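/- **Setting.** Let $\mathfrak L$ be a (finite or infinite) set of sites, $u_x=(\theta_x,\phi_x)$, $x\in\mathfrak L$, arbitrary unit vectors of $\mathbb R^3$ in spherical coordinates, and $J\in\frac12\{1,2,3,\dots\}$. On $\mathbb C^{2J+1}$ let $S=(S^1,S^2,S^3)$ be the spin-$J$ matrices in the usual basis $|m\rangle$, $S^\pm=S^1\pm iS^2$, and let $|(\theta,\phi)\rangle=e^{\frac12\theta(S^-e^{i\phi}-S^+e^{-i\phi})}|J\rangle$ be the coherent state in direction $(\theta,\phi)$. Let $\mathcal H_J$ be the incomplete tensor product of the spaces $(\mathbb C^{2J+1})_x$, $x\in\mathfrak L$, along the vector $\Omega_J=\bigotimes_x|(\theta_x,\phi_x)\rangle$ (the GNS space of the product state $\omega=\langle\Omega_J,\cdot\,\Omega_J\rangle$), and $S_x$ the spin at site $x$. For $v\in\ell^1_3(\mathfrak L)$, i.e. $v_x\in\mathbb R^3$ with $|v|_1=\sum_x|v_x|<\infty$, define the bounded operator $$F_J(v)=\sqrt{\tfrac2J}\sum_{x\in\mathfrak L}\bigl[v_x\cdot S_x-\omega(v_x\cdot S_x)\bigr].$$ Put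 $f^1_x=(\cos\theta_x\cos\phi_x,\cos\theta_x\sin\phi_x,-\sin\theta_x)$, $f^2_x=(-\sin\phi_x,\cos\phi_x,0)$, $\tilde S^-_x=f^1_x\cdot S_x-i\,f^2_x\cdot S_x$, and $\tilde v_x=f^1_x\cdot v_x+i\,f^2_x\cdot v_x\in\mathbb C$. Let $\mathcal F$ be the boson Fock space over $\ell^2(\mathfrak L)$ with vacuum $\tilde\Omega$, creation and annihilation operators $a_x^*,a_x$, and orthonormal basis $\tilde\phi_{\vec n}=\prod_x(n_x!)^{-1/2}(a_x^*)^{n_x}\tilde\Omega$ ($\sum_xn_x<\infty$). For $w\in\ell^2(\mathfrak L)$ let $F(w)=\sum_x[w_xa_x^*+\overline{w_x}a_x]$ be the self-adjoint boson field operator. Let $\mathcal D_n$ be the linear span of the vectors $F(w_1)\cdots F(w_n)\tilde\Omega$, $w_j\in\ell^2(\mathfrak L)$, and $\mathcal D$ the span of all $\mathcal D_n$, $n\ge0$. Products of unbounded operators have their natural domains. **Theorem.** (0) *Dyson identification.* For every $J$ there is a unique isometry $V_J:\mathcal H_J\to\mathcal F$ which maps $\phi_{\vec n}=\prod_x\frac1{n_x!}\binom{2J}{n_x}^{-1/2}(\tilde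 S_x^-)^{n_x}\Omega_J$ to $\tilde\phi_{\vec n}$ for all $\vec n$ with $n_x\le2J$ and $\sum_xn_x<\infty$, and whose range is the closed span $P_J\mathcal F$ of these $\tilde\phi_{\vec n}$. Below $F_J(v)$ is identified with the operator $V_JF_J(v)V_J^*$ on $\mathcal F$. Let $k\in\mathbb N$, $v_1,\dots,v_k\in\ell^1_3(\mathfrak L)$, $T_J=\prod_{j=1}^kF_J(v_j)$ and $T=\prod_{j=1}^kF(\tilde v_j)$. (1) For all $n\in\mathbb N$, $\psi_n\in\mathcal D_n$ and $J$ with $2J>n+k$, the vector $\psi_n$ is in the domain of $T$ and $$\Bigl\|\Bigl[\prod_{j=1}^kF(\tilde v_j)-\prod_{j=1}^kF_J(v_j)\Bigr]\psi_n\Bigr\|\le\frac1{(2J)^{1/2}}\Bigl[\prod_{j=1}^k|v_j|_1\Bigr]\Bigl[\frac{(n+k)!}{n!}\Bigr]^{1/2}\sum_{i=1}^k2^{k+i}(n+k-i)^{1/2}\,\|\psi_n\|.$$ (2) Let $J$ run through any sequence in $\frac12\{1,2,\dots\}$ tending to $\infty$. Then $T_J\to T$ in the following senses. - (a) $T_J\psi\to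 T\psi$ for every $\psi\in\mathcal D$. - (b) If $v_1=\dots=v_k$ (in particular if $k=1$), then $T_J$ and $T$ are self-adjoint and $T_J\to T$ in the strong resolvent sense, i.e. $(T_J-z)^{-1}\psi\to(T-z)^{-1}\psi$ for all $\psi\in\mathcal F$ and all non-real $z$. - (c) Whenever the $T_J$ are self-adjoint and $T$ is essentially self-adjoint on $\mathcal D$, $T_J\to\overline{T|_{\mathcal D}}$ in the strong resolvent sense. - (d) For arbitrary products: if $z\in\mathbb C$ is in the resolvent set of all the $T_J$, $\sup_J\|(T_J-z)^{-1}\|<\infty$, and $(T-z)\mathcal D$ is dense in $\mathcal F$, then $z$ is in the resolvent set of $\overline{T|_{\mathcal D}}$ and $(T_J-z)^{-1}\psi\to(\overline{T|_{\mathcal D}}-z)^{-1}\psi$ for all $\psi\in\mathcal F$. -/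

import Mathlib

open Filter Topology
open scoped ENNReal ComplexConjugate

noncomputable section

namespace SpinCLT

/-! ### Matrices of a single spin `J = N / 2`

The basis vector with index `i : Fin (N + 1)` is `|m⟩` with `m = J - i`; index `0` is `|J⟩`. -/

/-- The eigenvalue `m = J - i` of `S³`, where `J = N / 2`. -/
def magnetization (N i : ℕ) : ℝ := (N : ℝ) / 2 - i

/-- `S³ |m⟩ = m |m⟩`. -/
def spinZ (N : ℕ) : Matrix (Fin (N + 1)) (Fin (N + 1)) ℂ :=
  Matrix.diagonal fun i => ((magnetization N i : ℝ) : ℂ)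

/-- `S⁻ |m⟩ = √(J (J + 1) - m (m - 1)) |m - 1⟩`. -/
def spinMinus (N : ℕ) : Matrix (Fin (N + 1)) (Fin (N + 1)) ℂ :=
  Matrix.of fun i j =>
    if (i : ℕ) = j + 1 then
      ((Real.sqrt ((N : ℝ) / 2 * ((N : ℝ) / 2 + 1)
        - magnetization N j * (magnetization N j - 1)) : ℝ) : ℂ)
    else 0

/-- `S⁺ |m⟩ = √(J (J + 1) - m (m + 1)) |m + 1⟩`. -/
def spinPlus (N : ℕ) : Matrix (Fin (N + 1)) (Fin (N + 1)) ℂ :=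
  Matrix.of fun i j =>
    if (i : ℕ) + 1 = j then
      ((Real.sqrt ((N : ℝ) / 2 * ((N : ℝ) / 2 + 1)
        - magnetization N j * (magnetization N j + 1)) : ℝ) : ℂ)
    else 0

/-- `S¹ = (S⁺ + S⁻) / 2`. -/
def spinX (N : ℕ) : Matrix (Fin (N + 1)) (Fin (N + 1)) ℂ :=
  (1 / 2 : ℂ) • (spinPlus N + spinMinus N)

/-- `S² = (S⁺ - S⁻) / (2 i)`. -/
def spinY (N : ℕ) : Matrix (Fin (N + 1)) (Fin (N + 1)) ℂ :=
  (1 / (2 * Complex.I) : ℂ) • (spinPlus N - spinMinus N)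

/-- `a · S = a₁ S¹ + a₂ S² + a₃ S³`. -/
def spinDot (N : ℕ) (a : EuclideanSpace ℝ (Fin 3)) : Matrix (Fin (N + 1)) (Fin (N + 1)) ℂ :=
  (a 0 : ℂ) • spinX N + (a 1 : ℂ) • spinY N + (a 2 : ℂ) • spinZ N

/-- `U = exp (½ θ (S⁻ e^{iφ} - S⁺ e^{-iφ}))`; the coherent state is `|(θ, φ)⟩ = U |J⟩`. -/
def coherentU (N : ℕ) (θ φ : ℝ) : Matrix (Fin (N + 1)) (Fin (N + 1)) ℂ :=
  NormedSpace.exp ((θ / 2 : ℂ) •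
    (Complex.exp (Complex.I * φ) • spinMinus N - Complex.exp (-(Complex.I * φ)) • spinPlus N))

/-! ### The rotated frame at a site; its third vector is the classical spin `u = (θ, φ)` -/

/-- `f¹ = (cos θ cos φ, cos θ sin φ, - sin θ)`. -/
def frame1 (θ φ : ℝ) : EuclideanSpace ℝ (Fin 3) :=
  !₂[Real.cos θ * Real.cos φ, Real.cos θ * Real.sin φ, -Real.sin θ]

/-- `f² = (- sin φ, cos φ, 0)`. -/
def frame2 (φ : ℝ) : EuclideanSpace ℝ (Fin 3) :=
  !₂[-Real.sin φ, Real.cos φ, 0]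

/-! ### The incomplete tensor product (GNS) space -/

/-- Finitely supported occupation numbers with at most `N = 2J` at each site. -/
abbrev SpinConfig (L : Type*) (N : ℕ) : Type _ := {n : L →₀ ℕ // ∀ x, n x ≤ N}

/-- The incomplete tensor product `⨂ₓ (ℂ^{2J+1}, |(θₓ, φₓ)⟩)`, `J = N / 2`, i.e. the GNS space of
the product of the coherent states, written in coordinates: `ψ n` is the coefficient of `ψ` along
the product vector `⨂ₓ Uₓ |J - nₓ⟩`.  These product vectors, `n ∈ SpinConfig L N`, equal the
reference vector `Uₓ |J⟩ = |(θₓ, φₓ)⟩` at all but finitely many sites and form an orthonormal basis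
of the incomplete tensor product. -/
abbrev SpinSpace (L : Type*) (N : ℕ) : Type _ := lp (fun _ : SpinConfig L N => ℂ) 2

variable {L : Type*} {N : ℕ}

namespace SpinConfig

/-- The occupation number at `x` as an index of the single-site space. -/
def occ (n : SpinConfig L N) (x : L) : Fin (N + 1) := ⟨n.1 x, Nat.lt_succ_of_le (n.2 x)⟩

/-- Replace the occupation number at `x` by `m`. -/
def put (n : SpinConfig L N) (x : L) (m : Fin (N + 1)) : SpinConfig L N :=
  ⟨n.1.update x m, fun y => by
    classical
    rw [Finsupp.update_apply]
    split_ifs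
    · exact Nat.le_of_lt_succ m.2
    · exact n.2 y⟩

end SpinConfig

/-- Relabelling of coordinates along `σ` on a set `s`, and `0` outside `s`. -/
def relabel {I : Type*} (s : Set I) (σ : I → I) (hσ : Set.InjOn σ s) :
    lp (fun _ : I => ℂ) 2 →L[ℂ] lp (fun _ : I => ℂ) 2 :=
  have hsum : ∀ ψ : lp (fun _ : I => ℂ) 2, Summable fun n => ‖(ψ : I → ℂ) n‖ ^ 2 := fun ψ => by
    simpa using (lp.memℓp ψ).summable (by simp)
  have hnorm : ∀ (ψ : lp (fun _ : I => ℂ) 2) (n : I),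
      ‖s.indicator (fun n => (ψ : I → ℂ) (σ n)) n‖ ^ 2
        = s.indicator (fun n => ‖(ψ : I → ℂ) (σ n)‖ ^ 2) n := fun ψ n => by
    by_cases h : n ∈ s <;> simp [h]
  have hind : ∀ ψ : lp (fun _ : I => ℂ) 2,
      Summable (s.indicator fun n => ‖(ψ : I → ℂ) (σ n)‖ ^ 2) := fun ψ =>
    summable_subtype_iff_indicator.1
      ((hsum ψ).comp_injective (i := fun n : s => σ n) fun a b h =>
        Subtype.ext (hσ a.2 b.2 h))
  have hmem : ∀ ψ : lp (fun _ : I => ℂ) 2,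
      Memℓp (E := fun _ : I => ℂ) (s.indicator fun n => (ψ : I → ℂ) (σ n)) 2 := fun ψ =>
    memℓp_gen (by simpa [hnorm] using hind ψ)
  LinearMap.mkContinuous
    { toFun := fun ψ => ⟨s.indicator fun n => (ψ : I → ℂ) (σ n), hmem ψ⟩
      map_add' := fun ψ χ => by
        ext n
        change s.indicator (fun n => (ψ : I → ℂ) (σ n) + (χ : I → ℂ) (σ n)) n
          = s.indicator (fun n => (ψ : I → ℂ) (σ n)) n + s.indicator (fun n => (χ : I → ℂ) (σ n)) n
        by_cases h : n ∈ s <;> simp [h]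
      map_smul' := fun c ψ => by
        ext n
        by_cases h : n ∈ s <;> simp [h] } 1 fun ψ => by
    have h2 : (0 : ℝ) < (2 : ℝ≥0∞).toReal := by simp
    rw [one_mul]
    refine (sq_le_sq₀ (norm_nonneg _) (norm_nonneg _)).1 ?_
    have e1 := lp.norm_rpow_eq_tsum h2 ψ
    have e2 := lp.norm_rpow_eq_tsum (E := fun _ : I => ℂ) h2
      ⟨s.indicator fun n => (ψ : I → ℂ) (σ n), hmem ψ⟩
    simp only [ENNReal.toReal_ofNat, Real.rpow_ofNat] at e1 e2
    change ‖(⟨s.indicator fun n => (ψ : I → ℂ) (σ n), hmem ψ⟩ : lp (fun _ : I => ℂ) 2)‖ ^ 2 ≤ _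
    rw [e1, e2]
    simp only [hnorm]
    rw [← tsum_subtype s (fun n => ‖(ψ : I → ℂ) (σ n)‖ ^ 2)]
    exact tsum_comp_le_tsum_of_inj (hsum ψ) (fun _ => sq_nonneg _)
      (i := fun n : s => σ n) fun a b h => Subtype.ext (hσ a.2 b.2 h)

theorem relabel_apply {I : Type*} (s : Set I) (σ : I → I) (hσ : Set.InjOn σ s)
    (ψ : lp (fun _ : I => ℂ) 2) (n : I) :
    (relabel s σ hσ ψ : I → ℂ) n = s.indicator (fun n => (ψ : I → ℂ) (σ n)) n := rfl

theorem SpinConfig.put_injOn (x : L) (i m : Fin (N + 1)) :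
    Set.InjOn (fun n : SpinConfig L N => n.put x m) {n | n.occ x = i} := by
  classical
  intro n hn n' hn' h
  apply Subtype.ext
  ext y
  by_cases hy : y = x
  · subst hy
    have : n.occ y = n'.occ y := by
      exact Eq.trans (b := i) hn (Eq.symm hn')
    exact congrArg Fin.val this
  · have := congrArg (fun k : SpinConfig L N => k.1 y) h
    simpa [SpinConfig.put, Finsupp.update_apply, hy] using this

/-- The matrix `A` acting on the tensor factor at `x`, in the coordinates of `SpinSpace`. -/
def coordOp (x : L) (A : Matrix (Fin (N + 1)) (Fin (N + 1)) ℂ) :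
    SpinSpace L N →L[ℂ] SpinSpace L N :=
  ∑ i, ∑ m, A i m • relabel {n | n.occ x = i} (fun n => n.put x m) (SpinConfig.put_injOn x i m)

/-- `(A ψ)(n) = ∑ₘ A_{nₓ, m} ψ(n with nₓ replaced by m)`. -/
theorem coordOp_apply (x : L) (A : Matrix (Fin (N + 1)) (Fin (N + 1)) ℂ) (ψ : SpinSpace L N)
    (n : SpinConfig L N) :
    (coordOp x A ψ : SpinConfig L N → ℂ) n
      = ∑ m, A (n.occ x) m * (ψ : SpinConfig L N → ℂ) (n.put x m) := by
  have h : (coordOp x A ψ : SpinConfig L N → ℂ) n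
      = ∑ i, ∑ m, A i m * ({k : SpinConfig L N | k.occ x = i}.indicator
        (fun k => (ψ : SpinConfig L N → ℂ) (k.put x m)) n) := by
    have hs : ∀ f : Fin (N + 1) → SpinSpace L N, (∑ i, f i : SpinSpace L N) n = ∑ i, f i n :=
      fun f => by
        rw [lp.coeFn_sum]
        exact Finset.sum_apply n _ _
    simp only [coordOp, sum_apply, hs]
    rfl
  rw [h, Finset.sum_eq_single (n.occ x)]
  · simp
  · intro i _ hi
    simp [Set.indicator, Ne.symm hi]
  · simp

/-- The single-site observable `A` at `x` on the GNS space: its matrix in the basis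
`Uₓ |J - i⟩` of the tensor factor at `x` is `Uₓ* A Uₓ`. -/
def siteOp (θ φ : L → ℝ) (x : L) (A : Matrix (Fin (N + 1)) (Fin (N + 1)) ℂ) :
    SpinSpace L N →L[ℂ] SpinSpace L N :=
  coordOp x ((coherentU N (θ x) (φ x)).conjTranspose * A * coherentU N (θ x) (φ x))

open Classical in
/-- The GNS vector `Ω_J = ⨂ₓ |(θₓ, φₓ)⟩`. -/
def spinVacuum (L : Type*) (N : ℕ) : SpinSpace L N :=
  lp.single 2 (⟨0, fun _ => Nat.zero_le _⟩ : SpinConfig L N) 1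

/-- The product of coherent states, `ω(B) = ⟨Ω_J, B Ω_J⟩`. -/
def coherentState (B : SpinSpace L N →L[ℂ] SpinSpace L N) : ℂ :=
  inner ℂ (spinVacuum L N) (B (spinVacuum L N))

/-- The `ℝ³`-valued summable sequences on the lattice, with norm `|v|₁ = ∑ₓ |vₓ|`. -/
abbrev L1Three (L : Type*) : Type _ := lp (fun _ : L => EuclideanSpace ℝ (Fin 3)) 1

/-- The fluctuation operator `F_J(v) = √(2/J) ∑ₓ [vₓ · Sₓ - ω(vₓ · Sₓ)]`, `J = N / 2`; the series
converges in operator norm. -/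
def fluct (θ φ : L → ℝ) (N : ℕ) (v : L1Three L) : SpinSpace L N →L[ℂ] SpinSpace L N :=
  ((Real.sqrt (2 / ((N : ℝ) / 2)) : ℝ) : ℂ) •
    ∑' x, (siteOp θ φ x (spinDot N (v x))
      - coherentState (siteOp (N := N) θ φ x (spinDot N (v x))) • ContinuousLinearMap.id ℂ _)

/-- The rotated lowering operator `S̃⁻ₓ = f¹ₓ · Sₓ - i f²ₓ · Sₓ`. -/
def rotatedMinus (θ φ : L → ℝ) (N : ℕ) (x : L) : SpinSpace L N →L[ℂ] SpinSpace L N :=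
  siteOp θ φ x (spinDot N (frame1 (θ x) (φ x)) - Complex.I • spinDot N (frame2 (φ x)))

/-- `φ_n = ∏ₓ (1 / nₓ!) (2J choose nₓ)^{-1/2} (S̃⁻ₓ)^{nₓ} Ω_J` (the factors commute). -/
def spinBasis (θ φ : L → ℝ) (N : ℕ) (n : SpinConfig L N) : SpinSpace L N :=
  (n.1.support.toList.map fun x =>
    (((((n.1 x).factorial : ℝ)⁻¹ * (Real.sqrt (N.choose (n.1 x)))⁻¹ : ℝ)) : ℂ) •
      rotatedMinus θ φ N x ^ (n.1 x)).prod (spinVacuum L N)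

/-! ### Boson Fock space -/

/-- Boson Fock space over `ℓ²(L)` in the occupation number representation: `ψ n` is the
coefficient of `ψ` along `∏ₓ (nₓ!)^{-1/2} (a*ₓ)^{nₓ} Ω̃`. -/
abbrev FockSpace (L : Type*) : Type _ := lp (fun _ : L →₀ ℕ => ℂ) 2

open Classical in
/-- The basis vector `φ̃_n = ∏ₓ (nₓ!)^{-1/2} (a*ₓ)^{nₓ} Ω̃`. -/
def fockBasis (n : L →₀ ℕ) : FockSpace L := lp.single 2 n 1

/-- `a*ₓ` on coefficient functions: `a*ₓ φ̃_n = √(nₓ + 1) φ̃_{n + δₓ}`. -/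
def creation (x : L) (ψ : (L →₀ ℕ) → ℂ) (n : L →₀ ℕ) : ℂ :=
  (Real.sqrt (n x) : ℂ) * ψ (n - Finsupp.single x 1)

/-- `aₓ` on coefficient functions: `aₓ φ̃_n = √nₓ φ̃_{n - δₓ}`. -/
def annihilation (x : L) (ψ : (L →₀ ℕ) → ℂ) (n : L →₀ ℕ) : ℂ :=
  (Real.sqrt (n x + 1) : ℂ) * ψ (n + Finsupp.single x 1)

/-- The terms, at the coordinate `n`, of `∑ₓ [wₓ a*ₓ + conj wₓ aₓ] ψ`. -/
def fieldTerm (w : L → ℂ) (ψ : (L →₀ ℕ) → ℂ) (n : L →₀ ℕ) (x : L) : ℂ :=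
  w x * creation x ψ n + conj (w x) * annihilation x ψ n

theorem fieldTerm_add (w : L → ℂ) (ψ χ : (L →₀ ℕ) → ℂ) (n : L →₀ ℕ) :
    fieldTerm w (ψ + χ) n = fieldTerm w ψ n + fieldTerm w χ n := by
  funext x
  simp [fieldTerm, creation, annihilation]
  ring

theorem fieldTerm_smul (w : L → ℂ) (c : ℂ) (ψ : (L →₀ ℕ) → ℂ) (n : L →₀ ℕ) :
    fieldTerm w (c • ψ) n = c • fieldTerm w ψ n := by
  funext x
  simp [fieldTerm, creation, annihilation]
  ring

/-- The vectors of Fock space on which `∑ₓ [wₓ a*ₓ + conj wₓ aₓ]` is a vector of Fock space. -/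
def fieldDomain (w : L → ℂ) : Submodule ℂ (FockSpace L) where
  carrier := {ψ | (∀ n, Summable (fieldTerm w ψ n)) ∧
    Memℓp (E := fun _ : L →₀ ℕ => ℂ) (fun n => ∑' x, fieldTerm w ψ n x) 2}
  zero_mem' := by
    have h : ∀ n, fieldTerm w (0 : (L →₀ ℕ) → ℂ) n = 0 := fun n => by
      funext x
      simp [fieldTerm, creation, annihilation]
    refine ⟨fun n => ?_, ?_⟩
    · rw [lp.coeFn_zero, h]
      exact summable_zero
    · simp only [lp.coeFn_zero, h, Pi.zero_apply, tsum_zero]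
      exact zero_memℓp
  add_mem' := by
    rintro ψ χ ⟨h1, h2⟩ ⟨h3, h4⟩
    refine ⟨fun n => ?_, ?_⟩
    · rw [lp.coeFn_add, fieldTerm_add]
      exact (h1 n).add (h3 n)
    · have h : (fun n => ∑' x, fieldTerm w (ψ + χ : FockSpace L) n x)
          = (fun n => ∑' x, fieldTerm w ψ n x) + fun n => ∑' x, fieldTerm w χ n x := by
        funext n
        rw [lp.coeFn_add, fieldTerm_add]
        exact (h1 n).tsum_add (h3 n)
      rw [h]
      exact h2.add h4
  smul_mem' := by
    rintro c ψ ⟨h1, h2⟩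
    refine ⟨fun n => ?_, ?_⟩
    · rw [lp.coeFn_smul, fieldTerm_smul]
      exact (h1 n).const_smul c
    · have h : (fun n => ∑' x, fieldTerm w (c • ψ : FockSpace L) n x)
          = c • fun n => ∑' x, fieldTerm w ψ n x := by
        funext n
        rw [lp.coeFn_smul, fieldTerm_smul]
        exact (h1 n).tsum_const_smul c
      rw [h]
      exact h2.const_smul c

/-- The boson field operator `F(w) = ∑ₓ [wₓ a*ₓ + conj wₓ aₓ]` on its maximal domain (for
`w ∈ ℓ²(L)` this is the self-adjoint field operator). -/
def fieldOp (w : L → ℂ) : FockSpace L →ₗ.[ℂ] FockSpace L where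
  domain := fieldDomain w
  toFun :=
    { toFun := fun ψ => ⟨fun n => ∑' x, fieldTerm w (ψ : FockSpace L) n x, ψ.2.2⟩
      map_add' := fun ψ χ => by
        ext n
        simp only [Submodule.coe_add, lp.coeFn_add, fieldTerm_add, Pi.add_apply]
        exact (ψ.2.1 n).tsum_add (χ.2.1 n)
      map_smul' := fun c ψ => by
        ext n
        simp only [Submodule.coe_smul, lp.coeFn_smul, fieldTerm_smul, Pi.smul_apply,
          RingHom.id_apply]
        exact (ψ.2.1 n).tsum_const_smul c }

/-- `ṽₓ = ṽ⁺ₓ = f¹ₓ · vₓ + i f²ₓ · vₓ`, the projection of `vₓ` onto the tangent plane at `uₓ`. -/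
def tangent (θ φ : L → ℝ) (v : L1Three L) (x : L) : ℂ :=
  (inner ℝ (frame1 (θ x) (φ x)) (v x) : ℝ) + Complex.I * (inner ℝ (frame2 (φ x)) (v x) : ℝ)

/-! ### Unbounded operators -/

section Operators

variable {E : Type*} [NormedAddCommGroup E] [InnerProductSpace ℂ E]

/-- The product `S T` on its natural domain `{ψ ∈ dom T | T ψ ∈ dom S}`. -/
def natMul (S T : E →ₗ.[ℂ] E) : E →ₗ.[ℂ] E :=
  S.comp (T.domRestrict ((S.domain.comap T.toFun).map T.domain.subtype)) <| by
    rintro ⟨ψ, hψ, hT⟩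
    obtain ⟨χ, hχ, rfl⟩ := hψ
    exact hχ

/-- A bounded operator as an everywhere defined partial operator. -/
def everywhere (A : E →L[ℂ] E) : E →ₗ.[ℂ] E := (A : E →ₗ[ℂ] E).toPMap ⊤

/-- The product `T₁ T₂ ⋯ T_k` on its natural domain. -/
def natProd {k : ℕ} (T : Fin k → E →ₗ.[ℂ] E) : E →ₗ.[ℂ] E :=
  (List.ofFn T).foldr natMul (everywhere (ContinuousLinearMap.id ℂ E))

/-- `R = (T - z)⁻¹` is a bounded, everywhere defined two-sided inverse of `T - z`. -/
def IsResolvent (T : E →ₗ.[ℂ] E) (z : ℂ) (R : E →L[ℂ] E) : Prop :=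
  (∀ ψ : E, ∃ h : R ψ ∈ T.domain, T ⟨R ψ, h⟩ - z • R ψ = ψ) ∧
    ∀ ψ : T.domain, R (T ψ - z • (ψ : E)) = ψ

/-- Strong resolvent convergence of bounded self-adjoint operators `A m` to a (possibly unbounded)
self-adjoint operator `T`: `(A m - z)⁻¹ ψ → (T - z)⁻¹ ψ` for all `ψ` and all non-real `z`. -/
def StrongResolventTendsto [CompleteSpace E] (A : ℕ → E →L[ℂ] E) (T : E →ₗ.[ℂ] E) : Prop :=
  (∀ m, IsSelfAdjoint (A m)) ∧ IsSelfAdjoint T ∧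
    ∀ z : ℂ, z.im ≠ 0 → ∃ (R : ℕ → E →L[ℂ] E) (R' : E →L[ℂ] E),
      (∀ m, IsResolvent (everywhere (A m)) z (R m)) ∧ IsResolvent T z R' ∧
        ∀ ψ, Tendsto (fun m => R m ψ) atTop (𝓝 (R' ψ))

end Operators

/-! ### Finite-particle vectors, the Dyson identification -/

/-- `F(w₁) ⋯ F(w_n)`, on its natural domain. -/
def fieldProd {n : ℕ} (w : Fin n → L → ℂ) : FockSpace L →ₗ.[ℂ] FockSpace L :=
  natProd fun j => fieldOp (w j)

/-- `𝒟_n`, the linear span of the vectors `F(w₁) ⋯ F(w_n) Ω̃` with `w₁, …, w_n ∈ ℓ²(L)`. -/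
def finiteParticle (L : Type*) (n : ℕ) : Submodule ℂ (FockSpace L) :=
  Submodule.span ℂ {ψ | ∃ w : Fin n → L → ℂ,
    (∀ j, Memℓp (E := fun _ : L => ℂ) (w j) 2) ∧
      ∃ h : fockBasis 0 ∈ (fieldProd w).domain, fieldProd w ⟨fockBasis 0, h⟩ = ψ}

/-- `𝒟`, the span of all the `𝒟_n`. -/
def allFiniteParticle (L : Type*) : Submodule ℂ (FockSpace L) := ⨆ n, finiteParticle L n

/-- `F(w₁) ⋯ F(w_k)` restricted to `𝒟`. -/
def fieldProdCore {k : ℕ} (w : Fin k → L → ℂ) : FockSpace L →ₗ.[ℂ] FockSpace L :=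
  (fieldProd w).domRestrict (allFiniteParticle L)

/-- `V` is the Dyson identification of the spin-`N/2` space with the subspace of Fock space with
at most `N` bosons at each site: it sends `φ_n` to `φ̃_n`, and its range is `P_J` of Fock space. -/
def IsDyson (θ φ : L → ℝ) (N : ℕ) (V : SpinSpace L N →ₗᵢ[ℂ] FockSpace L) : Prop :=
  (∀ n : SpinConfig L N, V (spinBasis θ φ N n) = fockBasis n.1) ∧
    ∀ ψ : FockSpace L, ψ ∈ Set.range V ↔
      ∀ n : L →₀ ℕ, (∃ x, N < n x) → (ψ : (L →₀ ℕ) → ℂ) n = 0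

/-- The operator `V B V*` on Fock space, which is `B` on the range of `V` and `0` on its
orthogonal complement. -/
def transport (V : SpinSpace L N →ₗᵢ[ℂ] FockSpace L) (B : SpinSpace L N →L[ℂ] SpinSpace L N) :
    FockSpace L →L[ℂ] FockSpace L :=
  V.toContinuousLinearMap ∘L B ∘L V.toContinuousLinearMap.adjoint

/-- `F_J(v₁) ⋯ F_J(v_k)` as an operator on Fock space. -/
def fluctProd (θ φ : L → ℝ) (V : SpinSpace L N →ₗᵢ[ℂ] FockSpace L) {k : ℕ}
    (v : Fin k → L1Three L) : FockSpace L →L[ℂ] FockSpace L :=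
  (List.ofFn fun j => transport V (fluct θ φ N (v j))).prod

end SpinCLT
end

/-!
The spin system is carried to Fock space by the Dyson map, and everything after that is an estimate
on sequences `ψ : (L →₀ ℕ) → ℂ`. Write `N = 2J`.

*The boson picture.* Conjugation by the rotation `coherentU` brings `v · S` to
`½ (τ e^{iφ} S⁻ + conj τ e^{-iφ} S⁺) + (u · v) S³`, with `τ = f¹ · v + i f² · v` and `u` the
direction of the coherent state (`coherentU_conj_spinDot`). Hence the vectors `φ_n` are the
coordinate vectors up to phases (`spinBasis_eq`), the Dyson map is a phase times extension by zero
(`exists_isDyson`), and on vectors with fewer than `N` bosons the fluctuation operator is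
`∑ₓ [τₓ a*ₓ √(1 - nₓ / N) + conj τₓ √(1 - nₓ / N) aₓ - (2 / √N) (uₓ · vₓ) nₓ]`
(`hasSum_transport_fluct`).

*The bound.* On vectors with at most `m` bosons the field is bounded by `2 √(m + 1)` times
`∑ₓ ‖wₓ‖`, the fluctuation operator by `4 √(m + 1) |v|₁`, and their difference by
`4 √(m + 1) √m / √N · |v|₁` (`norm_fieldOp_le`, `norm_transport_fluct_le`,
`norm_fieldOp_sub_transport_fluct_le`). Each factor adds at most one boson, so splitting off the
leading factor and inducting on `k` gives the estimate for products
(`exists_fieldProd_sub_fluctProd_bound`), and with it strong convergence on the number-bounded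
vectors (`tendsto_fluctProd`).

*Resolvents.* If bounded resolvents `(T_m - z)⁻¹` are uniformly bounded, `T_m → T₀` strongly on the
domain of `T₀`, and `T₀ - z` has dense range, then the resolvents converge strongly to the resolvent
of the closure of `T₀` (`exists_tendsto_resolvent`, `isResolvent_closure`). The product of fields is
closable because the product in the reversed order is a densely defined formal adjoint
(`isClosable_fieldProdCore`); the symmetry needed here is never computed on Fock space but inherited
from the self-adjoint bounded operators `F_J`. This settles essentially self-adjoint products and
products with bounded resolvents.

*Powers of one field.* The field is defined on its maximal domain, so what has to be excluded is an
eigenvector `F(w) ψ = z ψ` with `z` not real. With `ψ_m` the component of `ψ` with `m` bosons,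
pairing the equation with the truncation of `ψ` to at most `m` bosons leaves only a boundary term:
`|Im z| ∑_{j ≤ m} ‖ψ_j‖²` is at most a constant times `√(m + 2) ‖ψ_m‖ ‖ψ_{m+1}‖`. Since
`∑ 1 / √m` diverges while `∑ ‖ψ_m‖ ‖ψ_{m+1}‖` converges, `ψ = 0`
(`eq_zero_of_fieldOp_eigenvector`), the argument behind Carleman's criterion for Jacobi matrices.
Strong resolvent convergence for `k = 1` follows (`strongResolventTendsto_fieldOp`). It passes to
`k`-th powers through `(A ^ k - z)⁻¹ = ∏ (A - ζ)⁻¹`, the product over the `k`-th roots `ζ` of `z`,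
none of which is real (`StrongResolventTendsto.natProd_const`).
-/

noncomputable section

namespace SpinCLT

/-! ### Resolvents and strong resolvent convergence -/

section Resolvents

variable {E : Type*} [NormedAddCommGroup E] [InnerProductSpace ℂ E]

theorem isResolvent_everywhere_iff {A R : E →L[ℂ] E} {z : ℂ} :
    IsResolvent (everywhere A) z R ↔
      (∀ ψ, A (R ψ) - z • R ψ = ψ) ∧ ∀ ψ, R (A ψ - z • ψ) = ψ := by
  constructor
  · rintro ⟨h1, h2⟩
    exact ⟨fun ψ => (h1 ψ).2, fun ψ => h2 ⟨ψ, trivial⟩⟩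
  · rintro ⟨h1, h2⟩
    exact ⟨fun ψ => ⟨trivial, h1 ψ⟩, fun ψ => h2 ψ⟩

theorem isResolvent_of_graph {T : E →ₗ.[ℂ] E} {z : ℂ} {R : E →L[ℂ] E}
    (h1 : ∀ ψ, (R ψ, ψ + z • R ψ) ∈ T.graph) (h2 : ∀ ψ : T.domain, R (T ψ - z • (ψ : E)) = ψ) :
    IsResolvent T z R := by
  refine ⟨fun ψ => ?_, h2⟩
  obtain ⟨⟨y, hy⟩, hy1, hy2⟩ := (LinearPMap.mem_graph_iff T).1 (h1 ψ)
  dsimp only at hy1 hy2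
  subst hy1
  exact ⟨hy, by rw [hy2]; abel⟩

/-- The range of `T - z`, as a submodule. -/
def shiftRange (T : E →ₗ.[ℂ] E) (z : ℂ) : Submodule ℂ E :=
  LinearMap.range (T.toFun - z • T.domain.subtype)

theorem mem_shiftRange {T : E →ₗ.[ℂ] E} {z : ℂ} {χ : E} :
    χ ∈ shiftRange T z ↔ ∃ ψ : T.domain, T ψ - z • (ψ : E) = χ := Iff.rfl

theorem cauchySeq_of_dense {R : ℕ → E →L[ℂ] E} {C : ℝ} (hC : ∀ m, ‖R m‖ ≤ C) {s : Set E}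
    (hs : Dense s) (h : ∀ χ ∈ s, CauchySeq fun m => R m χ) (ψ : E) :
    CauchySeq fun m => R m ψ := by
  have hC0 : 0 ≤ C := (norm_nonneg _).trans (hC 0)
  rw [Metric.cauchySeq_iff']
  intro ε hε
  obtain ⟨χ, hχ, hd⟩ := hs.exists_dist_lt ψ (ε := ε / (3 * (C + 1))) (by positivity)
  obtain ⟨M, hM⟩ := Metric.cauchySeq_iff'.1 (h χ hχ) (ε / 3) (by positivity)
  refine ⟨M, fun m hm => ?_⟩
  have key : ∀ j, dist (R j ψ) (R j χ) < ε / 3 := fun j => by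
    rw [dist_eq_norm, ← map_sub]
    calc ‖R j (ψ - χ)‖ ≤ C * ‖ψ - χ‖ := (R j).le_of_opNorm_le (hC j) _
      _ ≤ (C + 1) * ‖ψ - χ‖ := by gcongr; linarith
      _ < (C + 1) * (ε / (3 * (C + 1))) := by
        rw [← dist_eq_norm]; gcongr
      _ = ε / 3 := by field_simp
  have := dist_triangle4 (R m ψ) (R m χ) (R M χ) (R M ψ)
  have h1 := key m
  have h2 := key M
  rw [dist_comm] at h2
  have h3 := hM m hm
  linarith

/-- A bounded operator that inverts `T₀ - z` on the domain of `T₀`, with graph in the closure of that of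
`T₀`, is a resolvent of the closure. -/
theorem isResolvent_closure {T₀ : E →ₗ.[ℂ] E} (hc : T₀.IsClosable) {z : ℂ} {R' : E →L[ℂ] E}
    (h1 : ∀ ψ : T₀.domain, R' (T₀ ψ - z • (ψ : E)) = ψ)
    (h2 : ∀ ψ, (R' ψ, ψ + z • R' ψ) ∈ closure (T₀.graph : Set (E × E))) :
    IsResolvent T₀.closure z R' := by
  have hg : closure (T₀.graph : Set (E × E)) = T₀.closure.graph := by
    rw [← hc.graph_closure_eq_closure_graph]; rfl
  refine isResolvent_of_graph (fun ψ => by simpa [hg] using h2 ψ) fun ψ => ?_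
  have hcl : IsClosed {p : E × E | R' (p.2 - z • p.1) = p.1} :=
    isClosed_eq (by fun_prop) (by fun_prop)
  have hsub : closure (T₀.graph : Set (E × E)) ⊆ {p : E × E | R' (p.2 - z • p.1) = p.1} := by
    refine closure_minimal ?_ hcl
    rintro ⟨a, b⟩ hp
    obtain ⟨y, hy1, hy2⟩ := (LinearPMap.mem_graph_iff T₀).1 hp
    dsimp only at hy1 hy2
    subst hy1 hy2
    exact h1 y
  have := T₀.closure.mem_graph ψ
  exact hsub (by rw [hg]; exact this)

/-- A bound `|Im z| ‖ψ‖ ≤ ‖(A - z) ψ‖` for vectors at which `A` has a real expectation. -/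
theorem abs_im_mul_norm_le {z : ℂ} {ψ η : E} (h : (inner ℂ ψ η).im = 0) :
    |z.im| * ‖ψ‖ ≤ ‖η - z • ψ‖ := by
  by_cases h0 : ψ = 0
  · simp [h0]
  have h1 : ‖inner ℂ ψ (η - z • ψ)‖ ≤ ‖ψ‖ * ‖η - z • ψ‖ := norm_inner_le_norm _ _
  have h2 : |(inner ℂ ψ (η - z • ψ)).im| = |z.im| * ‖ψ‖ ^ 2 := by
    rw [inner_sub_right, inner_smul_right, inner_self_eq_norm_sq_to_K, Complex.sub_im, h]
    rw [zero_sub, abs_neg, ← abs_of_nonneg (sq_nonneg ‖ψ‖), ← abs_mul]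
    congr 1
    have : ((‖ψ‖ : ℂ)) ^ 2 = ((‖ψ‖ ^ 2 : ℝ) : ℂ) := by push_cast; rfl
    change (z * (‖ψ‖ : ℂ) ^ 2).im = _
    rw [this, Complex.im_mul_ofReal]
  have h3 := (Complex.abs_im_le_norm _).trans h1
  rw [h2] at h3
  have hpos : 0 < ‖ψ‖ := norm_pos_iff.2 h0
  nlinarith

variable [CompleteSpace E]

/-- If bounded operators `T m` with uniformly bounded resolvents at `z` converge strongly to `T₀`
and `T₀ - z` has dense range, then the resolvents converge strongly, and the limit inverts
`T₀ - z` up to closure of the graph. -/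
theorem exists_tendsto_resolvent {T R : ℕ → E →L[ℂ] E} {C : ℝ} {z : ℂ} {T₀ : E →ₗ.[ℂ] E}
    (hR : ∀ m, IsResolvent (everywhere (T m)) z (R m)) (hC : ∀ m, ‖R m‖ ≤ C)
    (hT : ∀ ψ : T₀.domain, Tendsto (fun m => T m ψ) atTop (𝓝 (T₀ ψ)))
    (hd : Dense (shiftRange T₀ z : Set E)) :
    ∃ R' : E →L[ℂ] E, (∀ ψ, Tendsto (fun m => R m ψ) atTop (𝓝 (R' ψ))) ∧
      (∀ ψ : T₀.domain, R' (T₀ ψ - z • (ψ : E)) = ψ) ∧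
      ∀ ψ, (R' ψ, ψ + z • R' ψ) ∈ closure (T₀.graph : Set (E × E)) := by
  have hlim : ∀ ψ : T₀.domain,
      Tendsto (fun m => R m (T₀ ψ - z • (ψ : E))) atTop (𝓝 (ψ : E)) := fun ψ => by
    have h1 : Tendsto (fun m => C * ‖T₀ ψ - T m ψ‖) atTop (𝓝 0) := by
      have := ((tendsto_const_nhds (x := T₀ ψ)).sub (hT ψ)).norm.const_mul C
      simpa using this
    rw [tendsto_iff_norm_sub_tendsto_zero]
    refine squeeze_zero (fun _ => norm_nonneg _) (fun m => ?_) h1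
    have h2 := (isResolvent_everywhere_iff.1 (hR m)).2 ψ
    have h3 : R m (T₀ ψ - z • (ψ : E)) - ψ = R m (T₀ ψ - T m ψ) := by
      nth_rewrite 2 [← h2]
      rw [← map_sub]
      congr 1
      abel
    rw [h3]
    exact (R m).le_of_opNorm_le (hC m) _
  have hcauchy := cauchySeq_of_dense hC hd (by
    intro χ hχ
    obtain ⟨ψ, rfl⟩ := mem_shiftRange.1 hχ
    exact (hlim ψ).cauchySeq)
  choose f hf using fun ψ => cauchySeq_tendsto_of_complete (hcauchy ψ)
  let R' : E →L[ℂ] E := continuousLinearMapOfTendsto R (tendsto_pi_nhds.2 hf)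
  have hR' : ∀ ψ, Tendsto (fun m => R m ψ) atTop (𝓝 (R' ψ)) := hf
  have hinv : ∀ ψ : T₀.domain, R' (T₀ ψ - z • (ψ : E)) = ψ := fun ψ =>
    tendsto_nhds_unique (hR' _) (hlim ψ)
  refine ⟨R', hR', hinv, fun ψ => ?_⟩
  have hcont : Continuous fun ψ => (R' ψ, ψ + z • R' ψ) := by fun_prop
  refine map_mem_closure (f := fun ψ => (R' ψ, ψ + z • R' ψ)) hcont (hd ψ) ?_
  intro χ hχ
  obtain ⟨η, rfl⟩ := mem_shiftRange.1 hχ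
  refine (LinearPMap.mem_graph_iff T₀).2 ⟨η, (hinv η).symm, ?_⟩
  dsimp only
  rw [hinv η]
  abel

theorem isClosable_of_formalAdjoint {T S : E →ₗ.[ℂ] E} (hS : Dense (S.domain : Set E))
    (h : S.IsFormalAdjoint T) : T.IsClosable :=
  LinearPMap.isClosable_iff_exists_closed_extension.2
    ⟨S.adjoint, LinearPMap.adjoint_isClosed hS, h.le_adjoint hS⟩

theorem inner_selfAdjoint {A : E →L[ℂ] E} (hA : IsSelfAdjoint A) (ψ χ : E) :
    inner ℂ (A ψ) χ = inner ℂ ψ (A χ) := by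
  conv_rhs => rw [← hA.adjoint_eq]
  rw [ContinuousLinearMap.adjoint_inner_right]

theorem im_inner_selfAdjoint {A : E →L[ℂ] E} (hA : IsSelfAdjoint A) (ψ : E) :
    (inner ℂ ψ (A ψ)).im = 0 := by
  rw [← Complex.conj_eq_iff_im, inner_conj_symm]
  exact inner_selfAdjoint hA ψ ψ

theorem exists_isResolvent_of_isSelfAdjoint {A : E →L[ℂ] E} (hA : IsSelfAdjoint A) {z : ℂ}
    (hz : z.im ≠ 0) :
    ∃ R : E →L[ℂ] E, IsResolvent (everywhere A) z R ∧ ‖R‖ ≤ |z.im|⁻¹ := by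
  have hu : IsUnit (algebraMap ℂ (E →L[ℂ] E) z - A) := by
    by_contra h
    have := IsSelfAdjoint.mem_spectrum_eq_re hA h
    exact hz (by rw [this]; simp)
  obtain ⟨u, hu⟩ := hu
  have e1 : ∀ ψ, (u : E →L[ℂ] E) ψ = z • ψ - A ψ := fun ψ => by
    rw [hu]; simp [Algebra.algebraMap_eq_smul_one]
  have e2 : ∀ ψ, (u : E →L[ℂ] E) ((↑u⁻¹ : E →L[ℂ] E) ψ) = ψ := fun ψ => by
    rw [← mul_apply_eq_comp, u.mul_inv]; rfl
  have e3 : ∀ ψ, (↑u⁻¹ : E →L[ℂ] E) ((u : E →L[ℂ] E) ψ) = ψ := fun ψ => by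
    rw [← mul_apply_eq_comp, u.inv_mul]; rfl
  have key : ∀ ψ, A ((-(↑u⁻¹ : E →L[ℂ] E)) ψ) - z • (-(↑u⁻¹ : E →L[ℂ] E)) ψ = ψ := fun ψ => by
    have := e2 ψ
    rw [e1] at this
    rw [neg_apply, map_neg, smul_neg, sub_neg_eq_add, neg_add_eq_sub, this]
  refine ⟨-(↑u⁻¹ : E →L[ℂ] E), isResolvent_everywhere_iff.2 ⟨key, fun ψ => ?_⟩, ?_⟩
  · have := e3 ψ
    rw [e1] at this
    rw [neg_apply, ← map_neg, neg_sub, this]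
  · refine ContinuousLinearMap.opNorm_le_bound _ (by positivity) fun ψ => ?_
    have h := abs_im_mul_norm_le (z := z) (im_inner_selfAdjoint hA ((-(↑u⁻¹ : E →L[ℂ] E)) ψ))
    rw [key] at h
    have hz' : 0 < |z.im| := abs_pos.2 hz
    rw [← div_eq_inv_mul, le_div_iff₀ hz', mul_comm]
    exact h

/-- A partial operator is self-adjoint as soon as it has resolvents at a point and at its complex
conjugate which are adjoint to each other. -/
theorem isSelfAdjoint_of_isResolvent {T : E →ₗ.[ℂ] E} {z : ℂ} {R S : E →L[ℂ] E}
    (hR : IsResolvent T z R) (hS : IsResolvent T (conj z) S)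
    (hRS : ∀ ψ χ, inner ℂ (R ψ) χ = inner ℂ ψ (S χ)) : IsSelfAdjoint T := by
  have hdense : Dense (T.domain : Set E) := by
    rw [Submodule.dense_iff_topologicalClosure_eq_top, Submodule.topologicalClosure_eq_top_iff,
      Submodule.eq_bot_iff]
    intro χ hχ
    have h1 : S χ = 0 := by
      refine ext_inner_left ℂ fun ψ => ?_
      rw [← hRS, inner_zero_right]
      exact (Submodule.mem_orthogonal _ _).1 hχ _ (hR.1 ψ).1
    obtain ⟨h2, h3⟩ := hS.1 χ
    have h4 : T ⟨S χ, h2⟩ = 0 := by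
      have : (⟨S χ, h2⟩ : T.domain) = 0 := Subtype.ext h1
      rw [this, LinearPMap.map_zero]
    rw [h4, h1] at h3
    simpa using h3.symm
  have hsym : T.IsFormalAdjoint T := fun ψ χ => by
    have h1 := hR.2 ψ
    have h2 := hS.2 χ
    have h3 := hRS (T ψ - z • (ψ : E)) (T χ - conj z • (χ : E))
    rw [h1, h2, inner_sub_left, inner_sub_right, inner_smul_left, inner_smul_right] at h3
    linear_combination -h3
  rw [LinearPMap.isSelfAdjoint_def]
  refine le_antisymm ?_ (hsym.le_adjoint hdense)
  have hdom : T.adjoint.domain ≤ T.domain := fun χ hχ => by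
    set η := T.adjoint ⟨χ, hχ⟩ with hη
    have hadj : ∀ ψ : T.domain, inner ℂ η (ψ : E) = inner ℂ χ (T ψ) := fun ψ =>
      LinearPMap.adjoint_isFormalAdjoint hdense ⟨χ, hχ⟩ ψ
    have : S (η - conj z • χ) = χ := by
      refine ext_inner_left ℂ fun f => ?_
      obtain ⟨h1, h2⟩ := hR.1 f
      rw [← hRS, inner_sub_right, inner_smul_right, ← inner_conj_symm, hadj ⟨R f, h1⟩,
        inner_conj_symm]
      conv_rhs => rw [← h2]
      rw [inner_sub_left, inner_smul_left]
    rw [← this]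
    exact (hS.1 _).1
  refine ⟨hdom, fun x y hxy => ?_⟩
  refine LinearPMap.adjoint_apply_eq hdense x fun ψ => ?_
  rw [hsym y ψ, hxy]

/-- Strong resolvent convergence follows from strong convergence of the resolvents to resolvents;
the self-adjointness of the limit is automatic. -/
theorem strongResolventTendsto_of_tendsto {A : ℕ → E →L[ℂ] E} {T : E →ₗ.[ℂ] E}
    (hA : ∀ m, IsSelfAdjoint (A m))
    (h : ∀ z : ℂ, z.im ≠ 0 → ∃ (R : ℕ → E →L[ℂ] E) (R' : E →L[ℂ] E),
      (∀ m, IsResolvent (everywhere (A m)) z (R m)) ∧ IsResolvent T z R' ∧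
        ∀ ψ, Tendsto (fun m => R m ψ) atTop (𝓝 (R' ψ))) :
    StrongResolventTendsto A T := by
  refine ⟨hA, ?_, h⟩
  obtain ⟨R, R', h1, h2, h3⟩ := h Complex.I (by simp)
  obtain ⟨S, S', g1, g2, g3⟩ := h (conj Complex.I) (by simp)
  refine isSelfAdjoint_of_isResolvent h2 g2 fun ψ χ => ?_
  have e : ∀ m, inner ℂ (R m ψ) χ = inner ℂ ψ (S m χ) := fun m => by
    have e1 := (isResolvent_everywhere_iff.1 (h1 m)).1 ψ
    have e2 := (isResolvent_everywhere_iff.1 (g1 m)).1 χ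
    conv_lhs => rw [← e2]
    conv_rhs => rw [← e1]
    rw [inner_sub_left, inner_sub_right, inner_smul_left, inner_smul_right,
      inner_selfAdjoint (hA m)]
  refine tendsto_nhds_unique ((h3 ψ).inner tendsto_const_nhds) ?_
  simp only [e]
  exact tendsto_const_nhds.inner (g3 χ)

theorem dense_shiftRange_iff {T : E →ₗ.[ℂ] E} {z : ℂ} :
    Dense (shiftRange T z : Set E) ↔
      ∀ χ, (∀ ψ : T.domain, inner ℂ (T ψ - z • (ψ : E)) χ = 0) → χ = 0 := by
  rw [Submodule.dense_iff_topologicalClosure_eq_top, Submodule.topologicalClosure_eq_top_iff,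
      Submodule.eq_bot_iff]
  refine forall_congr' fun χ => ?_
  rw [Submodule.mem_orthogonal]
  refine imp_congr ⟨fun h ψ => h _ ⟨ψ, rfl⟩, fun h u hu => ?_⟩ Iff.rfl
  obtain ⟨ψ, rfl⟩ := hu
  exact h ψ

/-- Bounded self-adjoint operators that converge strongly on the domain of an essentially
self-adjoint operator converge to its closure in the strong resolvent sense. -/
theorem strongResolventTendsto_closure {A : ℕ → E →L[ℂ] E} {T₀ : E →ₗ.[ℂ] E}
    (hA : ∀ m, IsSelfAdjoint (A m)) (hT₀ : IsSelfAdjoint T₀.closure)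
    (hT : ∀ ψ : T₀.domain, Tendsto (fun m => A m ψ) atTop (𝓝 (T₀ ψ))) :
    StrongResolventTendsto A T₀.closure := by
  have hc : T₀.IsClosable := by
    by_contra h
    rw [LinearPMap.closure_def' h] at hT₀
    exact h hT₀.isClosed.isClosable
  have hg : closure (T₀.graph : Set (E × E)) = T₀.closure.graph := by
    rw [← hc.graph_closure_eq_closure_graph]; rfl
  refine strongResolventTendsto_of_tendsto hA fun z hz => ?_
  choose R hR hRn using fun m => exists_isResolvent_of_isSelfAdjoint (hA m) hz
  have hd : Dense (shiftRange T₀ z : Set E) := by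
    refine dense_shiftRange_iff.2 fun χ hχ => ?_
    have hcl : IsClosed {p : E × E | inner ℂ (p.2 - z • p.1) χ = 0} :=
      isClosed_eq (by fun_prop) continuous_const
    have hsub : closure (T₀.graph : Set (E × E)) ⊆ {p : E × E | inner ℂ (p.2 - z • p.1) χ = 0} := by
      refine closure_minimal ?_ hcl
      rintro ⟨a, b⟩ hp
      obtain ⟨y, hy1, hy2⟩ := (LinearPMap.mem_graph_iff T₀).1 hp
      dsimp only at hy1 hy2
      subst hy1 hy2
      exact hχ y
    have hχ' : ∀ ψ : T₀.closure.domain, inner ℂ (T₀.closure ψ) χ = inner ℂ (ψ : E) (conj z • χ) :=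
      fun ψ => by
        have : inner ℂ (T₀.closure ψ - z • (ψ : E)) χ = 0 :=
          hsub (by rw [hg]; exact T₀.closure.mem_graph ψ)
        rw [inner_sub_left, inner_smul_left, sub_eq_zero] at this
        rw [this, inner_smul_right]
    have hmem : χ ∈ T₀.closure.adjoint.domain := by
      refine LinearPMap.mem_adjoint_domain_of_exists _ ⟨conj z • χ, fun ψ => ?_⟩
      rw [← inner_conj_symm, ← hχ', inner_conj_symm]
    rw [LinearPMap.isSelfAdjoint_def.1 hT₀] at hmem
    have hval : T₀.closure ⟨χ, hmem⟩ = conj z • χ := by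
      refine hT₀.dense_domain.eq_of_inner_right ℂ fun v hv => ?_
      have h1 := LinearPMap.adjoint_isFormalAdjoint hT₀.dense_domain
      rw [LinearPMap.isSelfAdjoint_def.1 hT₀] at h1
      rw [← hχ' ⟨v, hv⟩]
      exact (h1 ⟨v, hv⟩ ⟨χ, hmem⟩).symm
    have h2 := hχ' ⟨χ, hmem⟩
    rw [hval, inner_smul_left, inner_smul_right, Complex.conj_conj, ← sub_eq_zero, ← sub_mul,
      mul_eq_zero] at h2
    rcases h2 with h2 | h2
    · exfalso
      apply hz
      have := congrArg Complex.im h2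
      simp at this
      linarith
    · exact inner_self_eq_zero.1 h2
  obtain ⟨R', h1, h2, h3⟩ := exists_tendsto_resolvent hR hRn hT hd
  exact ⟨R, R', hR, isResolvent_closure hc h2 h3, h1⟩

end Resolvents

/-! ### Products of partial operators and resolvents of powers -/

section Products

variable {E : Type*} [NormedAddCommGroup E] [InnerProductSpace ℂ E]

theorem mem_graph_everywhere {A : E →L[ℂ] E} {p : E × E} :
    p ∈ (everywhere A).graph ↔ A p.1 = p.2 := by
  rw [LinearPMap.mem_graph_iff]
  constructor
  · rintro ⟨y, h1, h2⟩
    rw [← h1, ← h2]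
    rfl
  · intro h
    exact ⟨⟨p.1, trivial⟩, rfl, h⟩

theorem mem_domain_natMul {S T : E →ₗ.[ℂ] E} {ψ : E} :
    ψ ∈ (natMul S T).domain ↔ ∃ h : ψ ∈ T.domain, T ⟨ψ, h⟩ ∈ S.domain := by
  constructor
  · rintro ⟨⟨χ, hχ, rfl⟩, h2⟩
    exact ⟨h2, hχ⟩
  · rintro ⟨h1, h2⟩
    exact ⟨⟨⟨ψ, h1⟩, h2, rfl⟩, h1⟩

theorem natMul_apply {S T : E →ₗ.[ℂ] E} {ψ : E} (h : ψ ∈ (natMul S T).domain)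
    (h1 : ψ ∈ T.domain) (h2 : T ⟨ψ, h1⟩ ∈ S.domain) :
    natMul S T ⟨ψ, h⟩ = S ⟨T ⟨ψ, h1⟩, h2⟩ := rfl

theorem mem_graph_natMul {S T : E →ₗ.[ℂ] E} {ψ η : E} :
    (ψ, η) ∈ (natMul S T).graph ↔ ∃ χ, (ψ, χ) ∈ T.graph ∧ (χ, η) ∈ S.graph := by
  constructor
  · intro h
    obtain ⟨⟨y, hy⟩, h1, h2⟩ := (LinearPMap.mem_graph_iff _).1 h
    dsimp only at h1 h2
    subst h1
    obtain ⟨g1, g2⟩ := mem_domain_natMul.1 hy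
    exact ⟨T ⟨y, g1⟩, T.mem_graph ⟨y, g1⟩, by rw [← h2]; exact S.mem_graph ⟨T ⟨y, g1⟩, g2⟩⟩
  · rintro ⟨χ, h1, h2⟩
    obtain ⟨⟨y, hy⟩, g1, g2⟩ := (LinearPMap.mem_graph_iff _).1 h1
    obtain ⟨⟨w, hw⟩, g3, g4⟩ := (LinearPMap.mem_graph_iff _).1 h2
    dsimp only at g1 g2 g3 g4
    subst g1 g3
    subst g2
    rw [← g4]
    exact (natMul S T).mem_graph ⟨y, mem_domain_natMul.2 ⟨hy, hw⟩⟩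

theorem natProd_zero (T : Fin 0 → E →ₗ.[ℂ] E) :
    natProd T = everywhere (ContinuousLinearMap.id ℂ E) := by
  simp [natProd]

theorem natProd_succ {k : ℕ} (T : Fin (k + 1) → E →ₗ.[ℂ] E) :
    natProd T = natMul (T 0) (natProd fun j => T j.succ) := by
  simp [natProd]

theorem natProd_everywhere : ∀ {k : ℕ} (A : Fin k → E →L[ℂ] E),
    natProd (fun j => everywhere (A j)) = everywhere (List.ofFn A).prod
  | 0, A => by
    rw [natProd_zero]
    simp [ContinuousLinearMap.one_def]
  | k + 1, A => by
    rw [natProd_succ, natProd_everywhere fun j => A j.succ]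
    apply LinearPMap.eq_of_eq_graph
    ext ⟨ψ, η⟩
    rw [mem_graph_natMul]
    simp only [mem_graph_everywhere, List.ofFn_succ, List.prod_cons]
    constructor
    · rintro ⟨_, rfl, rfl⟩
      rfl
    · intro h
      exact ⟨_, rfl, h⟩

/-- A pair is in the graph of `A ^ k` precisely if it consists of the ends of a chain of `k` pairs
in the graph of `A`. -/
theorem mem_graph_natProd_const {A : E →ₗ.[ℂ] E} {k : ℕ} {ψ η : E} :
    (ψ, η) ∈ (natProd fun _ : Fin k => A).graph ↔
      ∃ s : ℕ → E, s 0 = ψ ∧ s k = η ∧ ∀ j < k, (s j, s (j + 1)) ∈ A.graph := by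
  induction k generalizing η with
  | zero =>
    rw [natProd_zero, mem_graph_everywhere]
    constructor
    · intro h
      exact ⟨fun _ => ψ, rfl, h, by simp⟩
    · rintro ⟨s, h1, h2, -⟩
      exact h1.symm.trans h2
  | succ k ih =>
    rw [natProd_succ, mem_graph_natMul]
    constructor
    · rintro ⟨χ, h1, h2⟩
      obtain ⟨s, g1, g2, g3⟩ := ih.1 h1
      refine ⟨fun j => if j ≤ k then s j else η, by simpa using g1, by simp, fun j hj => ?_⟩
      rcases Nat.lt_succ_iff_lt_or_eq.1 hj with h | h
      · have h' : j + 1 ≤ k := h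
        simpa [h.le, h'] using g3 j h
      · subst h
        simpa [g2] using h2
    · rintro ⟨s, h1, h2, h3⟩
      exact ⟨s k, ih.2 ⟨s, h1, rfl, fun j hj => h3 j (hj.trans (Nat.lt_succ_self k))⟩,
        h2 ▸ h3 k (Nat.lt_succ_self k)⟩

theorem mem_domain_of_mem_graph {T : E →ₗ.[ℂ] E} {ψ η : E} (h : (ψ, η) ∈ T.graph) :
    ψ ∈ T.domain :=
  LinearPMap.mem_domain_of_mem_graph h

theorem mem_graph_of_mem_domain {T : E →ₗ.[ℂ] E} {ψ : E} (h : ψ ∈ T.domain) :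
    ∃ η, (ψ, η) ∈ T.graph :=
  ⟨T ⟨ψ, h⟩, T.mem_graph ⟨ψ, h⟩⟩

theorem IsResolvent.graph {T : E →ₗ.[ℂ] E} {z : ℂ} {R : E →L[ℂ] E} (h : IsResolvent T z R)
    (ψ : E) : (R ψ, ψ + z • R ψ) ∈ T.graph := by
  obtain ⟨h1, h2⟩ := h.1 ψ
  refine (LinearPMap.mem_graph_iff T).2 ⟨⟨R ψ, h1⟩, rfl, sub_eq_iff_eq_add.1 h2⟩

theorem IsResolvent.apply_of_graph {T : E →ₗ.[ℂ] E} {z : ℂ} {R : E →L[ℂ] E}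
    (h : IsResolvent T z R) {ψ η : E} (hg : (ψ, η) ∈ T.graph) : R (η - z • ψ) = ψ := by
  obtain ⟨y, h1, h2⟩ := (LinearPMap.mem_graph_iff T).1 hg
  dsimp only at h1 h2
  subst h1 h2
  exact h.2 y

theorem IsResolvent.injective {T : E →ₗ.[ℂ] E} {z : ℂ} {R : E →L[ℂ] E}
    (h : IsResolvent T z R) : Function.Injective R := by
  refine (injective_iff_map_eq_zero R).2 fun ψ hψ => ?_
  obtain ⟨h1, h2⟩ := h.1 ψ
  have : (⟨R ψ, h1⟩ : T.domain) = 0 := Subtype.ext hψ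
  rw [this, LinearPMap.map_zero, hψ] at h2
  simpa using h2.symm

theorem mem_domain_natProd_of_succ {A : E →ₗ.[ℂ] E} {k : ℕ} {ψ : E}
    (h : ψ ∈ (natProd fun _ : Fin (k + 1) => A).domain) :
    ψ ∈ (natProd fun _ : Fin k => A).domain := by
  obtain ⟨η, h⟩ := mem_graph_of_mem_domain h
  obtain ⟨s, h1, -, h3⟩ := mem_graph_natProd_const.1 h
  exact mem_domain_of_mem_graph (η := s k) (mem_graph_natProd_const.2
    ⟨s, h1, rfl, fun j hj => h3 j (hj.trans (Nat.lt_succ_self k))⟩)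

theorem mem_domain_natProd_succ {A : E →ₗ.[ℂ] E} {k : ℕ} {ψ χ : E} (h : (ψ, χ) ∈ A.graph)
    (hχ : χ ∈ (natProd fun _ : Fin k => A).domain) :
    ψ ∈ (natProd fun _ : Fin (k + 1) => A).domain := by
  obtain ⟨η, hη⟩ := mem_graph_of_mem_domain hχ
  obtain ⟨s, h1, -, h3⟩ := mem_graph_natProd_const.1 hη
  refine mem_domain_of_mem_graph (η := s k) (mem_graph_natProd_const.2
    ⟨fun j => Nat.casesOn j ψ s, rfl, rfl, fun j hj => ?_⟩)
  cases j with
  | zero => simpa [h1] using h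
  | succ j => exact h3 j (by lia)

theorem resolvent_mem_domain_natProd {A : E →ₗ.[ℂ] E} {z : ℂ} {R : E →L[ℂ] E}
    (hR : IsResolvent A z R) {k : ℕ} {ψ : E} (h : ψ ∈ (natProd fun _ : Fin k => A).domain) :
    R ψ ∈ (natProd fun _ : Fin (k + 1) => A).domain := by
  induction k with
  | zero => exact mem_domain_natProd_succ (hR.graph ψ) (by rw [natProd_zero]; trivial)
  | succ k ih =>
    exact mem_domain_natProd_succ (hR.graph ψ)
      (Submodule.add_mem _ h (Submodule.smul_mem _ _ (ih (mem_domain_natProd_of_succ h))))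

/-- The product of the bounded operators `R ζ` over a list, the head of the list acting first. -/
def resolventProd (R : ℂ → E →L[ℂ] E) : List ℂ → E →L[ℂ] E
  | [] => ContinuousLinearMap.id ℂ E
  | ζ :: l => (resolventProd R l).comp (R ζ)

theorem resolventProd_mem_domain {A : E →ₗ.[ℂ] E} {R : ℂ → E →L[ℂ] E} {l : List ℂ}
    (hR : ∀ ζ ∈ l, IsResolvent A ζ (R ζ)) {k : ℕ} {ψ : E}
    (h : ψ ∈ (natProd fun _ : Fin k => A).domain) :
    resolventProd R l ψ ∈ (natProd fun _ : Fin (l.length + k) => A).domain := by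
  induction l generalizing k ψ with
  | nil =>
    rw [List.length_nil, zero_add]
    exact h
  | cons ζ l ih =>
    have := ih (fun ξ hξ => hR ξ (List.mem_cons_of_mem _ hξ))
      (resolvent_mem_domain_natProd (hR ζ List.mem_cons_self) h)
    rw [List.length_cons, add_assoc, add_comm 1 k]
    exact this

theorem resolventProd_injective {A : E →ₗ.[ℂ] E} {R : ℂ → E →L[ℂ] E} {l : List ℂ}
    (hR : ∀ ζ ∈ l, IsResolvent A ζ (R ζ)) : Function.Injective (resolventProd R l) := by
  induction l with
  | nil => exact Function.injective_id
  | cons ζ l ih =>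
    exact (ih fun ξ hξ => hR ξ (List.mem_cons_of_mem _ hξ)).comp
      (hR ζ List.mem_cons_self).injective

open Polynomial in
/-- The value `∑ᵢ qᵢ sᵢ` of a polynomial on a sequence; if `sᵢ = Aⁱ ψ` this is `q(A) ψ`. -/
def polyEval (s : ℕ → E) : ℂ[X] →ₗ[ℂ] E :=
  Polynomial.lsum fun i => LinearMap.toSpanSingleton ℂ E (s i)

open Polynomial

theorem polyEval_monomial (s : ℕ → E) (i : ℕ) (c : ℂ) :
    polyEval s (monomial i c) = c • s i := by
  rw [polyEval, Polynomial.lsum_apply, Polynomial.sum_monomial_index] <;> simp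

theorem polyEval_X_mul {A : E →ₗ.[ℂ] E} {s : ℕ → E} {k : ℕ}
    (hs : ∀ j < k, (s j, s (j + 1)) ∈ A.graph) {q : ℂ[X]} (hq : q.natDegree < k) :
    (polyEval s q, polyEval s (X * q)) ∈ A.graph := by
  have e : (polyEval s q, polyEval s (X * q))
      = ∑ i ∈ Finset.range k, q.coeff i • (s i, s (i + 1)) := by
    conv_lhs => rw [q.as_sum_range' k hq]
    rw [Finset.mul_sum, map_sum, map_sum]
    ext
    · simp [polyEval_monomial, Prod.fst_sum]
    · simp [polyEval_monomial, Prod.snd_sum, X_mul_monomial]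
  rw [e]
  exact Submodule.sum_mem _ fun i hi =>
    Submodule.smul_mem _ _ (hs i (Finset.mem_range.1 hi))

theorem resolventProd_polyEval {A : E →ₗ.[ℂ] E} {s : ℕ → E} {k : ℕ}
    (hs : ∀ j < k, (s j, s (j + 1)) ∈ A.graph) {R : ℂ → E →L[ℂ] E} {l : List ℂ}
    (hR : ∀ ζ ∈ l, IsResolvent A ζ (R ζ)) (hl : l.length ≤ k) :
    resolventProd R l (polyEval s (l.map fun ζ => X - C ζ).prod) = s 0 := by
  induction l with
  | nil =>
    have : polyEval s 1 = s 0 := by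
      simpa using polyEval_monomial s 0 1
    simpa [resolventProd] using this
  | cons ζ l ih =>
    have hdeg : (l.map fun ζ => X - C ζ).prod.natDegree < k := by
      rw [← Multiset.prod_coe, ← Multiset.map_coe, natDegree_multiset_prod_X_sub_C_eq_card]
      exact hl
    have h1 := (hR ζ List.mem_cons_self).apply_of_graph (polyEval_X_mul hs hdeg)
    rw [← map_smul, ← map_sub, ← C_mul', ← sub_mul] at h1
    rw [List.map_cons, List.prod_cons, resolventProd, ContinuousLinearMap.comp_apply, h1]
    exact ih (fun ξ hξ => hR ξ (List.mem_cons_of_mem _ hξ)) (Nat.le_of_succ_le hl)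

/-- The list of the `k`-th roots of `z`. -/
def kthRoots (k : ℕ) (z : ℂ) : List ℂ := (X ^ k - C z : ℂ[X]).roots.toList

theorem prod_kthRoots {k : ℕ} (hk : k ≠ 0) (z : ℂ) :
    ((kthRoots k z).map fun ζ => X - C ζ).prod = X ^ k - C z := by
  have h := (IsAlgClosed.splits (X ^ k - C z : ℂ[X])).eq_prod_roots_of_monic
    (monic_X_pow_sub_C z hk)
  rw [h, ← Multiset.prod_coe, ← Multiset.map_coe, kthRoots, Multiset.coe_toList, ← h]

theorem length_kthRoots {k : ℕ} (hk : k ≠ 0) (z : ℂ) : (kthRoots k z).length = k := by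
  have h := congrArg natDegree (prod_kthRoots hk z)
  rwa [← Multiset.prod_coe, ← Multiset.map_coe, natDegree_multiset_prod_X_sub_C_eq_card,
    natDegree_X_pow_sub_C] at h

theorem im_ne_zero_of_mem_kthRoots {k : ℕ} {z ζ : ℂ} (hz : z.im ≠ 0) (hζ : ζ ∈ kthRoots k z) :
    ζ.im ≠ 0 := by
  intro h
  have h1 : ζ ^ k = z := by
    have := isRoot_of_mem_roots (Multiset.mem_toList.1 hζ)
    simpa [IsRoot, sub_eq_zero] using this
  apply hz
  have h2 : ζ = (ζ.re : ℂ) := Complex.ext rfl (by simpa using h)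
  rw [← h1, h2, ← Complex.ofReal_pow, Complex.ofReal_im]

/-- `(A ^ k - z)⁻¹` is the product of the `(A - ζ)⁻¹` over the `k`-th roots `ζ` of `z`. -/
theorem isResolvent_natProd_const {A : E →ₗ.[ℂ] E} {R : ℂ → E →L[ℂ] E} {k : ℕ} (hk : k ≠ 0)
    {z : ℂ} (hR : ∀ ζ ∈ kthRoots k z, IsResolvent A ζ (R ζ)) :
    IsResolvent (natProd fun _ : Fin k => A) z (resolventProd R (kthRoots k z)) := by
  have hleft : ∀ ψ η, (ψ, η) ∈ (natProd fun _ : Fin k => A).graph →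
      resolventProd R (kthRoots k z) (η - z • ψ) = ψ := fun ψ η h => by
    obtain ⟨s, h1, h2, h3⟩ := mem_graph_natProd_const.1 h
    have h4 := resolventProd_polyEval h3 hR (length_kthRoots hk z).le
    rw [prod_kthRoots hk, map_sub] at h4
    have e1 : polyEval s (X ^ k) = η := by
      rw [← monomial_one_right_eq_X_pow, polyEval_monomial, one_smul, h2]
    have e2 : polyEval s (C z) = z • ψ := by
      rw [← monomial_zero_left, polyEval_monomial, h1]
    rwa [e1, e2, h1] at h4
  refine isResolvent_of_graph (fun ψ => ?_) fun ψ => hleft ψ _ (LinearPMap.mem_graph _ ψ)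
  have hd := resolventProd_mem_domain hR (k := 0) (ψ := ψ) (by rw [natProd_zero]; trivial)
  rw [length_kthRoots hk, add_zero] at hd
  obtain ⟨η, hη⟩ := mem_graph_of_mem_domain hd
  have h1 := resolventProd_injective hR (hleft _ η hη)
  rw [sub_eq_iff_eq_add] at h1
  rwa [h1] at hη

theorem tendsto_resolventProd {R : ℕ → ℂ → E →L[ℂ] E} {R' : ℂ → E →L[ℂ] E} {l : List ℂ}
    (hC : ∀ ζ ∈ l, ∃ C : ℝ, ∀ m, ‖R m ζ‖ ≤ C)
    (h : ∀ ζ ∈ l, ∀ ψ, Tendsto (fun m => R m ζ ψ) atTop (𝓝 (R' ζ ψ))) (ψ : E) :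
    Tendsto (fun m => resolventProd (R m) l ψ) atTop (𝓝 (resolventProd R' l ψ)) ∧
      ∃ C : ℝ, ∀ m, ‖resolventProd (R m) l‖ ≤ C := by
  induction l generalizing ψ with
  | nil => exact ⟨tendsto_const_nhds, ‖ContinuousLinearMap.id ℂ E‖, fun _ => le_rfl⟩
  | cons ζ l ih =>
    have ih' := ih (fun ξ hξ => hC ξ (List.mem_cons_of_mem _ hξ))
      (fun ξ hξ => h ξ (List.mem_cons_of_mem _ hξ))
    obtain ⟨C₁, hC₁⟩ := hC ζ List.mem_cons_self
    obtain ⟨C₂, hC₂⟩ := (ih' 0).2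
    have hC₂0 : 0 ≤ C₂ := (norm_nonneg _).trans (hC₂ 0)
    refine ⟨?_, C₂ * C₁, fun m => ?_⟩
    · have h1 := h ζ List.mem_cons_self ψ
      have h2 := (ih' (R' ζ ψ)).1
      have h3 : Tendsto (fun m => resolventProd (R m) l (R m ζ ψ - R' ζ ψ)) atTop (𝓝 0) := by
        refine squeeze_zero_norm (fun m => (resolventProd (R m) l).le_of_opNorm_le (hC₂ m) _) ?_
        have := (tendsto_iff_norm_sub_tendsto_zero.1 h1).const_mul C₂
        simpa using this
      have h4 := h3.add h2
      simpa [resolventProd] using h4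
    · refine (ContinuousLinearMap.opNorm_comp_le _ _).trans ?_
      exact mul_le_mul (hC₂ m) (hC₁ m) (norm_nonneg _) hC₂0

variable [CompleteSpace E]

/-- Strong resolvent convergence is inherited by powers. -/
theorem StrongResolventTendsto.natProd_const {A : ℕ → E →L[ℂ] E} {T : E →ₗ.[ℂ] E}
    (h : StrongResolventTendsto A T) (k : ℕ) :
    StrongResolventTendsto (fun m => A m ^ k) (natProd fun _ : Fin k => T) := by
  obtain ⟨hA, -, hres⟩ := h
  refine strongResolventTendsto_of_tendsto (fun m => (hA m).pow k) fun z hz => ?_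
  by_cases hk : k = 0
  · subst hk
    obtain ⟨R, hR, -⟩ := exists_isResolvent_of_isSelfAdjoint
      (A := ContinuousLinearMap.id ℂ E) (IsSelfAdjoint.one (E →L[ℂ] E)) hz
    refine ⟨fun _ => R, R, fun m => by rw [pow_zero]; exact hR, ?_, fun _ => tendsto_const_nhds⟩
    rw [natProd_zero]
    exact hR
  · have hpow : ∀ m, natProd (fun _ : Fin k => everywhere (A m)) = everywhere (A m ^ k) :=
      fun m => by
        rw [natProd_everywhere fun _ => A m, List.ofFn_const, List.prod_replicate]
    have hex : ∀ ζ : ℂ, ∃ (R : ℕ → E →L[ℂ] E) (R' : E →L[ℂ] E), ζ.im ≠ 0 →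
        (∀ m, IsResolvent (everywhere (A m)) ζ (R m)) ∧ IsResolvent T ζ R' ∧
          ∀ ψ, Tendsto (fun m => R m ψ) atTop (𝓝 (R' ψ)) := fun ζ => by
      by_cases hζ : ζ.im ≠ 0
      · obtain ⟨R, R', h⟩ := hres ζ hζ
        exact ⟨R, R', fun _ => h⟩
      · exact ⟨0, 0, fun h => absurd h hζ⟩
    choose R R' hRR using hex
    have him := fun ζ (hζ : ζ ∈ kthRoots k z) => hRR ζ (im_ne_zero_of_mem_kthRoots hz hζ)
    refine ⟨fun m => resolventProd (fun ζ => R ζ m) (kthRoots k z),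
      resolventProd R' (kthRoots k z), fun m => ?_, ?_, fun ψ => ?_⟩
    · rw [← hpow]
      exact isResolvent_natProd_const hk fun ζ hζ => (him ζ hζ).1 m
    · exact isResolvent_natProd_const hk fun ζ hζ => (him ζ hζ).2.1
    · refine (tendsto_resolventProd (fun ζ hζ => ?_) (fun ζ hζ => (him ζ hζ).2.2) ψ).1
      -- strongly convergent sequences are norm bounded by the uniform boundedness principle
      refine banach_steinhaus fun ψ => ?_
      obtain ⟨C, hC⟩ := ((him ζ hζ).2.2 ψ).norm.bddAbove_range
      exact ⟨C, fun m => hC ⟨m, rfl⟩⟩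

end Products

/-! ### Commutation relations of the spin matrices and rotation of the frame -/

section SpinMatrices

variable {N : ℕ}

theorem spinMinus_apply (i j : Fin (N + 1)) :
    spinMinus N i j
      = if (i : ℕ) = j + 1 then ((Real.sqrt (((j : ℝ) + 1) * (N - j)) : ℝ) : ℂ) else 0 := by
  have h : (N : ℝ) / 2 * ((N : ℝ) / 2 + 1) - magnetization N j * (magnetization N j - 1)
      = ((j : ℝ) + 1) * (N - j) := by
    unfold magnetization; ring
  simp only [spinMinus, Matrix.of_apply, h]

theorem spinPlus_apply (i j : Fin (N + 1)) :
    spinPlus N i j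
      = if (i : ℕ) + 1 = j then ((Real.sqrt (((i : ℝ) + 1) * (N - i)) : ℝ) : ℂ) else 0 := by
  simp only [spinPlus, Matrix.of_apply]
  split_ifs with h
  · congr 2
    have h' : ((j : ℕ) : ℝ) = (i : ℝ) + 1 := by rw [← h]; push_cast; ring
    unfold magnetization
    rw [h']
    ring
  · rfl

theorem conjTranspose_spinMinus : (spinMinus N).conjTranspose = spinPlus N := by
  ext i j
  rw [Matrix.conjTranspose_apply, spinMinus_apply, spinPlus_apply]
  by_cases h : (i : ℕ) + 1 = j
  · rw [if_pos h, if_pos h.symm]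
    exact Complex.conj_ofReal _
  · rw [if_neg h, if_neg fun h' => h h'.symm]
    exact star_zero _

theorem conjTranspose_spinZ : (spinZ N).conjTranspose = spinZ N := by
  rw [spinZ, Matrix.diagonal_conjTranspose]
  congr 1
  ext i
  exact Complex.conj_ofReal _

theorem spinZ_mul_sub_spinMinus : spinZ N * spinMinus N - spinMinus N * spinZ N = -spinMinus N := by
  ext i j
  simp only [spinZ, Matrix.sub_apply, Matrix.diagonal_mul, Matrix.mul_diagonal, Matrix.neg_apply,
    spinMinus_apply]
  split_ifs with h
  · have h' : ((i : ℕ) : ℝ) = (j : ℝ) + 1 := by rw [h]; push_cast; ring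
    unfold magnetization
    rw [h']
    push_cast
    ring
  · simp

theorem spinZ_mul_sub_spinPlus : spinZ N * spinPlus N - spinPlus N * spinZ N = spinPlus N := by
  have h := congrArg Matrix.conjTranspose (spinZ_mul_sub_spinMinus (N := N))
  simp only [Matrix.conjTranspose_sub, Matrix.conjTranspose_mul, Matrix.conjTranspose_neg,
    conjTranspose_spinZ, conjTranspose_spinMinus] at h
  rw [← neg_sub, h, neg_neg]

theorem spinMinus_mul_spinPlus :
    spinMinus N * spinPlus N
      = Matrix.diagonal fun i : Fin (N + 1) => (((i : ℝ) * (N - i + 1) : ℝ) : ℂ) := by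
  ext i j
  rw [Matrix.mul_apply, Matrix.diagonal_apply]
  simp only [spinMinus_apply, spinPlus_apply]
  by_cases h0 : (i : ℕ) = 0
  · rw [Finset.sum_eq_zero]
    · split_ifs <;> simp [h0]
    · intro k _
      rw [if_neg (by lia), zero_mul]
  · have hi : (i : ℕ) - 1 < N + 1 := by lia
    rw [Finset.sum_eq_single ⟨(i : ℕ) - 1, hi⟩]
    · have e : (((i : ℕ) - 1 : ℕ) : ℝ) = (i : ℝ) - 1 := by
        rw [Nat.cast_sub (by lia)]; simp
      rw [if_pos (by simp; lia)]
      by_cases h : i = j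
      · subst h
        rw [if_pos (by simp; lia), if_pos rfl, ← Complex.ofReal_mul, Real.mul_self_sqrt]
        · congr 1
          simp only [e]
          ring
        · simp only [e]
          have : ((i : ℕ) : ℝ) ≤ N := by exact_mod_cast Nat.le_of_lt_succ i.2
          have : (0 : ℝ) ≤ (i : ℕ) := Nat.cast_nonneg _
          apply mul_nonneg <;> linarith
      · rw [if_neg h, if_neg, mul_zero]
        intro h'
        apply h
        ext
        simp at h'
        lia
    · intro k _ hk
      rw [if_neg, zero_mul]
      intro h
      apply hk
      ext
      simp [h]
    · simp

theorem spinPlus_mul_spinMinus :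
    spinPlus N * spinMinus N
      = Matrix.diagonal fun i : Fin (N + 1) => ((((i : ℝ) + 1) * (N - i) : ℝ) : ℂ) := by
  ext i j
  rw [Matrix.mul_apply, Matrix.diagonal_apply]
  simp only [spinMinus_apply, spinPlus_apply]
  by_cases h0 : (i : ℕ) = N
  · rw [Finset.sum_eq_zero]
    · split_ifs <;> simp [h0]
    · intro k _
      rw [if_neg (by lia), zero_mul]
  · have hi : (i : ℕ) + 1 < N + 1 := by lia
    rw [Finset.sum_eq_single ⟨(i : ℕ) + 1, hi⟩]
    · rw [if_pos (by simp)]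
      by_cases h : i = j
      · subst h
        rw [if_pos (by simp), if_pos rfl, ← Complex.ofReal_mul, Real.mul_self_sqrt]
        have : ((i : ℕ) : ℝ) ≤ N := by exact_mod_cast Nat.le_of_lt_succ i.2
        have : (0 : ℝ) ≤ (i : ℕ) := Nat.cast_nonneg _
        apply mul_nonneg <;> linarith
      · rw [if_neg h, if_neg, mul_zero]
        intro h'
        apply h
        ext
        simpa using h'
    · intro k _ hk
      rw [if_neg, zero_mul]
      intro h
      apply hk
      ext
      simp [h]
    · simp

theorem spinMinus_mul_sub_spinPlus :
    spinMinus N * spinPlus N - spinPlus N * spinMinus N = -(2 : ℂ) • spinZ N := by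
  rw [spinMinus_mul_spinPlus, spinPlus_mul_spinMinus, spinZ, ← Matrix.diagonal_smul,
    Matrix.diagonal_sub]
  congr 1
  ext i
  simp [magnetization]
  ring

/-- The lowering matrix `e^{iφ} S⁻` along the frame rotated by `φ` about the third axis. -/
def phaseMinus (N : ℕ) (φ : ℝ) : Matrix (Fin (N + 1)) (Fin (N + 1)) ℂ :=
  Complex.exp (Complex.I * φ) • spinMinus N

/-- The raising matrix `e^{-iφ} S⁺`. -/
def phasePlus (N : ℕ) (φ : ℝ) : Matrix (Fin (N + 1)) (Fin (N + 1)) ℂ :=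
  Complex.exp (-(Complex.I * φ)) • spinPlus N

theorem phase_cancel (φ : ℝ) : Complex.exp (Complex.I * φ) * Complex.exp (-(Complex.I * φ)) = 1 := by
  rw [← Complex.exp_add]; simp

theorem star_exp_phase (φ : ℝ) :
    star (Complex.exp (Complex.I * φ)) = Complex.exp (-(Complex.I * φ)) := by
  change conj _ = _
  rw [← Complex.exp_conj]
  simp

theorem conjTranspose_phaseMinus (φ : ℝ) : (phaseMinus N φ).conjTranspose = phasePlus N φ := by
  rw [phaseMinus, Matrix.conjTranspose_smul, conjTranspose_spinMinus, star_exp_phase, phasePlus]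

theorem conjTranspose_phasePlus (φ : ℝ) : (phasePlus N φ).conjTranspose = phaseMinus N φ := by
  rw [← conjTranspose_phaseMinus, Matrix.conjTranspose_conjTranspose]

theorem spinZ_phaseMinus (φ : ℝ) :
    spinZ N * phaseMinus N φ - phaseMinus N φ * spinZ N = -phaseMinus N φ := by
  rw [phaseMinus, mul_smul_comm, smul_mul_assoc, ← smul_sub, spinZ_mul_sub_spinMinus, smul_neg]

theorem spinZ_phasePlus (φ : ℝ) :
    spinZ N * phasePlus N φ - phasePlus N φ * spinZ N = phasePlus N φ := by
  rw [phasePlus, mul_smul_comm, smul_mul_assoc, ← smul_sub, spinZ_mul_sub_spinPlus]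

theorem phaseMinus_phasePlus (φ : ℝ) :
    phaseMinus N φ * phasePlus N φ - phasePlus N φ * phaseMinus N φ = -(2 : ℂ) • spinZ N := by
  rw [phaseMinus, phasePlus, smul_mul_smul_comm, smul_mul_smul_comm, phase_cancel, mul_comm,
    phase_cancel, one_smul, one_smul, spinMinus_mul_sub_spinPlus]

/-- The generator `½ (e^{iφ} S⁻ - e^{-iφ} S⁺)` of the rotation about `f²`. -/
def rotGen (N : ℕ) (φ : ℝ) : Matrix (Fin (N + 1)) (Fin (N + 1)) ℂ :=
  (1 / 2 : ℂ) • (phaseMinus N φ - phasePlus N φ)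

/-- `cos φ S¹ + sin φ S²`. -/
def horizSpin (N : ℕ) (φ : ℝ) : Matrix (Fin (N + 1)) (Fin (N + 1)) ℂ :=
  (1 / 2 : ℂ) • (phaseMinus N φ + phasePlus N φ)

theorem conjTranspose_rotGen (φ : ℝ) : (rotGen N φ).conjTranspose = -rotGen N φ := by
  rw [rotGen, Matrix.conjTranspose_smul, Matrix.conjTranspose_sub, conjTranspose_phaseMinus,
    conjTranspose_phasePlus, ← smul_neg, neg_sub]
  simp

theorem coherentU_eq (θ φ : ℝ) : coherentU N θ φ = NormedSpace.exp (θ • rotGen N φ) := by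
  rw [coherentU, rotGen, phaseMinus, phasePlus]
  congr 1
  rw [← Complex.coe_smul, smul_smul]
  congr 1
  ring

theorem rotGen_spinZ (φ : ℝ) :
    rotGen N φ * spinZ N - spinZ N * rotGen N φ = horizSpin N φ := by
  have h1 := spinZ_phaseMinus (N := N) φ
  have h2 := spinZ_phasePlus (N := N) φ
  rw [rotGen, horizSpin, smul_mul_assoc, mul_smul_comm, ← smul_sub]
  congr 1
  have e : (phaseMinus N φ - phasePlus N φ) * spinZ N - spinZ N * (phaseMinus N φ - phasePlus N φ)
      = -(spinZ N * phaseMinus N φ - phaseMinus N φ * spinZ N)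
        + (spinZ N * phasePlus N φ - phasePlus N φ * spinZ N) := by noncomm_ring
  rw [e, h1, h2, neg_neg]

theorem rotGen_horizSpin (φ : ℝ) :
    rotGen N φ * horizSpin N φ - horizSpin N φ * rotGen N φ = -spinZ N := by
  have h1 := phaseMinus_phasePlus (N := N) φ
  rw [rotGen, horizSpin, smul_mul_smul_comm, smul_mul_smul_comm, ← smul_sub]
  have e : (phaseMinus N φ - phasePlus N φ) * (phaseMinus N φ + phasePlus N φ)
      - (phaseMinus N φ + phasePlus N φ) * (phaseMinus N φ - phasePlus N φ)
      = (2 : ℂ) • (phaseMinus N φ * phasePlus N φ - phasePlus N φ * phaseMinus N φ) := by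
    rw [two_smul]; noncomm_ring
  rw [e, h1, smul_smul, smul_smul, ← neg_one_smul ℂ (spinZ N)]
  congr 1
  norm_num

/-- If `[K, a] = -b` and `[K, b] = a`, then conjugation by `exp (t K)` rotates the pair `a, b`. -/
theorem exp_conj_rotate {A : Type*} [NormedRing A] [NormedAlgebra ℝ A] [CompleteSpace A]
    {K a b : A}
    (h1 : K * a - a * K = -b) (h2 : K * b - b * K = a) (α β t : ℝ) :
    NormedSpace.exp (-(t • K))
        * ((α * Real.cos t + β * Real.sin t) • a + (β * Real.cos t - α * Real.sin t) • b)
        * NormedSpace.exp (t • K) = α • a + β • b := by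
  let g : ℝ → A := fun t => NormedSpace.exp (t • -K)
        * ((α * Real.cos t + β * Real.sin t) • a + (β * Real.cos t - α * Real.sin t) • b)
        * NormedSpace.exp (t • K)
  have hg : ∀ t, HasDerivAt g 0 t := fun t => by
    have d1 : HasDerivAt (fun u : ℝ => NormedSpace.exp (u • -K))
        (NormedSpace.exp (t • -K) * -K) t := hasDerivAt_exp_smul_const (-K) t
    have d2 : HasDerivAt (fun u : ℝ => NormedSpace.exp (u • K))
        (K * NormedSpace.exp (t • K)) t := hasDerivAt_exp_smul_const' K t
    have d3 : HasDerivAt (fun t : ℝ => (α * Real.cos t + β * Real.sin t) • a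
          + (β * Real.cos t - α * Real.sin t) • b)
        ((α * -Real.sin t + β * Real.cos t) • a + (β * -Real.sin t - α * Real.cos t) • b) t :=
      ((((Real.hasDerivAt_cos t).const_mul α).add
        ((Real.hasDerivAt_sin t).const_mul β)).smul_const a).add
      ((((Real.hasDerivAt_cos t).const_mul β).sub
        ((Real.hasDerivAt_sin t).const_mul α)).smul_const b)
    have d := (d1.mul d3).mul d2
    refine HasDerivAt.congr_deriv (f := g) d ?_
    have hK : ∀ x y : ℝ, K * (x • a + y • b) - (x • a + y • b) * K = y • a - x • b := fun x y => by
      have : K * (x • a + y • b) - (x • a + y • b) * K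
          = x • (K * a - a * K) + y • (K * b - b * K) := by
        simp only [mul_add, add_mul, mul_smul_comm, smul_mul_assoc, smul_sub]
        abel
      rw [this, h1, h2, smul_neg]
      abel
    have h3 := hK (α * Real.cos t + β * Real.sin t) (β * Real.cos t - α * Real.sin t)
    have h4 : (α * -Real.sin t + β * Real.cos t) • a + (β * -Real.sin t - α * Real.cos t) • b
        = K * ((α * Real.cos t + β * Real.sin t) • a + (β * Real.cos t - α * Real.sin t) • b)
        - ((α * Real.cos t + β * Real.sin t) • a + (β * Real.cos t - α * Real.sin t) • b) * K := by
      rw [h3]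
      module
    rw [h4]
    simp only [Pi.mul_apply]
    generalize (α * Real.cos t + β * Real.sin t) • a + (β * Real.cos t - α * Real.sin t) • b = x
    noncomm_ring
  have hc : g t = g 0 :=
    is_const_of_deriv_eq_zero (fun t => (hg t).differentiableAt) (fun t => (hg t).deriv) t 0
  have h0 : g 0 = α • a + β • b := by simp [g]
  rw [← h0, ← hc]
  simp only [g, smul_neg]

attribute [local instance] Matrix.linftyOpNormedRing Matrix.linftyOpNormedAlgebra

theorem exp_conj_rotate_matrix {n : Type*} [Fintype n] [DecidableEq n] {K a b : Matrix n n ℂ}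
    (h1 : K * a - a * K = -b) (h2 : K * b - b * K = a) (α β t : ℝ) :
    NormedSpace.exp (-(t • K))
        * ((α * Real.cos t + β * Real.sin t) • a + (β * Real.cos t - α * Real.sin t) • b)
        * NormedSpace.exp (t • K) = α • a + β • b :=
  exp_conj_rotate h1 h2 α β t

theorem exp_neg_mul_exp_matrix {n : Type*} [Fintype n] [DecidableEq n] (K : Matrix n n ℂ) :
    NormedSpace.exp (-K) * NormedSpace.exp K = 1 := by
  rw [← Matrix.exp_add_of_commute _ _ (Commute.neg_left (Commute.refl K)), neg_add_cancel,
    NormedSpace.exp_zero]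

theorem conjTranspose_coherentU (θ φ : ℝ) :
    (coherentU N θ φ).conjTranspose = NormedSpace.exp (-(θ • rotGen N φ)) := by
  rw [coherentU_eq, ← Matrix.exp_conjTranspose, Matrix.conjTranspose_smul, conjTranspose_rotGen]
  simp

/-- The component `u · v` along the classical spin `u = (θ, φ)`. -/
def radial (θ φ : ℝ) (v : EuclideanSpace ℝ (Fin 3)) : ℝ :=
  Real.sin θ * Real.cos φ * v 0 + Real.sin θ * Real.sin φ * v 1 + Real.cos θ * v 2

theorem inner_frame1 (θ φ : ℝ) (v : EuclideanSpace ℝ (Fin 3)) :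
    inner ℝ (frame1 θ φ) v
      = Real.cos θ * Real.cos φ * v 0 + Real.cos θ * Real.sin φ * v 1 - Real.sin θ * v 2 := by
  simp [frame1, PiLp.inner_apply, Fin.sum_univ_three]
  ring

theorem inner_frame2 (φ : ℝ) (v : EuclideanSpace ℝ (Fin 3)) :
    inner ℝ (frame2 φ) v = -Real.sin φ * v 0 + Real.cos φ * v 1 := by
  simp [frame2, PiLp.inner_apply, Fin.sum_univ_three]
  ring

theorem exp_phase (φ : ℝ) :
    Complex.exp (Complex.I * φ) = (Real.cos φ : ℂ) + Complex.I * (Real.sin φ : ℂ) := by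
  rw [mul_comm, Complex.exp_mul_I, ← Complex.ofReal_cos, ← Complex.ofReal_sin, mul_comm Complex.I]

theorem exp_neg_phase (φ : ℝ) :
    Complex.exp (-(Complex.I * φ)) = (Real.cos φ : ℂ) - Complex.I * (Real.sin φ : ℂ) := by
  have : -(Complex.I * (φ : ℂ)) = Complex.I * ((-φ : ℝ) : ℂ) := by push_cast; ring
  rw [this, exp_phase, Real.cos_neg, Real.sin_neg]
  push_cast
  ring

/-- The spin along `v`, decomposed in the rotated frame. -/
theorem spinDot_eq (θ φ : ℝ) (v : EuclideanSpace ℝ (Fin 3)) :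
    spinDot N v
      = ((inner ℝ (frame1 θ φ) v * Real.cos θ + radial θ φ v * Real.sin θ) • horizSpin N φ
        + (radial θ φ v * Real.cos θ - inner ℝ (frame1 θ φ) v * Real.sin θ) • spinZ N)
        + (Complex.I * (inner ℝ (frame2 φ) v : ℝ)) • rotGen N φ := by
  have c1 := Complex.cos_sq_add_sin_sq θ
  have c2 := Complex.cos_sq_add_sin_sq φ
  rw [inner_frame1, inner_frame2]
  simp only [← Complex.coe_smul, radial, spinDot, spinX, spinY, horizSpin, rotGen, phaseMinus,
    phasePlus, exp_phase, exp_neg_phase]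
  push_cast
  have hI : (1 / (2 * Complex.I) : ℂ) = -Complex.I / 2 := by
    field_simp
    rw [Complex.I_sq]; norm_num
  rw [hI]
  generalize Complex.cos θ = a at *
  generalize Complex.sin θ = b at *
  generalize Complex.cos φ = c at *
  generalize Complex.sin φ = d at *
  generalize ((v 0 : ℝ) : ℂ) = x
  generalize ((v 1 : ℝ) : ℂ) = y
  generalize ((v 2 : ℝ) : ℂ) = w
  have hII := Complex.I_sq
  match_scalars
  · linear_combination -(c * x + d * y) / 2 * (c - Complex.I * d) * c1
      - (x - Complex.I * y) / 2 * c2 - d * (-d * x + c * y) / 2 * hII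
  · linear_combination -(c * x + d * y) / 2 * (c + Complex.I * d) * c1
      - (x + Complex.I * y) / 2 * c2 - d * (-d * x + c * y) / 2 * hII
  · linear_combination -w * c1

/-- Conjugation by the rotation takes the rotated frame to the fixed one. -/
theorem coherentU_conj_spinDot (θ φ : ℝ) (v : EuclideanSpace ℝ (Fin 3)) :
    (coherentU N θ φ).conjTranspose * spinDot N v * coherentU N θ φ
      = inner ℝ (frame1 θ φ) v • horizSpin N φ + radial θ φ v • spinZ N
        + (Complex.I * (inner ℝ (frame2 φ) v : ℝ)) • rotGen N φ := by
  rw [spinDot_eq θ φ v, mul_add, add_mul, conjTranspose_coherentU, coherentU_eq,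
    exp_conj_rotate_matrix (rotGen_horizSpin φ) (rotGen_spinZ φ)]
  congr 1
  have hc : Commute (rotGen N φ) (NormedSpace.exp (θ • rotGen N φ)) :=
    ((Commute.refl (rotGen N φ)).smul_right θ).exp_right
  rw [mul_smul_comm, smul_mul_assoc, mul_assoc, hc.eq, ← mul_assoc, exp_neg_mul_exp_matrix, one_mul]

end SpinMatrices

/-! ### Single-site operators in coordinates -/

section Sites

variable {L : Type*} {N : ℕ}

open Classical in
/-- The basis vector `⨂ₓ Uₓ |J - nₓ⟩` of the spin space. -/
def spinVec (n : SpinConfig L N) : SpinSpace L N := lp.single 2 n 1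

theorem inner_spinVec (n : SpinConfig L N) (ψ : SpinSpace L N) :
    inner ℂ (spinVec n) ψ = (ψ : SpinConfig L N → ℂ) n := by
  classical
  rw [spinVec, lp.inner_single_left]
  simp

theorem inner_fockBasis (n : L →₀ ℕ) (ψ : FockSpace L) :
    inner ℂ (fockBasis n) ψ = (ψ : (L →₀ ℕ) → ℂ) n := by
  classical
  rw [fockBasis, lp.inner_single_left]
  simp

open Classical in
theorem spinVec_apply (n k : SpinConfig L N) :
    (spinVec n : SpinConfig L N → ℂ) k = if k = n then 1 else 0 := by
  rw [spinVec, lp.single_apply, Pi.single_apply]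

open Classical in
theorem fockBasis_apply (n k : L →₀ ℕ) :
    (fockBasis n : (L →₀ ℕ) → ℂ) k = if k = n then 1 else 0 := by
  rw [fockBasis, lp.single_apply, Pi.single_apply]

theorem SpinConfig.put_apply_self (n : SpinConfig L N) (x : L) (m : Fin (N + 1)) :
    (n.put x m).1 x = m := by
  classical
  simp [SpinConfig.put, Finsupp.update_apply]

theorem SpinConfig.put_apply_ne (n : SpinConfig L N) {x y : L} (m : Fin (N + 1)) (h : y ≠ x) :
    (n.put x m).1 y = n.1 y := by
  classical
  simp [SpinConfig.put, Finsupp.update_apply, h]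

theorem SpinConfig.put_occ (n : SpinConfig L N) (x : L) : n.put x (n.occ x) = n := by
  apply Subtype.ext
  ext y
  by_cases h : y = x
  · subst h
    rw [SpinConfig.put_apply_self]
    rfl
  · rw [SpinConfig.put_apply_ne _ _ h]

theorem SpinConfig.put_put (n : SpinConfig L N) (x : L) (m m' : Fin (N + 1)) :
    (n.put x m).put x m' = n.put x m' := by
  apply Subtype.ext
  ext y
  by_cases h : y = x
  · subst h
    rw [SpinConfig.put_apply_self, SpinConfig.put_apply_self]
  · rw [SpinConfig.put_apply_ne _ _ h, SpinConfig.put_apply_ne _ _ h,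
      SpinConfig.put_apply_ne _ _ h]

theorem SpinConfig.occ_put (n : SpinConfig L N) (x : L) (m : Fin (N + 1)) :
    (n.put x m).occ x = m :=
  Fin.ext (n.put_apply_self x m)

theorem coordOp_add (x : L) (A B : Matrix (Fin (N + 1)) (Fin (N + 1)) ℂ) :
    coordOp (L := L) x (A + B) = coordOp x A + coordOp x B := by
  simp only [coordOp, Matrix.add_apply, add_smul, Finset.sum_add_distrib]

theorem coordOp_smul (x : L) (c : ℂ) (A : Matrix (Fin (N + 1)) (Fin (N + 1)) ℂ) :
    coordOp (L := L) x (c • A) = c • coordOp x A := by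
  simp only [coordOp, Matrix.smul_apply, smul_eq_mul, mul_smul, Finset.smul_sum]

theorem coordOp_one (x : L) :
    coordOp (L := L) x (1 : Matrix (Fin (N + 1)) (Fin (N + 1)) ℂ)
      = ContinuousLinearMap.id ℂ (SpinSpace L N) := by
  ext ψ n
  rw [coordOp_apply, Finset.sum_eq_single (n.occ x)]
  · simp [SpinConfig.put_occ]
  · intro m _ hm
    rw [Matrix.one_apply_ne (Ne.symm hm), zero_mul]
  · simp

theorem norm_relabel_le {I : Type*} (s : Set I) (σ : I → I) (hσ : Set.InjOn σ s) :
    ‖relabel s σ hσ‖ ≤ 1 := by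
  unfold relabel
  exact LinearMap.mkContinuous_norm_le _ zero_le_one _

theorem norm_coordOp_le (x : L) (A : Matrix (Fin (N + 1)) (Fin (N + 1)) ℂ) :
    ‖coordOp (L := L) x A‖ ≤ ∑ i, ∑ m, ‖A i m‖ := by
  refine (norm_sum_le _ _).trans (Finset.sum_le_sum fun i _ => (norm_sum_le _ _).trans
    (Finset.sum_le_sum fun m _ => ?_))
  rw [norm_smul]
  exact mul_le_of_le_one_right (norm_nonneg _) (norm_relabel_le _ _ _)

theorem coordOp_spinVec (x : L) (A : Matrix (Fin (N + 1)) (Fin (N + 1)) ℂ) (k : SpinConfig L N) :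
    coordOp x A (spinVec k) = ∑ i, A i (k.occ x) • spinVec (k.put x i) := by
  classical
  ext n
  have hs : ∀ f : Fin (N + 1) → SpinSpace L N,
      (∑ i, f i : SpinSpace L N) n = ∑ i, f i n := fun f => by
    rw [lp.coeFn_sum]
    exact Finset.sum_apply n _ _
  rw [coordOp_apply, hs]
  simp only [lp.coeFn_smul, Pi.smul_apply, spinVec_apply, smul_eq_mul, mul_ite, mul_one, mul_zero]
  by_cases h : n.put x (k.occ x) = k
  · have h' : n = k.put x (n.occ x) := by
      rw [← h, SpinConfig.put_put, SpinConfig.put_occ]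
    rw [Finset.sum_eq_single (k.occ x), Finset.sum_eq_single (n.occ x), if_pos h, if_pos h']
    · intro i _ hi
      rw [if_neg]
      intro h2
      exact hi (by rw [h2, SpinConfig.occ_put])
    · simp
    · intro i _ hi
      rw [if_neg]
      intro h2
      exact hi (by rw [← h2, SpinConfig.occ_put])
    · simp
  · rw [Finset.sum_eq_zero, Finset.sum_eq_zero]
    · intro i _
      rw [if_neg]
      intro h2
      exact h (by rw [h2, SpinConfig.put_put, SpinConfig.put_occ])
    · intro i _
      rw [if_neg]
      intro h2
      exact h (by rw [← h2, SpinConfig.occ_put])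

theorem coordOp_adjoint (x : L) (A : Matrix (Fin (N + 1)) (Fin (N + 1)) ℂ) :
    (coordOp (L := L) x A).adjoint = coordOp x A.conjTranspose := by
  ext ψ n
  rw [← inner_spinVec, ContinuousLinearMap.adjoint_inner_right, coordOp_spinVec, sum_inner,
    coordOp_apply]
  refine Finset.sum_congr rfl fun m _ => ?_
  rw [inner_smul_left, inner_spinVec]
  rfl

/-! ### The rotated lowering operators generate the basis -/

theorem spinDot_sub_smul_conj (θ φ : ℝ) :
    (coherentU N θ φ).conjTranspose
      * (spinDot N (frame1 θ φ) - Complex.I • spinDot N (frame2 φ)) * coherentU N θ φ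
      = phaseMinus N φ := by
  have c1 := Real.cos_sq_add_sin_sq θ
  have c2 := Real.cos_sq_add_sin_sq φ
  have a1 : inner ℝ (frame1 θ φ) (frame1 θ φ) = (1 : ℝ) := by
    rw [inner_frame1]
    simp [frame1]
    linear_combination c1 + Real.cos θ ^ 2 * c2
  have a2 : radial θ φ (frame1 θ φ) = 0 := by
    simp [radial, frame1]
    linear_combination Real.cos θ * Real.sin θ * c2
  have a3 : inner ℝ (frame2 φ) (frame1 θ φ) = (0 : ℝ) := by
    rw [inner_frame2]
    simp [frame1]
    ring
  have b1 : inner ℝ (frame1 θ φ) (frame2 φ) = (0 : ℝ) := by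
    rw [inner_frame1]
    simp [frame2]
    ring
  have b2 : radial θ φ (frame2 φ) = 0 := by
    simp [radial, frame2]
    ring
  have b3 : inner ℝ (frame2 φ) (frame2 φ) = (1 : ℝ) := by
    rw [inner_frame2]
    simp [frame2]
    linear_combination c2
  rw [mul_sub, sub_mul, mul_smul_comm, smul_mul_assoc, coherentU_conj_spinDot,
    coherentU_conj_spinDot, a1, a2, a3, b1, b2, b3]
  simp only [horizSpin, rotGen, one_smul, zero_smul, Complex.ofReal_zero, Complex.ofReal_one,
    mul_zero, mul_one, add_zero, zero_add, smul_smul]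
  match_scalars
  · linear_combination -(1 / 2) * Complex.I_sq
  · linear_combination (1 / 2) * Complex.I_sq

theorem rotatedMinus_eq (θ φ : L → ℝ) (N : ℕ) (x : L) :
    rotatedMinus θ φ N x = coordOp x (phaseMinus N (φ x)) := by
  rw [rotatedMinus, siteOp, spinDot_sub_smul_conj]

theorem coordOp_phaseMinus_spinVec (x : L) (φ : ℝ) (k : SpinConfig L N) {j : ℕ} (hj : j < N)
    (hk : k.1 x = j) :
    coordOp x (phaseMinus N φ) (spinVec k)
      = (Complex.exp (Complex.I * φ) * (Real.sqrt (((j : ℝ) + 1) * (N - j)) : ℝ))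
        • spinVec (k.put x ⟨j + 1, Nat.succ_lt_succ hj⟩) := by
  have hocc : ((k.occ x : Fin (N + 1)) : ℕ) = j := hk
  rw [coordOp_spinVec, Finset.sum_eq_single ⟨j + 1, Nat.succ_lt_succ hj⟩]
  · rw [phaseMinus, Matrix.smul_apply, spinMinus_apply, hocc, if_pos rfl, smul_eq_mul]
  · intro i _ hi
    rw [phaseMinus, Matrix.smul_apply, spinMinus_apply, hocc, if_neg, smul_zero, zero_smul]
    intro h
    exact hi (Fin.ext h)
  · simp

theorem coordOp_phaseMinus_pow_spinVec (x : L) (φ : ℝ) (k : SpinConfig L N) (hk : k.1 x = 0) :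
    ∀ (j : ℕ) (hj : j < N + 1), (coordOp x (phaseMinus N φ) ^ j) (spinVec k)
      = (Complex.exp (Complex.I * φ) ^ j * ((j.factorial : ℝ) * Real.sqrt (N.choose j) : ℝ))
        • spinVec (k.put x ⟨j, hj⟩)
  | 0, hj => by
    have : k.put x ⟨0, hj⟩ = k := by
      conv_rhs => rw [← SpinConfig.put_occ k x]
      congr 1
      exact Fin.ext hk.symm
    rw [this]
    simp
  | j + 1, hj => by
    have hj' : j < N := Nat.lt_of_succ_lt_succ hj
    rw [pow_succ', mul_apply_eq_comp, coordOp_phaseMinus_pow_spinVec x φ k hk j (by lia), map_smul,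
      coordOp_phaseMinus_spinVec x φ (k.put x ⟨j, by lia⟩) hj' (SpinConfig.put_apply_self _ _ _),
      SpinConfig.put_put, smul_smul]
    congr 1
    have h1 : Real.sqrt (N.choose j) * Real.sqrt (((j : ℝ) + 1) * (N - j))
        = (j + 1) * Real.sqrt (N.choose (j + 1)) := by
      have h2 : ((N.choose (j + 1) : ℝ)) * (j + 1) = N.choose j * (N - j) := by
        have := Nat.choose_succ_right_eq N j
        rw [← Nat.cast_sub hj'.le]
        exact_mod_cast this
      have h3 : (0 : ℝ) ≤ (j : ℝ) + 1 := by positivity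
      rw [← Real.sqrt_mul (Nat.cast_nonneg _), ← Real.sqrt_sq h3, ← Real.sqrt_mul (sq_nonneg _),
        Real.sqrt_sq h3]
      congr 1
      linear_combination -(j + 1 : ℝ) * h2
    have h4 : ((((j + 1).factorial : ℝ) * Real.sqrt (N.choose (j + 1)) : ℝ) : ℂ)
        = (((j.factorial : ℝ) * (Real.sqrt (N.choose j)
          * Real.sqrt (((j : ℝ) + 1) * (N - j))) : ℝ) : ℂ) := by
      rw [h1, Nat.factorial_succ]
      push_cast
      ring
    rw [h4]
    push_cast
    ring

/-- The phase `∏ₓ e^{i φₓ nₓ}` by which `φ_n` differs from the vector `⨂ₓ Uₓ |J - nₓ⟩`. -/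
def configPhase (φ : L → ℝ) (n : L →₀ ℕ) : ℂ := n.prod fun x j => Complex.exp (Complex.I * φ x) ^ j

theorem norm_exp_phase (φ : ℝ) : ‖Complex.exp (Complex.I * φ)‖ = 1 := by
  rw [mul_comm, Complex.norm_exp_ofReal_mul_I]

theorem norm_configPhase (φ : L → ℝ) (n : L →₀ ℕ) : ‖configPhase φ n‖ = 1 := by
  rw [configPhase, Finsupp.prod, norm_prod]
  exact Finset.prod_eq_one fun x _ => by rw [norm_pow, norm_exp_phase, one_pow]

theorem conj_configPhase_mul (φ : L → ℝ) (n : L →₀ ℕ) :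
    conj (configPhase φ n) * configPhase φ n = 1 := by
  rw [mul_comm, Complex.mul_conj, Complex.normSq_eq_norm_sq, norm_configPhase]
  simp

theorem configPhase_add_single (φ : L → ℝ) (n : L →₀ ℕ) (x : L) :
    configPhase φ (n + Finsupp.single x 1) = configPhase φ n * Complex.exp (Complex.I * φ x) := by
  classical
  rw [configPhase, Finsupp.prod_add_index', Finsupp.prod_single_index, pow_one, configPhase]
  · simp
  · simp
  · intros
    rw [pow_add]

theorem prod_rotatedMinus_vacuum (θ φ : L → ℝ) (n : L → ℕ) (l : List L) (hl : l.Nodup)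
    (k : SpinConfig L N) (h1 : ∀ x ∈ l, k.1 x = n x) (h2 : ∀ x ∉ l, k.1 x = 0) :
    (l.map fun x => (((((n x).factorial : ℝ)⁻¹ * (Real.sqrt (N.choose (n x)))⁻¹ : ℝ)) : ℂ) •
      rotatedMinus θ φ N x ^ (n x)).prod (spinVacuum L N)
      = (l.map fun x => Complex.exp (Complex.I * φ x) ^ n x).prod • spinVec k := by
  induction l generalizing k with
  | nil =>
    have : k = ⟨0, fun _ => Nat.zero_le _⟩ := by
      apply Subtype.ext
      ext x
      exact h2 x List.not_mem_nil
    subst this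
    simp [spinVacuum, spinVec]
  | cons x l ih =>
    obtain ⟨hx, hl⟩ := List.nodup_cons.1 hl
    have hz : (k.put x 0).1 x = 0 := SpinConfig.put_apply_self _ _ _
    have hne : ∀ y, y ≠ x → (k.put x 0).1 y = k.1 y := fun y hy =>
      SpinConfig.put_apply_ne _ _ hy
    have hkx : k.1 x = n x := h1 x List.mem_cons_self
    have hn : n x ≤ N := hkx ▸ k.2 x
    have ih' := ih hl (k.put x 0)
      (fun y hy => by
        rw [hne y (by rintro rfl; exact hx hy)]
        exact h1 y (List.mem_cons_of_mem _ hy))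
      (fun y hy => by
        by_cases hyx : y = x
        · rw [hyx, hz]
        · rw [hne y hyx]
          exact h2 y (by simp [hyx, hy]))
    have hk' : (k.put x 0).put x ⟨n x, Nat.lt_succ_of_le hn⟩ = k := by
      rw [SpinConfig.put_put]
      conv_rhs => rw [← SpinConfig.put_occ k x]
      congr 1
      exact Fin.ext hkx.symm
    rw [List.map_cons, List.prod_cons, mul_apply_eq_comp, ih', map_smul,
      smul_apply, rotatedMinus_eq,
      coordOp_phaseMinus_pow_spinVec x (φ x) _ hz _ (Nat.lt_succ_of_le hn), hk', smul_smul,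
      smul_smul, List.map_cons, List.prod_cons]
    congr 1
    have h5 : (((n x).factorial : ℝ)⁻¹ * (Real.sqrt (N.choose (n x)))⁻¹)
        * ((n x).factorial * Real.sqrt (N.choose (n x))) = 1 := by
      have := Nat.factorial_pos (n x)
      have := Real.sqrt_pos.2 (Nat.cast_pos (α := ℝ).2 (Nat.choose_pos hn))
      field_simp
    have h6 := congrArg (Complex.ofReal) h5
    rw [Complex.ofReal_mul, Complex.ofReal_one] at h6
    linear_combination (List.map (fun x => Complex.exp (Complex.I * φ x) ^ n x) l).prod
      * Complex.exp (Complex.I * φ x) ^ n x * h6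

/-- In the rotated frame `S̃⁻` is `e^{iφ} S⁻`, so `φ_n` is a coordinate vector up to a phase. -/
theorem spinBasis_eq (θ φ : L → ℝ) (n : SpinConfig L N) :
    spinBasis θ φ N n = configPhase φ n.1 • spinVec n := by
  rw [spinBasis, prod_rotatedMinus_vacuum θ φ (fun x => n.1 x) _ (Finset.nodup_toList _) n
    (fun _ _ => rfl) fun x hx => by simpa using hx]
  rw [configPhase, Finsupp.prod, Finset.prod_map_toList]

end Sites

/-! ### The Dyson identification -/

section Dyson

variable {L : Type*} {N : ℕ}

theorem memℓp_two_iff {I : Type*} {f : I → ℂ} :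
    Memℓp (E := fun _ : I => ℂ) f 2 ↔ Summable fun i => ‖f i‖ ^ 2 := by
  rw [memℓp_gen_iff (by simp)]
  simp

theorem inner_spinBasis (θ φ : L → ℝ) (n : SpinConfig L N) (ψ : SpinSpace L N) :
    inner ℂ (spinBasis θ φ N n) ψ = conj (configPhase φ n.1) * (ψ : SpinConfig L N → ℂ) n := by
  rw [spinBasis_eq, inner_smul_left, inner_spinVec]

/-- An isometry with the values of the Dyson map on the basis is given by the conjugate phases. -/
theorem apply_of_map_spinBasis {θ φ : L → ℝ} {V : SpinSpace L N →ₗᵢ[ℂ] FockSpace L}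
    (hV : ∀ n : SpinConfig L N, V (spinBasis θ φ N n) = fockBasis n.1) (ψ : SpinSpace L N)
    (n : SpinConfig L N) :
    (V ψ : (L →₀ ℕ) → ℂ) n.1 = conj (configPhase φ n.1) * (ψ : SpinConfig L N → ℂ) n := by
  rw [← inner_fockBasis, ← hV, V.inner_map_map, inner_spinBasis]

theorem IsDyson.apply_config {θ φ : L → ℝ} {V : SpinSpace L N →ₗᵢ[ℂ] FockSpace L}
    (hV : IsDyson θ φ N V) (ψ : SpinSpace L N) (n : SpinConfig L N) :
    (V ψ : (L →₀ ℕ) → ℂ) n.1 = conj (configPhase φ n.1) * (ψ : SpinConfig L N → ℂ) n :=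
  apply_of_map_spinBasis hV.1 ψ n

theorem IsDyson.apply_eq_zero {θ φ : L → ℝ} {V : SpinSpace L N →ₗᵢ[ℂ] FockSpace L}
    (hV : IsDyson θ φ N V) (ψ : SpinSpace L N) {n : L →₀ ℕ} (hn : ∃ x, N < n x) :
    (V ψ : (L →₀ ℕ) → ℂ) n = 0 :=
  (hV.2 (V ψ)).1 ⟨ψ, rfl⟩ n hn

theorem IsDyson.unique {θ φ : L → ℝ} {V W : SpinSpace L N →ₗᵢ[ℂ] FockSpace L}
    (hV : IsDyson θ φ N V) (hW : IsDyson θ φ N W) : V = W := by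
  ext ψ n
  by_cases hn : ∃ x, N < n x
  · rw [hV.apply_eq_zero ψ hn, hW.apply_eq_zero ψ hn]
  · push Not at hn
    exact (hV.apply_config ψ ⟨n, hn⟩).trans (hW.apply_config ψ ⟨n, hn⟩).symm

theorem orthonormal_conj_phase_fockBasis (φ : L → ℝ) (N : ℕ) :
    Orthonormal ℂ fun n : SpinConfig L N => conj (configPhase φ n.1) • fockBasis n.1 := by
  classical
  rw [orthonormal_iff_ite]
  intro n k
  rw [inner_smul_left, inner_smul_right, inner_fockBasis, fockBasis_apply, Complex.conj_conj]
  by_cases h : n = k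
  · subst h
    rw [if_pos rfl, if_pos rfl, mul_one, mul_comm, conj_configPhase_mul]
  · rw [if_neg h, if_neg fun h' => h (Subtype.ext h'), mul_zero, mul_zero]

/-- The Dyson map sends the orthonormal basis of coordinate vectors to an orthonormal family, up to
phases. -/
theorem exists_isDyson (θ φ : L → ℝ) (N : ℕ) :
    ∃ V : SpinSpace L N →ₗᵢ[ℂ] FockSpace L, IsDyson θ φ N V := by
  classical
  have hO := (orthonormal_conj_phase_fockBasis φ N).orthogonalFamily
  have hb : ∀ n : SpinConfig L N, hO.linearIsometry (spinBasis θ φ N n) = fockBasis n.1 := fun n => by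
    rw [spinBasis_eq, map_smul, spinVec, hO.linearIsometry_apply_single,
      LinearIsometry.toSpanSingleton_apply, one_smul, smul_smul, mul_comm, conj_configPhase_mul,
      one_smul]
  refine ⟨hO.linearIsometry, hb, fun ψ => ⟨?_, fun h => ?_⟩⟩
  · rintro ⟨χ, rfl⟩ n ⟨x, hx⟩
    have hs := hO.hasSum_linearIsometry χ
    have hs' := hs.mapL (innerSL ℂ (fockBasis n))
    rw [← inner_fockBasis]
    refine hs'.unique ?_
    convert hasSum_zero with k
    rw [LinearIsometry.toSpanSingleton_apply, innerSL_apply_apply, inner_smul_right,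
      inner_smul_right, inner_fockBasis, fockBasis_apply, if_neg, mul_zero, mul_zero]
    rintro rfl
    exact absurd (k.2 x) (not_le.2 hx)
  · have hmem : Memℓp (E := fun _ : SpinConfig L N => ℂ)
        (fun n => configPhase φ n.1 * (ψ : (L →₀ ℕ) → ℂ) n.1) 2 := by
      rw [memℓp_two_iff]
      simp only [norm_mul, norm_configPhase, one_mul]
      exact (memℓp_two_iff.1 (lp.memℓp ψ)).comp_injective Subtype.val_injective
    refine ⟨⟨_, hmem⟩, ?_⟩
    ext n
    by_cases hn : ∃ x, N < n x
    · rw [h n hn]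
      have hs := hO.hasSum_linearIsometry ⟨_, hmem⟩
      have hs' := hs.mapL (innerSL ℂ (fockBasis n))
      rw [← inner_fockBasis]
      refine hs'.unique ?_
      convert hasSum_zero with k
      rw [LinearIsometry.toSpanSingleton_apply, innerSL_apply_apply, inner_smul_right,
        inner_smul_right, inner_fockBasis, fockBasis_apply, if_neg, mul_zero, mul_zero]
      rintro rfl
      obtain ⟨x, hx⟩ := hn
      exact absurd (k.2 x) (not_le.2 hx)
    · push Not at hn
      rw [apply_of_map_spinBasis hb ⟨_, hmem⟩ ⟨n, hn⟩]
      change _ * (_ * _) = _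
      rw [← mul_assoc, conj_configPhase_mul, one_mul]

theorem IsDyson.adjoint_apply {θ φ : L → ℝ} {V : SpinSpace L N →ₗᵢ[ℂ] FockSpace L}
    (hV : IsDyson θ φ N V) (ψ : FockSpace L) (n : SpinConfig L N) :
    (V.toContinuousLinearMap.adjoint ψ : SpinConfig L N → ℂ) n
      = configPhase φ n.1 * (ψ : (L →₀ ℕ) → ℂ) n.1 := by
  have h1 : V (spinVec n) = conj (configPhase φ n.1) • fockBasis n.1 := by
    rw [← hV.1 n, spinBasis_eq, map_smul, smul_smul, conj_configPhase_mul, one_smul]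
  rw [← inner_spinVec, ContinuousLinearMap.adjoint_inner_right]
  change inner ℂ (V (spinVec n)) ψ = _
  rw [h1, inner_smul_left, inner_fockBasis, Complex.conj_conj]

theorem isSelfAdjoint_transport {V : SpinSpace L N →ₗᵢ[ℂ] FockSpace L}
    {B : SpinSpace L N →L[ℂ] SpinSpace L N} (hB : IsSelfAdjoint B) :
    IsSelfAdjoint (transport V B) := by
  rw [ContinuousLinearMap.isSelfAdjoint_iff'] at hB ⊢
  rw [transport, ContinuousLinearMap.adjoint_comp, ContinuousLinearMap.adjoint_comp,
    ContinuousLinearMap.adjoint_adjoint, hB]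
  rfl

/-! ### The fluctuation operators in the boson picture -/

/-- `f¹ · v + i f² · v`, the component of `v` tangent to the sphere at `u = (θ, φ)`. -/
def tangentAt (θ φ : ℝ) (v : EuclideanSpace ℝ (Fin 3)) : ℂ :=
  (inner ℝ (frame1 θ φ) v : ℝ) + Complex.I * (inner ℝ (frame2 φ) v : ℝ)

theorem tangent_apply (θ φ : L → ℝ) (v : L1Three L) (x : L) :
    tangent θ φ v x = tangentAt (θ x) (φ x) (v x) := rfl

theorem norm_sq_tangentAt_add (θ φ : ℝ) (v : EuclideanSpace ℝ (Fin 3)) :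
    ‖tangentAt θ φ v‖ ^ 2 + radial θ φ v ^ 2 = ‖v‖ ^ 2 := by
  have h1 : ‖tangentAt θ φ v‖ ^ 2 = inner ℝ (frame1 θ φ) v ^ 2 + inner ℝ (frame2 φ) v ^ 2 := by
    rw [← Complex.normSq_eq_norm_sq, tangentAt, mul_comm, Complex.normSq_add_mul_I]
  have c1 := Real.cos_sq_add_sin_sq θ
  have c2 := Real.cos_sq_add_sin_sq φ
  rw [h1, EuclideanSpace.real_norm_sq_eq, Fin.sum_univ_three, inner_frame1, inner_frame2, radial]
  linear_combination ((Real.cos φ * v 0 + Real.sin φ * v 1) ^ 2 + v 2 ^ 2) * c1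
    + (v 0 ^ 2 + v 1 ^ 2) * c2

theorem norm_tangentAt_le (θ φ : ℝ) (v : EuclideanSpace ℝ (Fin 3)) : ‖tangentAt θ φ v‖ ≤ ‖v‖ := by
  have h := norm_sq_tangentAt_add θ φ v
  exact le_of_sq_le_sq (by nlinarith [sq_nonneg (radial θ φ v)]) (norm_nonneg _)

theorem abs_radial_le (θ φ : ℝ) (v : EuclideanSpace ℝ (Fin 3)) : |radial θ φ v| ≤ ‖v‖ := by
  have h := norm_sq_tangentAt_add θ φ v
  refine abs_le_of_sq_le_sq (by nlinarith [sq_nonneg ‖tangentAt θ φ v‖]) (norm_nonneg _)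

theorem summable_norm_L1 (v : L1Three L) : Summable fun x => ‖v x‖ := by
  simpa using (lp.memℓp v).summable (by simp)

theorem norm_L1_eq (v : L1Three L) : ‖v‖ = ∑' x, ‖v x‖ := by
  rw [lp.norm_eq_tsum_rpow (by simp)]
  simp

/-- The single-site fluctuation matrix in the rotated frame,
`½ (τ e^{iφ} S⁻ + conj τ e^{-iφ} S⁺) + (u · v) (S³ - J)`, with `τ` the tangential component. -/
def siteFluct (N : ℕ) (θ φ : ℝ) (v : EuclideanSpace ℝ (Fin 3)) :
    Matrix (Fin (N + 1)) (Fin (N + 1)) ℂ :=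
  (tangentAt θ φ v / 2) • phaseMinus N φ + (conj (tangentAt θ φ v) / 2) • phasePlus N φ
    + (radial θ φ v : ℂ) • (spinZ N - ((N : ℂ) / 2) • 1)

theorem conjTranspose_siteFluct (θ φ : ℝ) (v : EuclideanSpace ℝ (Fin 3)) :
    (siteFluct N θ φ v).conjTranspose = siteFluct N θ φ v := by
  simp only [siteFluct, Matrix.conjTranspose_add, Matrix.conjTranspose_smul,
    Matrix.conjTranspose_sub, conjTranspose_phaseMinus, conjTranspose_phasePlus,
    conjTranspose_spinZ, Matrix.conjTranspose_one]
  have h1 : star (tangentAt θ φ v / 2) = conj (tangentAt θ φ v) / 2 := by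
    change conj _ = _
    rw [map_div₀, map_ofNat]
  have h2 : star (conj (tangentAt θ φ v) / 2) = tangentAt θ φ v / 2 := by
    rw [← h1, star_star]
  have h3 : star ((radial θ φ v : ℝ) : ℂ) = radial θ φ v := Complex.conj_ofReal _
  have h4 : star ((N : ℂ) / 2) = (N : ℂ) / 2 := by
    change conj _ = _
    rw [map_div₀, map_ofNat, map_natCast]
  rw [h1, h2, h3, h4, add_comm (_ • phasePlus N φ)]

theorem rotated_spinDot_eq (θ φ : ℝ) (v : EuclideanSpace ℝ (Fin 3)) :
    (coherentU N θ φ).conjTranspose * spinDot N v * coherentU N θ φ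
      = siteFluct N θ φ v + ((radial θ φ v : ℂ) * (N / 2)) • 1 := by
  have hτ : conj (tangentAt θ φ v)
      = (inner ℝ (frame1 θ φ) v : ℝ) - Complex.I * (inner ℝ (frame2 φ) v : ℝ) := by
    rw [tangentAt]
    simp
    ring
  rw [coherentU_conj_spinDot, siteFluct, hτ, tangentAt]
  simp only [horizSpin, rotGen, ← Complex.coe_smul]
  module

theorem siteFluct_zero_zero (θ φ : ℝ) (v : EuclideanSpace ℝ (Fin 3)) :
    siteFluct N θ φ v 0 0 = 0 := by
  simp [siteFluct, phaseMinus, phasePlus, spinMinus_apply, spinPlus_apply, spinZ, magnetization]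

theorem coherentState_coordOp (x : L) (A : Matrix (Fin (N + 1)) (Fin (N + 1)) ℂ) :
    coherentState (coordOp (L := L) x A) = A 0 0 := by
  have hv : spinVacuum L N = spinVec ⟨0, fun _ => Nat.zero_le _⟩ := rfl
  have h0 : SpinConfig.occ (⟨0, fun _ => Nat.zero_le _⟩ : SpinConfig L N) x = 0 := rfl
  have h1 := SpinConfig.put_occ (⟨0, fun _ => Nat.zero_le _⟩ : SpinConfig L N) x
  rw [h0] at h1
  rw [coherentState, hv, inner_spinVec, coordOp_apply, Finset.sum_eq_single 0, h0, h1,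
    spinVec_apply, if_pos rfl, mul_one]
  · intro m _ hm
    rw [spinVec_apply, if_neg, mul_zero]
    intro h
    apply hm
    rw [← SpinConfig.occ_put (⟨0, fun _ => Nat.zero_le _⟩ : SpinConfig L N) x m, h, h0]
  · simp

theorem fluct_eq (θ φ : L → ℝ) (N : ℕ) (v : L1Three L) :
    fluct θ φ N v = ((Real.sqrt (2 / ((N : ℝ) / 2)) : ℝ) : ℂ) •
      ∑' x, coordOp x (siteFluct N (θ x) (φ x) (v x)) := by
  rw [fluct]
  congr 2
  ext1 x
  rw [siteOp, rotated_spinDot_eq, coherentState_coordOp, Matrix.add_apply, siteFluct_zero_zero,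
    zero_add, coordOp_add, coordOp_smul, coordOp_one]
  simp

theorem summable_coordOp_siteFluct (θ φ : L → ℝ) (N : ℕ) (v : L1Three L) :
    Summable fun x => coordOp (L := L) x (siteFluct N (θ x) (φ x) (v x)) := by
  set S : Matrix (Fin (N + 1)) (Fin (N + 1)) ℂ → ℝ := fun A => ∑ i, ∑ m, ‖A i m‖ with hS
  have hSn : ∀ A, 0 ≤ S A := fun A =>
    Finset.sum_nonneg fun _ _ => Finset.sum_nonneg fun _ _ => norm_nonneg _
  have hm : ∀ φ, S (phaseMinus N φ) = S (spinMinus N) := fun φ => by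
    simp only [hS, phaseMinus, Matrix.smul_apply, norm_smul, norm_exp_phase, one_mul]
  have hp : ∀ φ, S (phasePlus N φ) = S (spinPlus N) := fun φ => by
    have : ‖Complex.exp (-(Complex.I * φ))‖ = 1 := by
      rw [← star_exp_phase, norm_star, norm_exp_phase]
    simp only [hS, phasePlus, Matrix.smul_apply, norm_smul, this, one_mul]
  have hc : ∀ (x : L) (c : ℂ) (A : Matrix (Fin (N + 1)) (Fin (N + 1)) ℂ) (b : ℝ), ‖c‖ ≤ b →
      ‖coordOp (L := L) x (c • A)‖ ≤ b * S A := fun x c A b hb => by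
    rw [coordOp_smul, norm_smul]
    exact mul_le_mul hb (norm_coordOp_le x A) (norm_nonneg _) ((norm_nonneg _).trans hb)
  refine Summable.of_norm_bounded (g := fun x => ‖v x‖ *
    (S (spinMinus N) + S (spinPlus N) + S (spinZ N - ((N : ℂ) / 2) • 1)))
    ((summable_norm_L1 v).mul_right _) fun x => ?_
  have ht : ‖tangentAt (θ x) (φ x) (v x) / 2‖ ≤ ‖v x‖ := by
    rw [norm_div]
    have := norm_tangentAt_le (θ x) (φ x) (v x)
    have := norm_nonneg (tangentAt (θ x) (φ x) (v x))
    simp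
    linarith
  have ht' : ‖conj (tangentAt (θ x) (φ x) (v x)) / 2‖ ≤ ‖v x‖ := by
    rw [norm_div, RCLike.norm_conj, ← norm_div]
    exact ht
  have hr : ‖((radial (θ x) (φ x) (v x) : ℝ) : ℂ)‖ ≤ ‖v x‖ := by
    rw [Complex.norm_real]
    exact abs_radial_le _ _ _
  rw [siteFluct, coordOp_add, coordOp_add]
  refine (norm_add₃_le).trans ?_
  have h1 := hc x _ (phaseMinus N (φ x)) _ ht
  have h2 := hc x _ (phasePlus N (φ x)) _ ht'
  have h3 := hc x _ (spinZ N - ((N : ℂ) / 2) • 1) _ hr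
  rw [hm] at h1
  rw [hp] at h2
  linarith

theorem isSelfAdjoint_fluct (θ φ : L → ℝ) (N : ℕ) (v : L1Three L) :
    IsSelfAdjoint (fluct θ φ N v) := by
  rw [fluct_eq]
  have h1 : IsSelfAdjoint (∑' x, coordOp (L := L) x (siteFluct N (θ x) (φ x) (v x))) := by
    rw [isSelfAdjoint_iff, tsum_star]
    congr 1
    ext1 x
    rw [ContinuousLinearMap.star_eq_adjoint, coordOp_adjoint, conjTranspose_siteFluct]
  have h2 : IsSelfAdjoint ((Real.sqrt (2 / ((N : ℝ) / 2)) : ℝ) : ℂ) := Complex.conj_ofReal _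
  exact h2.smul h1

end Dyson

/-! ### Matrix elements in the boson picture -/

section BosonPicture

variable {L : Type*} {N : ℕ}

/-- The terms, at the coordinate `n`, of the fluctuation operator in the boson picture,
`∑ₓ [τₓ a*ₓ √(1 - nₓ / N) + conj τₓ √(1 - nₓ / N) aₓ - (2 / √N) (uₓ · vₓ) nₓ]`. -/
def spinTerm (θ φ : L → ℝ) (N : ℕ) (v : L1Three L) (ψ : (L →₀ ℕ) → ℂ) (n : L →₀ ℕ) (x : L) : ℂ :=
  tangent θ φ v x * (Real.sqrt (n x) * Real.sqrt (1 - ((n x : ℝ) - 1) / N) : ℝ)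
      * ψ (n - Finsupp.single x 1)
    + conj (tangent θ φ v x) * (Real.sqrt (n x + 1) * Real.sqrt (1 - (n x : ℝ) / N) : ℝ)
      * ψ (n + Finsupp.single x 1)
    - (2 / Real.sqrt N * radial (θ x) (φ x) (v x) * n x : ℝ) * ψ n

theorem coordOp_phaseMinus_apply {φ : L → ℝ} {χ : SpinSpace L N} {ψ : (L →₀ ℕ) → ℂ}
    (h : ∀ k : SpinConfig L N, (χ : SpinConfig L N → ℂ) k = configPhase φ k.1 * ψ k.1) (x : L)
    (n : SpinConfig L N) :
    (coordOp x (phaseMinus N (φ x)) χ : SpinConfig L N → ℂ) n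
      = configPhase φ n.1 * (Real.sqrt (n.1 x * (N - n.1 x + 1)) : ℝ)
        * ψ (n.1 - Finsupp.single x 1) := by
  rw [coordOp_apply]
  have hocc : ((n.occ x : Fin (N + 1)) : ℕ) = n.1 x := rfl
  have hle := n.2 x
  by_cases h0 : n.1 x = 0
  · rw [Finset.sum_eq_zero]
    · simp [h0]
    · intro m _
      rw [phaseMinus, Matrix.smul_apply, spinMinus_apply, if_neg (by lia), smul_zero, zero_mul]
  · rw [Finset.sum_eq_single ⟨n.1 x - 1, by lia⟩]
    · have e : (n.put x ⟨n.1 x - 1, by lia⟩).1 = n.1 - Finsupp.single x 1 := by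
        ext y
        by_cases hy : y = x
        · subst hy
          rw [SpinConfig.put_apply_self]
          simp
        · rw [SpinConfig.put_apply_ne _ _ hy]
          simp [Ne.symm hy]
      have e2 : n.1 - Finsupp.single x 1 + Finsupp.single x 1 = n.1 := by
        ext y
        by_cases hy : y = x
        · subst hy
          simp
          lia
        · simp [Ne.symm hy]
      have e3 : (((n.1 x - 1 : ℕ) : ℝ) + 1) * (N - ((n.1 x - 1 : ℕ) : ℝ))
          = n.1 x * (N - n.1 x + 1) := by
        rw [Nat.cast_sub (by lia)]
        push_cast
        ring
      rw [h, e, phaseMinus, Matrix.smul_apply, spinMinus_apply, if_pos (by rw [hocc]; simp; lia),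
        smul_eq_mul]
      conv_rhs => rw [← e2, configPhase_add_single, e2]
      dsimp only
      rw [e3]
      ring
    · intro m _ hm
      rw [phaseMinus, Matrix.smul_apply, spinMinus_apply, if_neg, smul_zero, zero_mul]
      intro h'
      apply hm
      ext
      simp
      lia
    · simp

theorem coordOp_phasePlus_apply {φ : L → ℝ} {χ : SpinSpace L N} {ψ : (L →₀ ℕ) → ℂ}
    (h : ∀ k : SpinConfig L N, (χ : SpinConfig L N → ℂ) k = configPhase φ k.1 * ψ k.1) (x : L)
    (n : SpinConfig L N) :
    (coordOp x (phasePlus N (φ x)) χ : SpinConfig L N → ℂ) n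
      = configPhase φ n.1 * (Real.sqrt ((n.1 x + 1) * (N - n.1 x)) : ℝ)
        * ψ (n.1 + Finsupp.single x 1) := by
  rw [coordOp_apply]
  have hocc : ((n.occ x : Fin (N + 1)) : ℕ) = n.1 x := rfl
  have hle := n.2 x
  by_cases h0 : n.1 x = N
  · rw [Finset.sum_eq_zero]
    · simp [h0]
    · intro m _
      rw [phasePlus, Matrix.smul_apply, spinPlus_apply, if_neg (by lia), smul_zero, zero_mul]
  · rw [Finset.sum_eq_single ⟨n.1 x + 1, by lia⟩]
    · have e : (n.put x ⟨n.1 x + 1, by lia⟩).1 = n.1 + Finsupp.single x 1 := by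
        ext y
        by_cases hy : y = x
        · subst hy
          rw [SpinConfig.put_apply_self]
          simp
        · rw [SpinConfig.put_apply_ne _ _ hy]
          simp [Ne.symm hy]
      rw [h, e, phasePlus, Matrix.smul_apply, spinPlus_apply, if_pos (by rw [hocc]),
        smul_eq_mul, configPhase_add_single, hocc]
      linear_combination (configPhase φ n.1 * (Real.sqrt ((n.1 x + 1) * (N - n.1 x)) : ℝ)
        * ψ (n.1 + Finsupp.single x 1)) * phase_cancel (φ x)
    · intro m _ hm
      rw [phasePlus, Matrix.smul_apply, spinPlus_apply, if_neg, smul_zero, zero_mul]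
      intro h'
      apply hm
      ext
      simp
      lia
    · simp

theorem coordOp_spinZ_apply {φ : L → ℝ} {χ : SpinSpace L N} {ψ : (L →₀ ℕ) → ℂ}
    (h : ∀ k : SpinConfig L N, (χ : SpinConfig L N → ℂ) k = configPhase φ k.1 * ψ k.1) (x : L)
    (n : SpinConfig L N) :
    (coordOp x (spinZ N - ((N : ℂ) / 2) • 1) χ : SpinConfig L N → ℂ) n
      = configPhase φ n.1 * (-(n.1 x : ℂ)) * ψ n.1 := by
  rw [coordOp_apply, Finset.sum_eq_single (n.occ x)]
  · rw [SpinConfig.put_occ, h, Matrix.sub_apply, spinZ, Matrix.diagonal_apply_eq,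
      Matrix.smul_apply, Matrix.one_apply_eq, magnetization]
    have hocc : ((n.occ x : Fin (N + 1)) : ℕ) = n.1 x := rfl
    rw [hocc]
    push_cast
    simp
    ring
  · intro m _ hm
    rw [Matrix.sub_apply, spinZ, Matrix.diagonal_apply_ne _ (Ne.symm hm), Matrix.smul_apply,
      Matrix.one_apply_ne (Ne.symm hm)]
    simp
  · simp

/-- The transported fluctuation operator is the bosonic expression at every configuration with at most
`N` bosons per site, for every `ψ`: the factor `√(1 - nₓ / N)` cuts off the creation of an `N + 1`st
boson. -/
theorem hasSum_transport_fluct {θ φ : L → ℝ} {V : SpinSpace L N →ₗᵢ[ℂ] FockSpace L}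
    (hV : IsDyson θ φ N V) (hN : 0 < N) (v : L1Three L) (ψ : FockSpace L) (n : SpinConfig L N) :
    HasSum (spinTerm θ φ N v ψ n.1) ((transport V (fluct θ φ N v) ψ : (L →₀ ℕ) → ℂ) n.1) := by
  set χ := V.toContinuousLinearMap.adjoint ψ with hχ
  have h : ∀ k : SpinConfig L N, (χ : SpinConfig L N → ℂ) k
      = configPhase φ k.1 * (ψ : (L →₀ ℕ) → ℂ) k.1 := fun k => hV.adjoint_apply ψ k
  have e1 : (transport V (fluct θ φ N v) ψ : (L →₀ ℕ) → ℂ) n.1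
      = conj (configPhase φ n.1) * inner ℂ (spinVec n) (fluct θ φ N v χ) := by
    rw [inner_spinVec, ← hV.apply_config]
    rfl
  set c : ℝ := Real.sqrt (2 / ((N : ℝ) / 2)) with hc
  have hN' : (0 : ℝ) < N := Nat.cast_pos.2 hN
  have hcv : c = 2 / Real.sqrt N := by
    rw [hc, show (2 : ℝ) / ((N : ℝ) / 2) = 2 ^ 2 / N by field_simp, Real.sqrt_div (by norm_num),
      Real.sqrt_sq (by norm_num)]
  have hs := ((summable_coordOp_siteFluct θ φ N v).hasSum.const_smul ((c : ℝ) : ℂ))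
  rw [← fluct_eq] at hs
  have hs2 := hs.mapL (ContinuousLinearMap.apply ℂ (SpinSpace L N) χ)
  have hs3 := (hs2.mapL (innerSL ℂ (spinVec n))).mul_left (conj (configPhase φ n.1))
  rw [e1]
  suffices hfun : (fun x => conj (configPhase φ n.1) * inner ℂ (spinVec n)
      ((c : ℂ) • coordOp x (siteFluct N (θ x) (φ x) (v x)) χ)) = spinTerm θ φ N v ψ n.1 by
    rw [← hfun]
    exact hs3
  ext1 x
  have hle : ((n.1 x : ℕ) : ℝ) ≤ N := Nat.cast_le.2 (n.2 x)
  have hn0 : (0 : ℝ) ≤ n.1 x := Nat.cast_nonneg _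
  have k1 : (c / 2) * Real.sqrt (n.1 x * (N - n.1 x + 1))
      = Real.sqrt (n.1 x) * Real.sqrt (1 - ((n.1 x : ℝ) - 1) / N) := by
    rw [hcv, Real.sqrt_mul hn0, show 1 - ((n.1 x : ℝ) - 1) / N = (N - n.1 x + 1) / N by
      field_simp; ring, Real.sqrt_div (by linarith)]
    ring
  have k2 : (c / 2) * Real.sqrt ((n.1 x + 1) * (N - n.1 x))
      = Real.sqrt (n.1 x + 1) * Real.sqrt (1 - (n.1 x : ℝ) / N) := by
    rw [hcv, Real.sqrt_mul (by linarith), show 1 - (n.1 x : ℝ) / N = (N - n.1 x) / N by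
      field_simp, Real.sqrt_div (by linarith)]
    ring
  rw [inner_smul_right, inner_spinVec, siteFluct, coordOp_add, coordOp_add, coordOp_smul,
    coordOp_smul, coordOp_smul]
  change _ * ((c : ℂ) * (_ * (coordOp x (phaseMinus N (φ x)) χ : SpinConfig L N → ℂ) n
    + _ * (coordOp x (phasePlus N (φ x)) χ : SpinConfig L N → ℂ) n
    + _ * (coordOp x (spinZ N - ((N : ℂ) / 2) • 1) χ : SpinConfig L N → ℂ) n)) = _
  rw [coordOp_phaseMinus_apply h, coordOp_phasePlus_apply h, coordOp_spinZ_apply h, spinTerm,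
    ← k1, ← k2, ← hcv, tangent_apply]
  push_cast
  have hp := conj_configPhase_mul φ n.1
  generalize conj (configPhase φ n.1) = p at *
  generalize configPhase φ n.1 = q at *
  linear_combination ((c : ℂ) / 2 * tangentAt (θ x) (φ x) (v x)
      * (Real.sqrt (n.1 x * (N - n.1 x + 1)) : ℝ) * (ψ : (L →₀ ℕ) → ℂ) (n.1 - Finsupp.single x 1)
    + (c : ℂ) / 2 * conj (tangentAt (θ x) (φ x) (v x))
      * (Real.sqrt ((n.1 x + 1) * (N - n.1 x)) : ℝ) * (ψ : (L →₀ ℕ) → ℂ) (n.1 + Finsupp.single x 1)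
    - (c : ℂ) * radial (θ x) (φ x) (v x) * n.1 x * (ψ : (L →₀ ℕ) → ℂ) n.1) * hp

theorem transport_apply_eq_zero {θ φ : L → ℝ} {V : SpinSpace L N →ₗᵢ[ℂ] FockSpace L}
    (hV : IsDyson θ φ N V) (B : SpinSpace L N →L[ℂ] SpinSpace L N) (ψ : FockSpace L) {n : L →₀ ℕ}
    (hn : ∃ x, N < n x) : (transport V B ψ : (L →₀ ℕ) → ℂ) n = 0 :=
  hV.apply_eq_zero _ hn

end BosonPicture

/-! ### Number-bounded vectors and relative bounds -/

section NumberBounds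

variable {L : Type*} {N : ℕ}

theorem exists_lp_of_norm_le {I : Type*} {f : I → ℂ} {g : lp (fun _ : I => ℂ) 2} {K : ℝ}
    (hK : 0 ≤ K) (h : ∀ i, ‖f i‖ ≤ K * ‖(g : I → ℂ) i‖) :
    ∃ F : lp (fun _ : I => ℂ) 2, (∀ i, (F : I → ℂ) i = f i) ∧ ‖F‖ ≤ K * ‖g‖ := by
  have hg := memℓp_two_iff.1 (lp.memℓp g)
  have hle : ∀ i, ‖f i‖ ^ 2 ≤ K ^ 2 * ‖(g : I → ℂ) i‖ ^ 2 := fun i => by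
    rw [← mul_pow]
    exact pow_le_pow_left₀ (norm_nonneg _) (h i) 2
  have hf : Memℓp (E := fun _ : I => ℂ) f 2 :=
    memℓp_two_iff.2 (Summable.of_nonneg_of_le (fun _ => sq_nonneg _) hle (hg.mul_left _))
  refine ⟨⟨f, hf⟩, fun _ => rfl, ?_⟩
  have h2 : (0 : ℝ) < (2 : ℝ≥0∞).toReal := by simp
  have e1 := lp.norm_rpow_eq_tsum h2 g
  have e2 := lp.norm_rpow_eq_tsum (E := fun _ : I => ℂ) h2 ⟨f, hf⟩
  simp only [ENNReal.toReal_ofNat, Real.rpow_ofNat] at e1 e2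
  refine le_of_sq_le_sq ?_ (by positivity)
  rw [mul_pow, e1, e2, ← tsum_mul_left]
  exact (memℓp_two_iff.1 hf).tsum_le_tsum hle (hg.mul_left _)

theorem exists_lp_of_norm_le_shift {I : Type*} {s : Set I} {σ : I → I} (hσ : Set.InjOn σ s)
    {f : I → ℂ} {ψ : lp (fun _ : I => ℂ) 2} {K : ℝ} (hK : 0 ≤ K)
    (h1 : ∀ i ∈ s, ‖f i‖ ≤ K * ‖(ψ : I → ℂ) (σ i)‖) (h2 : ∀ i ∉ s, f i = 0) :
    ∃ F : lp (fun _ : I => ℂ) 2, (∀ i, (F : I → ℂ) i = f i) ∧ ‖F‖ ≤ K * ‖ψ‖ := by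
  obtain ⟨F, hF1, hF2⟩ := exists_lp_of_norm_le (f := f) (g := relabel s σ hσ ψ) hK fun i => by
    rw [relabel_apply]
    by_cases hi : i ∈ s
    · rw [Set.indicator_of_mem hi]
      exact h1 i hi
    · rw [Set.indicator_of_notMem hi, h2 i hi]
      simp
  refine ⟨F, hF1, hF2.trans ?_⟩
  gcongr
  exact (ContinuousLinearMap.le_of_opNorm_le _ (norm_relabel_le s σ hσ) ψ).trans (one_mul _).le

/-- The vectors of Fock space with at most `m` bosons. -/
def upTo (L : Type*) (m : ℕ) : Submodule ℂ (FockSpace L) where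
  carrier := {ψ | ∀ n : L →₀ ℕ, m < n.degree → (ψ : (L →₀ ℕ) → ℂ) n = 0}
  zero_mem' := fun _ _ => rfl
  add_mem' := fun {ψ χ} h1 h2 n hn => by
    rw [lp.coeFn_add, Pi.add_apply, h1 n hn, h2 n hn, add_zero]
  smul_mem' := fun c ψ h n hn => by
    rw [lp.coeFn_smul, Pi.smul_apply, h n hn, smul_zero]

theorem upTo_mono {m m' : ℕ} (h : m ≤ m') : upTo L m ≤ upTo L m' :=
  fun _ hψ n hn => hψ n (h.trans_lt hn)

theorem degree_add_single (n : L →₀ ℕ) (x : L) :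
    (n + Finsupp.single x 1).degree = n.degree + 1 := by
  rw [map_add, Finsupp.degree_single]

theorem sub_single_add {n : L →₀ ℕ} {x : L} (h : n x ≠ 0) :
    n - Finsupp.single x 1 + Finsupp.single x 1 = n := by
  ext y
  by_cases hy : y = x
  · subst hy
    simp
    lia
  · simp [Ne.symm hy]

theorem degree_sub_single {n : L →₀ ℕ} {x : L} (h : n x ≠ 0) :
    (n - Finsupp.single x 1).degree + 1 = n.degree := by
  rw [← degree_add_single, sub_single_add h]

theorem injOn_sub_single (x : L) :
    Set.InjOn (fun n : L →₀ ℕ => n - Finsupp.single x 1) {n | n x ≠ 0} := by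
  intro n hn k hk h
  have := congrArg (· + Finsupp.single x 1) h
  dsimp only at this
  rwa [sub_single_add hn, sub_single_add hk] at this

theorem injOn_add_single (x : L) :
    Set.InjOn (fun n : L →₀ ℕ => n + Finsupp.single x 1) Set.univ :=
  fun _ _ _ _ h => add_right_cancel h

/-- Operators `∑ₓ (αₓ Tₓ + βₓ Tₓ* + γₓ)`, where `Tₓ` adds a boson at `x`, are bounded on vectors
with at most `m` bosons if the coefficients there are bounded by a summable sequence in `x`. -/
theorem exists_hasSum_shift {m : ℕ} {ψ : FockSpace L} (hψ : ψ ∈ upTo L m)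
    {α β γ : L → (L →₀ ℕ) → ℂ} {r : L → ℝ} (hr : Summable r) (hr0 : ∀ x, 0 ≤ r x) {a b c : ℝ}
    (ha0 : 0 ≤ a) (hb0 : 0 ≤ b) (hc0 : 0 ≤ c)
    (hα0 : ∀ x n, n x = 0 → α x n = 0)
    (hα : ∀ x n, n x ≠ 0 → n.degree ≤ m + 1 → ‖α x n‖ ≤ r x * a)
    (hβ : ∀ x n, n.degree + 1 ≤ m → ‖β x n‖ ≤ r x * b)
    (hγ : ∀ x n, n.degree ≤ m → ‖γ x n‖ ≤ r x * c) :
    ∃ g : FockSpace L, g ∈ upTo L (m + 1) ∧ ‖g‖ ≤ (a + b + c) * (∑' x, r x) * ‖ψ‖ ∧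
      ∀ n, HasSum (fun x => α x n * (ψ : (L →₀ ℕ) → ℂ) (n - Finsupp.single x 1)
        + β x n * (ψ : (L →₀ ℕ) → ℂ) (n + Finsupp.single x 1)
        + γ x n * (ψ : (L →₀ ℕ) → ℂ) n) ((g : (L →₀ ℕ) → ℂ) n) := by
  have key : ∀ x, ∃ F : FockSpace L, (∀ n, (F : (L →₀ ℕ) → ℂ) n
      = α x n * (ψ : (L →₀ ℕ) → ℂ) (n - Finsupp.single x 1)
        + β x n * (ψ : (L →₀ ℕ) → ℂ) (n + Finsupp.single x 1)
        + γ x n * (ψ : (L →₀ ℕ) → ℂ) n) ∧ ‖F‖ ≤ r x * ((a + b + c) * ‖ψ‖) := fun x => by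
    obtain ⟨A, hA1, hA2⟩ := exists_lp_of_norm_le_shift (injOn_sub_single x)
      (f := fun n => α x n * (ψ : (L →₀ ℕ) → ℂ) (n - Finsupp.single x 1)) (ψ := ψ)
      (K := r x * a) (mul_nonneg (hr0 x) ha0) (fun n hn => by
        by_cases hd : n.degree ≤ m + 1
        · rw [norm_mul]
          gcongr
          exact hα x n hn hd
        · have := degree_sub_single hn
          rw [hψ (n - Finsupp.single x 1) (by lia)]
          simp)
      (fun n hn => by rw [hα0 x n (not_not.1 hn), zero_mul])
    obtain ⟨B, hB1, hB2⟩ := exists_lp_of_norm_le_shift (injOn_add_single x)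
      (f := fun n => β x n * (ψ : (L →₀ ℕ) → ℂ) (n + Finsupp.single x 1)) (ψ := ψ)
      (K := r x * b) (mul_nonneg (hr0 x) hb0) (fun n _ => by
        by_cases hd : n.degree + 1 ≤ m
        · rw [norm_mul]
          gcongr
          exact hβ x n hd
        · have := degree_add_single n x
          rw [hψ (n + Finsupp.single x 1) (by lia)]
          simp)
      (fun n hn => absurd (Set.mem_univ n) hn)
    obtain ⟨C, hC1, hC2⟩ := exists_lp_of_norm_le
      (f := fun n => γ x n * (ψ : (L →₀ ℕ) → ℂ) n) (g := ψ)
      (K := r x * c) (mul_nonneg (hr0 x) hc0) (fun n => by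
        by_cases hd : n.degree ≤ m
        · rw [norm_mul]
          gcongr
          exact hγ x n hd
        · rw [hψ n (by lia)]
          simp)
    refine ⟨A + B + C, fun n => ?_, ?_⟩
    · rw [lp.coeFn_add, lp.coeFn_add, Pi.add_apply, Pi.add_apply, hA1, hB1, hC1]
    · refine norm_add₃_le.trans ?_
      calc ‖A‖ + ‖B‖ + ‖C‖ ≤ r x * a * ‖ψ‖ + r x * b * ‖ψ‖ + r x * c * ‖ψ‖ := by gcongr
        _ = _ := by ring
  choose F hF1 hF2 using key
  have hsum := hr.mul_right ((a + b + c) * ‖ψ‖)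
  have hF : Summable F := Summable.of_norm_bounded hsum hF2
  have hcoord : ∀ n, HasSum (fun x => (F x : (L →₀ ℕ) → ℂ) n)
      (((∑' x, F x : FockSpace L) : (L →₀ ℕ) → ℂ) n) := fun n => by
    have := hF.hasSum.mapL (innerSL ℂ (fockBasis n))
    simpa only [innerSL_apply_apply, inner_fockBasis] using this
  refine ⟨∑' x, F x, fun n hn => ?_, ?_, fun n => by simpa only [hF1] using hcoord n⟩
  · refine (hcoord n).unique ?_
    convert hasSum_zero with x
    rw [hF1, hψ n (by lia), hψ (n + Finsupp.single x 1) (by rw [degree_add_single]; lia)]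
    by_cases h0 : n x = 0
    · rw [hα0 x n h0]
      simp
    · have := degree_sub_single h0
      rw [hψ (n - Finsupp.single x 1) (by lia)]
      simp
  · refine (tsum_of_norm_bounded hsum.hasSum hF2).trans (le_of_eq ?_)
    rw [tsum_mul_right]
    ring

theorem cast_apply_le_of_degree_le {n : L →₀ ℕ} {m : ℕ} (h : n.degree ≤ m) (x : L) :
    (n x : ℝ) ≤ m :=
  Nat.cast_le.2 ((Finsupp.le_degree x n).trans h)

theorem exists_hasSum_fieldTerm {w : L → ℂ} (hw : Summable fun x => ‖w x‖) {m : ℕ}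
    {ψ : FockSpace L} (hψ : ψ ∈ upTo L m) :
    ∃ g : FockSpace L, g ∈ upTo L (m + 1) ∧
      ‖g‖ ≤ 2 * Real.sqrt (m + 1) * (∑' x, ‖w x‖) * ‖ψ‖ ∧
      ∀ n, HasSum (fieldTerm w ψ n) ((g : (L →₀ ℕ) → ℂ) n) := by
  obtain ⟨g, h1, h2, h3⟩ := exists_hasSum_shift hψ
    (α := fun x n => w x * (Real.sqrt (n x) : ℝ))
    (β := fun x n => conj (w x) * (Real.sqrt (n x + 1) : ℝ)) (γ := fun _ _ => 0)
    hw (fun _ => norm_nonneg _) (a := Real.sqrt (m + 1)) (b := Real.sqrt (m + 1)) (c := 0)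
    (Real.sqrt_nonneg _) (Real.sqrt_nonneg _) le_rfl
    (fun x n h => by simp [h])
    (fun x n _ hd => by
      rw [norm_mul, Complex.norm_real, Real.norm_of_nonneg (Real.sqrt_nonneg _)]
      gcongr
      exact_mod_cast cast_apply_le_of_degree_le hd x)
    (fun x n hd => by
      rw [norm_mul, RCLike.norm_conj, Complex.norm_real, Real.norm_of_nonneg (Real.sqrt_nonneg _)]
      gcongr
      exact (Finsupp.le_degree x n).trans (Nat.le_of_succ_le hd))
    (fun x n _ => by simp)
  refine ⟨g, h1, h2.trans (le_of_eq (by ring)), fun n => ?_⟩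
  convert h3 n using 1
  ext1 x
  rw [fieldTerm, creation, annihilation]
  ring

theorem upTo_le_fieldDomain {w : L → ℂ} (hw : Summable fun x => ‖w x‖) (m : ℕ) :
    upTo L m ≤ (fieldOp w).domain := fun ψ hψ => by
  obtain ⟨g, -, -, h3⟩ := exists_hasSum_fieldTerm hw hψ
  refine ⟨fun n => (h3 n).summable, ?_⟩
  have : (fun n => ∑' x, fieldTerm w ψ n x) = (g : (L →₀ ℕ) → ℂ) := by
    ext n
    exact (h3 n).tsum_eq
  rw [this]
  exact lp.memℓp g

theorem fieldOp_apply {w : L → ℂ} (ψ : (fieldOp w).domain) (n : L →₀ ℕ) :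
    (fieldOp w ψ : (L →₀ ℕ) → ℂ) n = ∑' x, fieldTerm w (ψ : FockSpace L) n x := rfl

theorem fieldOp_eq_of_hasSum {w : L → ℂ} {ψ g : FockSpace L} (h : ψ ∈ (fieldOp w).domain)
    (hg : ∀ n, HasSum (fieldTerm w ψ n) ((g : (L →₀ ℕ) → ℂ) n)) : fieldOp w ⟨ψ, h⟩ = g := by
  ext n
  exact (hg n).tsum_eq

theorem fieldOp_mem_upTo {w : L → ℂ} {m : ℕ} {ψ : FockSpace L} (hψ : ψ ∈ upTo L m)
    (h : ψ ∈ (fieldOp w).domain) : fieldOp w ⟨ψ, h⟩ ∈ upTo L (m + 1) := fun n hn => by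
  rw [fieldOp_apply]
  convert tsum_zero with x
  rw [fieldTerm, creation, annihilation,
    hψ (n + Finsupp.single x 1) (by rw [degree_add_single]; lia)]
  by_cases h0 : n x = 0
  · simp [h0]
  · have := degree_sub_single h0
    rw [hψ (n - Finsupp.single x 1) (by lia)]
    simp

theorem norm_fieldOp_le {w : L → ℂ} (hw : Summable fun x => ‖w x‖) {m : ℕ} {ψ : FockSpace L}
    (hψ : ψ ∈ upTo L m) (h : ψ ∈ (fieldOp w).domain) :
    ‖fieldOp w ⟨ψ, h⟩‖ ≤ 2 * Real.sqrt (m + 1) * (∑' x, ‖w x‖) * ‖ψ‖ := by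
  obtain ⟨g, -, h2, h3⟩ := exists_hasSum_fieldTerm hw hψ
  rw [fieldOp_eq_of_hasSum h h3]
  exact h2

theorem summable_norm_tangent (θ φ : L → ℝ) (v : L1Three L) :
    Summable fun x => ‖tangent θ φ v x‖ :=
  (summable_norm_L1 v).of_nonneg_of_le (fun _ => norm_nonneg _)
    fun x => norm_tangentAt_le (θ x) (φ x) (v x)

theorem tsum_norm_tangent_le (θ φ : L → ℝ) (v : L1Three L) :
    ∑' x, ‖tangent θ φ v x‖ ≤ ‖v‖ := by
  rw [norm_L1_eq]
  exact (summable_norm_tangent θ φ v).tsum_le_tsum (fun x => norm_tangentAt_le (θ x) (φ x) (v x))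
    (summable_norm_L1 v)

theorem div_le_sqrt_div_sqrt {m N : ℕ} (h : m ≤ N) :
    (m : ℝ) / N ≤ Real.sqrt m / Real.sqrt N := by
  rw [← Real.sqrt_div (Nat.cast_nonneg _)]
  refine Real.le_sqrt_of_sq_le ?_
  rw [sq]
  exact mul_le_of_le_one_left (by positivity)
    (div_le_one_of_le₀ (Nat.cast_le.2 h) (Nat.cast_nonneg _))

theorem nat_div_sqrt_le {m N : ℕ} (h : m ≤ N) : (m : ℝ) / Real.sqrt N ≤ Real.sqrt m := by
  rcases Nat.eq_zero_or_pos N with h0 | h0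
  · simp [h0]
  rw [div_le_iff₀ (Real.sqrt_pos.2 (Nat.cast_pos.2 h0))]
  calc (m : ℝ) = Real.sqrt m * Real.sqrt m := (Real.mul_self_sqrt (Nat.cast_nonneg _)).symm
    _ ≤ Real.sqrt m * Real.sqrt N := by gcongr

theorem abs_one_sub_sqrt_le {t : ℝ} (h0 : 0 ≤ t) (h1 : t ≤ 1) : |1 - Real.sqrt (1 - t)| ≤ t := by
  have h2 : 1 - t ≤ Real.sqrt (1 - t) := by
    refine Real.le_sqrt_of_sq_le ?_
    nlinarith
  have h3 : Real.sqrt (1 - t) ≤ 1 := Real.sqrt_le_one.2 (by linarith)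
  rw [abs_of_nonneg (by linarith)]
  linarith

theorem transport_fluct_eq {θ φ : L → ℝ} {V : SpinSpace L N →ₗᵢ[ℂ] FockSpace L}
    (hV : IsDyson θ φ N V) (v : L1Three L) {m : ℕ} (hm : m < N) {ψ g : FockSpace L}
    (hg : g ∈ upTo L (m + 1))
    (h : ∀ n, HasSum (spinTerm θ φ N v ψ n) ((g : (L →₀ ℕ) → ℂ) n)) :
    transport V (fluct θ φ N v) ψ = g := by
  ext n
  by_cases hn : ∃ x, N < n x
  · obtain ⟨x, hx⟩ := hn
    rw [transport_apply_eq_zero hV _ _ ⟨x, hx⟩, hg n]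
    have := Finsupp.le_degree x n
    lia
  · push Not at hn
    exact (hasSum_transport_fluct hV (by lia) v ψ ⟨n, hn⟩).unique (h n)

/-- The bosonic expression is bounded by `4 √(m + 1) |v|₁` on vectors with at most `m < N` bosons: the
creation and annihilation parts contribute `√(m + 1)` each, the number part
`2 m / √N ≤ 2 √(m + 1)`. -/
theorem exists_hasSum_spinTerm (θ φ : L → ℝ) (v : L1Three L) {m : ℕ} (hm : m < N)
    {ψ : FockSpace L} (hψ : ψ ∈ upTo L m) :
    ∃ g : FockSpace L, g ∈ upTo L (m + 1) ∧ ‖g‖ ≤ 4 * Real.sqrt (m + 1) * ‖v‖ * ‖ψ‖ ∧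
      ∀ n, HasSum (spinTerm θ φ N v ψ n) ((g : (L →₀ ℕ) → ℂ) n) := by
  have hN : (0 : ℝ) < N := Nat.cast_pos.2 (by lia)
  obtain ⟨g, h1, h2, h3⟩ := exists_hasSum_shift hψ
    (α := fun x n => tangent θ φ v x
      * (Real.sqrt (n x) * Real.sqrt (1 - ((n x : ℝ) - 1) / N) : ℝ))
    (β := fun x n => conj (tangent θ φ v x)
      * (Real.sqrt (n x + 1) * Real.sqrt (1 - (n x : ℝ) / N) : ℝ))
    (γ := fun x n => -(2 / Real.sqrt N * radial (θ x) (φ x) (v x) * n x : ℝ))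
    (summable_norm_L1 v) (fun _ => norm_nonneg _) (a := Real.sqrt (m + 1))
    (b := Real.sqrt (m + 1)) (c := 2 * Real.sqrt (m + 1))
    (Real.sqrt_nonneg _) (Real.sqrt_nonneg _) (by positivity)
    (fun x n h => by simp [h])
    (fun x n h0 hd => by
      rw [norm_mul, Complex.norm_real, Real.norm_of_nonneg (by positivity)]
      refine mul_le_mul (norm_tangentAt_le _ _ _) ?_ (by positivity) (norm_nonneg _)
      have hn1 : (1 : ℝ) ≤ n x := Nat.one_le_cast.2 (by lia)
      have hs : Real.sqrt (1 - ((n x : ℝ) - 1) / N) ≤ 1 := by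
        rw [Real.sqrt_le_one]
        have : 0 ≤ ((n x : ℝ) - 1) / N := div_nonneg (by linarith) hN.le
        linarith
      refine (mul_le_of_le_one_right (Real.sqrt_nonneg _) hs).trans ?_
      gcongr
      exact_mod_cast cast_apply_le_of_degree_le hd x)
    (fun x n hd => by
      rw [norm_mul, RCLike.norm_conj, Complex.norm_real, Real.norm_of_nonneg (by positivity)]
      refine mul_le_mul (norm_tangentAt_le _ _ _) ?_ (by positivity) (norm_nonneg _)
      have hs : Real.sqrt (1 - (n x : ℝ) / N) ≤ 1 := by
        rw [Real.sqrt_le_one]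
        have : 0 ≤ (n x : ℝ) / N := by positivity
        linarith
      refine (mul_le_of_le_one_right (Real.sqrt_nonneg _) hs).trans ?_
      gcongr
      exact (Finsupp.le_degree x n).trans (Nat.le_of_succ_le hd))
    (fun x n hd => by
      rw [norm_neg, Complex.norm_real, Real.norm_eq_abs, abs_mul, abs_mul,
        abs_of_nonneg (by positivity : (0 : ℝ) ≤ 2 / Real.sqrt N), Nat.abs_cast]
      have e1 := abs_radial_le (θ x) (φ x) (v x)
      have e2 := cast_apply_le_of_degree_le hd x
      have e3 : (m : ℝ) / Real.sqrt N ≤ Real.sqrt (m + 1) :=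
        (nat_div_sqrt_le hm.le).trans (Real.sqrt_le_sqrt (by linarith))
      calc 2 / Real.sqrt N * |radial (θ x) (φ x) (v x)| * n x
          ≤ 2 / Real.sqrt N * ‖v x‖ * m := by gcongr
        _ = ‖v x‖ * (2 * (m / Real.sqrt N)) := by ring
        _ ≤ _ := by gcongr)
  refine ⟨g, h1, h2.trans (le_of_eq (by rw [norm_L1_eq]; ring)), fun n => ?_⟩
  convert h3 n using 1
  ext1 x
  rw [spinTerm]
  push_cast
  ring

theorem transport_fluct_mem_upTo {θ φ : L → ℝ} {V : SpinSpace L N →ₗᵢ[ℂ] FockSpace L}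
    (hV : IsDyson θ φ N V) (v : L1Three L) {m : ℕ} (hm : m < N) {ψ : FockSpace L}
    (hψ : ψ ∈ upTo L m) : transport V (fluct θ φ N v) ψ ∈ upTo L (m + 1) := by
  obtain ⟨g, h1, -, h3⟩ := exists_hasSum_spinTerm θ φ v hm hψ
  rw [transport_fluct_eq hV v hm h1 h3]
  exact h1

theorem norm_transport_fluct_le {θ φ : L → ℝ} {V : SpinSpace L N →ₗᵢ[ℂ] FockSpace L}
    (hV : IsDyson θ φ N V) (v : L1Three L) {m : ℕ} (hm : m < N) {ψ : FockSpace L}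
    (hψ : ψ ∈ upTo L m) :
    ‖transport V (fluct θ φ N v) ψ‖ ≤ 4 * Real.sqrt (m + 1) * ‖v‖ * ‖ψ‖ := by
  obtain ⟨g, h1, h2, h3⟩ := exists_hasSum_spinTerm θ φ v hm hψ
  rw [transport_fluct_eq hV v hm h1 h3]
  exact h2

/-- On vectors with at most `m` bosons, a single fluctuation operator is `O(N^{-1/2})`-close to the
boson field. -/
theorem norm_fieldOp_sub_transport_fluct_le {θ φ : L → ℝ}
    {V : SpinSpace L N →ₗᵢ[ℂ] FockSpace L} (hV : IsDyson θ φ N V) (v : L1Three L) {m : ℕ}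
    (hm : m < N) {ψ : FockSpace L} (hψ : ψ ∈ upTo L m)
    (h : ψ ∈ (fieldOp (tangent θ φ v)).domain) :
    ‖fieldOp (tangent θ φ v) ⟨ψ, h⟩ - transport V (fluct θ φ N v) ψ‖
      ≤ 4 * (Real.sqrt (m + 1) * Real.sqrt m / Real.sqrt N) * ‖v‖ * ‖ψ‖ := by
  have hN : (0 : ℝ) < N := Nat.cast_pos.2 (by lia)
  obtain ⟨gF, -, -, hF⟩ := exists_hasSum_fieldTerm (summable_norm_tangent θ φ v) hψ
  obtain ⟨gS, hS1, -, hS⟩ := exists_hasSum_spinTerm (N := N) θ φ v hm hψ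
  rw [fieldOp_eq_of_hasSum h hF, transport_fluct_eq hV v hm hS1 hS]
  set K : ℝ := Real.sqrt (m + 1) * Real.sqrt m / Real.sqrt N with hK
  have hK0 : 0 ≤ K := by positivity
  -- a factor `√j ≤ √(m + 1)` times `1 - √(1 - i / N) ≤ i / N`
  have hkey : ∀ i j : ℕ, i ≤ m → j ≤ m + 1 →
      Real.sqrt j * |1 - Real.sqrt (1 - (i : ℝ) / N)| ≤ K := fun i j hi hj => by
    have hi' : (i : ℝ) ≤ m := Nat.cast_le.2 hi
    have hmN : (m : ℝ) ≤ N := Nat.cast_le.2 hm.le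
    have e1 := abs_one_sub_sqrt_le (t := (i : ℝ) / N) (by positivity)
      (div_le_one_of_le₀ (hi'.trans hmN) hN.le)
    have e2 : (i : ℝ) / N ≤ Real.sqrt m / Real.sqrt N :=
      (by gcongr : (i : ℝ) / N ≤ m / N).trans (div_le_sqrt_div_sqrt hm.le)
    calc Real.sqrt j * |1 - Real.sqrt (1 - (i : ℝ) / N)|
        ≤ Real.sqrt (m + 1) * (Real.sqrt m / Real.sqrt N) := by
          refine mul_le_mul (Real.sqrt_le_sqrt (by exact_mod_cast hj)) (e1.trans e2)
            (abs_nonneg _) (Real.sqrt_nonneg _)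
      _ = K := by rw [hK]; ring
  obtain ⟨g, -, h2, h3⟩ := exists_hasSum_shift hψ
    (α := fun x n => tangent θ φ v x
      * (Real.sqrt (n x) * (1 - Real.sqrt (1 - ((n x : ℝ) - 1) / N)) : ℝ))
    (β := fun x n => conj (tangent θ φ v x)
      * (Real.sqrt (n x + 1) * (1 - Real.sqrt (1 - (n x : ℝ) / N)) : ℝ))
    (γ := fun x n => (2 / Real.sqrt N * radial (θ x) (φ x) (v x) * n x : ℝ))
    (summable_norm_L1 v) (fun _ => norm_nonneg _) (a := K) (b := K) (c := 2 * K)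
    hK0 hK0 (by positivity)
    (fun x n h => by simp [h])
    (fun x n h0 hd => by
      rw [norm_mul, Complex.norm_real, Real.norm_eq_abs, abs_mul,
        abs_of_nonneg (Real.sqrt_nonneg _)]
      refine mul_le_mul (norm_tangentAt_le _ _ _) ?_ (by positivity) (norm_nonneg _)
      have hle := (Finsupp.le_degree x n).trans hd
      have := hkey (n x - 1) (n x) (by lia) hle
      rwa [Nat.cast_sub (by lia), Nat.cast_one] at this)
    (fun x n hd => by
      rw [norm_mul, RCLike.norm_conj, Complex.norm_real, Real.norm_eq_abs, abs_mul,
        abs_of_nonneg (Real.sqrt_nonneg _)]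
      refine mul_le_mul (norm_tangentAt_le _ _ _) ?_ (by positivity) (norm_nonneg _)
      have hle := Finsupp.le_degree x n
      have := hkey (n x) (n x + 1) (by lia) (by lia)
      rwa [Nat.cast_add, Nat.cast_one] at this)
    (fun x n hd => by
      rw [Complex.norm_real, Real.norm_eq_abs, abs_mul, abs_mul,
        abs_of_nonneg (by positivity : (0 : ℝ) ≤ 2 / Real.sqrt N), Nat.abs_cast]
      have e1 := abs_radial_le (θ x) (φ x) (v x)
      have e2 := cast_apply_le_of_degree_le hd x
      have e3 : (m : ℝ) ≤ Real.sqrt (m + 1) * Real.sqrt m := by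
        calc (m : ℝ) = Real.sqrt m * Real.sqrt m :=
              (Real.mul_self_sqrt (Nat.cast_nonneg _)).symm
          _ ≤ _ := by gcongr; linarith
      calc 2 / Real.sqrt N * |radial (θ x) (φ x) (v x)| * n x
          ≤ 2 / Real.sqrt N * ‖v x‖ * m := by gcongr
        _ = ‖v x‖ * (2 * (m / Real.sqrt N)) := by ring
        _ ≤ _ := by rw [hK]; gcongr)
  have hg : gF - gS = g := by
    ext n
    rw [lp.coeFn_sub, Pi.sub_apply]
    refine ((hF n).sub (hS n)).unique ?_
    suffices hfun : (fun x => fieldTerm (tangent θ φ v) ψ n x - spinTerm θ φ N v ψ n x) = _ by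
      rw [hfun]
      exact h3 n
    ext1 x
    rw [spinTerm, fieldTerm, creation, annihilation]
    push_cast
    ring
  rw [hg]
  refine h2.trans (le_of_eq ?_)
  rw [norm_L1_eq]
  ring

end NumberBounds

/-! ### Products of fields and of fluctuation operators -/

section FieldProducts

variable {L : Type*} {N : ℕ}

theorem fieldProd_succ {k : ℕ} (w : Fin (k + 1) → L → ℂ) :
    fieldProd w = natMul (fieldOp (w 0)) (fieldProd fun j => w j.succ) :=
  natProd_succ _

theorem fluctProd_succ (θ φ : L → ℝ) (V : SpinSpace L N →ₗᵢ[ℂ] FockSpace L) {k : ℕ}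
    (v : Fin (k + 1) → L1Three L) :
    fluctProd θ φ V v
      = transport V (fluct θ φ N (v 0)) * fluctProd θ φ V fun j => v j.succ := by
  rw [fluctProd, List.ofFn_succ, List.prod_cons]
  rfl

theorem fieldProd_mem_upTo {k : ℕ} {w : Fin k → L → ℂ} {m : ℕ} {ψ : FockSpace L}
    (hψ : ψ ∈ upTo L m) (h : ψ ∈ (fieldProd w).domain) :
    fieldProd w ⟨ψ, h⟩ ∈ upTo L (m + k) := by
  induction k with
  | zero => exact hψ
  | succ k ih =>
    obtain ⟨h1, h2⟩ := mem_domain_natMul.1 (fieldProd_succ w ▸ h)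
    have e : fieldProd w ⟨ψ, h⟩ = fieldOp (w 0) ⟨_, h2⟩ := by
      have : ∀ (S : FockSpace L →ₗ.[ℂ] FockSpace L) (hS : ψ ∈ S.domain),
          S = natMul (fieldOp (w 0)) (fieldProd fun j => w j.succ) →
          S ⟨ψ, hS⟩ = fieldOp (w 0) ⟨_, h2⟩ := fun S hS hSe => by
        subst hSe
        exact natMul_apply hS h1 h2
      exact this _ h (fieldProd_succ w)
    rw [e]
    exact fieldOp_mem_upTo (ih h1) h2

theorem fieldProd_succ_apply {k : ℕ} {w : Fin (k + 1) → L → ℂ} {ψ : FockSpace L}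
    (h1 : ψ ∈ (fieldProd fun j => w j.succ).domain)
    (h2 : fieldProd (fun j => w j.succ) ⟨ψ, h1⟩ ∈ (fieldOp (w 0)).domain) :
    ∃ h : ψ ∈ (fieldProd w).domain, fieldProd w ⟨ψ, h⟩ = fieldOp (w 0) ⟨_, h2⟩ := by
  rw [fieldProd_succ w]
  exact ⟨mem_domain_natMul.2 ⟨h1, h2⟩, rfl⟩

theorem sqrt_factorial_succ_div (n k : ℕ) :
    Real.sqrt (((n + (k + 1)).factorial : ℝ) / (n.factorial : ℝ))
      = Real.sqrt (((n + k : ℕ) : ℝ) + 1)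
        * Real.sqrt (((n + k).factorial : ℝ) / (n.factorial : ℝ)) := by
  rw [← Real.sqrt_mul (by positivity), ← add_assoc, Nat.factorial_succ]
  congr 1
  push_cast
  ring

theorem exists_fieldProd_bound {k : ℕ} {w : Fin k → L → ℂ} (hw : ∀ j, Summable fun x => ‖w j x‖)
    {n : ℕ} {ψ : FockSpace L} (hψ : ψ ∈ upTo L n) :
    ∃ h : ψ ∈ (fieldProd w).domain, ‖fieldProd w ⟨ψ, h⟩‖
      ≤ 2 ^ k * Real.sqrt (((n + k).factorial : ℝ) / (n.factorial : ℝ))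
        * (∏ j, ∑' x, ‖w j x‖) * ‖ψ‖ := by
  induction k with
  | zero =>
    refine ⟨trivial, ?_⟩
    have h0 : (n.factorial : ℝ) ≠ 0 := Nat.cast_ne_zero.2 n.factorial_ne_zero
    simp only [pow_zero, add_zero, div_self h0, Real.sqrt_one, Finset.univ_eq_empty,
      Finset.prod_empty, mul_one, one_mul]
    exact le_rfl
  | succ k ih =>
    obtain ⟨h1, hb⟩ := ih fun j => hw j.succ
    have hm := fieldProd_mem_upTo hψ h1
    have h2 := upTo_le_fieldDomain (hw 0) _ hm
    obtain ⟨h, he⟩ := fieldProd_succ_apply h1 h2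
    refine ⟨h, ?_⟩
    rw [he, sqrt_factorial_succ_div, Fin.prod_univ_succ]
    refine (norm_fieldOp_le (hw 0) hm h2).trans ?_
    calc 2 * Real.sqrt (((n + k : ℕ) : ℝ) + 1) * (∑' x, ‖w 0 x‖) * ‖_‖
        ≤ 2 * Real.sqrt (((n + k : ℕ) : ℝ) + 1) * (∑' x, ‖w 0 x‖) *
          (2 ^ k * Real.sqrt (((n + k).factorial : ℝ) / (n.factorial : ℝ))
            * (∏ j : Fin k, ∑' x, ‖w j.succ x‖) * ‖ψ‖) := by
          have : 0 ≤ ∑' x, ‖w 0 x‖ := tsum_nonneg fun _ => norm_nonneg _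
          gcongr
      _ = _ := by ring

theorem fluctProd_mem_upTo {θ φ : L → ℝ} {V : SpinSpace L N →ₗᵢ[ℂ] FockSpace L}
    (hV : IsDyson θ φ N V) {k : ℕ} (v : Fin k → L1Three L) {n : ℕ} (hn : n + k ≤ N)
    {ψ : FockSpace L} (hψ : ψ ∈ upTo L n) : fluctProd θ φ V v ψ ∈ upTo L (n + k) := by
  induction k with
  | zero => simpa [fluctProd] using hψ
  | succ k ih =>
    rw [fluctProd_succ]
    exact transport_fluct_mem_upTo hV _ (by lia) (ih _ (by lia))

/-- The sum over the factors in the error bound, peeled off at its first term. -/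
theorem sum_Icc_succ_bound (n k : ℕ) :
    ∑ i ∈ Finset.Icc 1 (k + 1),
        (2 : ℝ) ^ (k + 1 + i) * Real.sqrt ((n : ℝ) + ((k + 1 : ℕ) : ℝ) - (i : ℝ))
      = 2 ^ k * 4 * Real.sqrt ((n + k : ℕ) : ℝ) + 4 * ∑ i ∈ Finset.Icc 1 k,
        (2 : ℝ) ^ (k + i) * Real.sqrt ((n : ℝ) + (k : ℝ) - (i : ℝ)) := by
  have h1 : ∀ f : ℕ → ℝ, ∀ j, ∑ i ∈ Finset.Icc 1 j, f i = ∑ i ∈ Finset.range j, f (i + 1) :=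
    fun f j => by
      rw [Finset.range_eq_Ico, Finset.sum_Ico_add' f 0 j 1]
      rfl
  rw [h1, h1, Finset.sum_range_succ', Finset.mul_sum, add_comm]
  congr 1
  · rw [show (n : ℝ) + ((k + 1 : ℕ) : ℝ) - ((0 + 1 : ℕ) : ℝ) = ((n + k : ℕ) : ℝ) by
      push_cast; ring]
    ring
  · refine Finset.sum_congr rfl fun i _ => ?_
    rw [show (n : ℝ) + ((k + 1 : ℕ) : ℝ) - ((i + 1 + 1 : ℕ) : ℝ)
      = (n : ℝ) + k - ((i + 1 : ℕ) : ℝ) by push_cast; ring]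
    ring

/-- The quantitative bound, valid on all vectors with at most `n` bosons. The factors are exchanged
one at a time: `T₀ T' - A₀ A' = (T₀ - A₀) T' + A₀ (T' - A')`. -/
theorem exists_fieldProd_sub_fluctProd_bound {θ φ : L → ℝ}
    {V : SpinSpace L N →ₗᵢ[ℂ] FockSpace L} (hV : IsDyson θ φ N V) {k : ℕ}
    (v : Fin k → L1Three L) {n : ℕ} (hn : n + k < N) {ψ : FockSpace L} (hψ : ψ ∈ upTo L n) :
    ∃ h : ψ ∈ (fieldProd fun j => tangent θ φ (v j)).domain,
      ‖(fieldProd fun j => tangent θ φ (v j)) ⟨ψ, h⟩ - fluctProd θ φ V v ψ‖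
        ≤ 1 / Real.sqrt (N : ℝ) * (∏ j, ‖v j‖)
            * Real.sqrt (((n + k).factorial : ℝ) / (n.factorial : ℝ))
            * (∑ i ∈ Finset.Icc 1 k,
                (2 : ℝ) ^ (k + i) * Real.sqrt ((n : ℝ) + (k : ℝ) - (i : ℝ)))
            * ‖ψ‖ := by
  induction k with
  | zero =>
    refine ⟨trivial, ?_⟩
    have : (fieldProd fun j : Fin 0 => tangent θ φ (v j)) ⟨ψ, trivial⟩ - fluctProd θ φ V v ψ = 0 := by
      change ψ - fluctProd θ φ V v ψ = 0
      simp [fluctProd]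
    rw [this]
    simp
  | succ k ih =>
    obtain ⟨h1, hb⟩ := ih (fun j => v j.succ) (by lia)
    have hsum := fun j => summable_norm_tangent θ φ (v j)
    obtain ⟨_, hT⟩ := exists_fieldProd_bound (fun j : Fin k => hsum j.succ) hψ
    have hm := fieldProd_mem_upTo hψ h1
    have h2 := upTo_le_fieldDomain (hsum 0) _ hm
    obtain ⟨h, he⟩ := fieldProd_succ_apply (w := fun j => tangent θ φ (v j)) h1 h2
    refine ⟨h, ?_⟩
    have hA := fluctProd_mem_upTo hV (fun j => v j.succ) (by lia) hψ
    rw [he, fluctProd_succ, mul_apply_eq_comp]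
    set τ := fieldProd (fun j : Fin k => tangent θ φ (v j.succ)) ⟨ψ, h1⟩ with hτ
    set χ := fluctProd θ φ V (fun j : Fin k => v j.succ) ψ with hχ
    set P : ℝ := ∏ j : Fin k, ‖v j.succ‖ with hP
    set S : ℝ := ∑ i ∈ Finset.Icc 1 k,
      (2 : ℝ) ^ (k + i) * Real.sqrt ((n : ℝ) + (k : ℝ) - (i : ℝ)) with hS
    set Q : ℝ := Real.sqrt (((n + k).factorial : ℝ) / (n.factorial : ℝ)) with hQ
    set s : ℝ := Real.sqrt (((n + k : ℕ) : ℝ) + 1) with hs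
    have hτn : ‖τ‖ ≤ 2 ^ k * Q * P * ‖ψ‖ := by
      refine hT.trans ?_
      gcongr with j
      exact Finset.prod_le_prod (fun _ _ => tsum_nonneg fun _ => norm_nonneg _)
        fun j _ => tsum_norm_tangent_le θ φ (v j.succ)
    have b1 := norm_fieldOp_sub_transport_fluct_le hV (v 0) (by lia) hm h2
    have b2 := norm_transport_fluct_le hV (v 0) (m := n + k) (by lia) (Submodule.sub_mem _ hm hA)
    have e : fieldOp (tangent θ φ (v 0)) ⟨τ, h2⟩ - transport V (fluct θ φ N (v 0)) χ
        = (fieldOp (tangent θ φ (v 0)) ⟨τ, h2⟩ - transport V (fluct θ φ N (v 0)) τ)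
          + transport V (fluct θ φ N (v 0)) (τ - χ) := by
      rw [map_sub]
      abel
    rw [e, sqrt_factorial_succ_div, Fin.prod_univ_succ, sum_Icc_succ_bound]
    refine (norm_add_le _ _).trans ?_
    calc _ ≤ 4 * (s * Real.sqrt ((n + k : ℕ) : ℝ) / Real.sqrt N) * ‖v 0‖ * ‖τ‖
          + 4 * s * ‖v 0‖ * ‖τ - χ‖ := add_le_add b1 b2
      _ ≤ 4 * (s * Real.sqrt ((n + k : ℕ) : ℝ) / Real.sqrt N) * ‖v 0‖ * (2 ^ k * Q * P * ‖ψ‖)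
          + 4 * s * ‖v 0‖ * (1 / Real.sqrt N * P * Q * S * ‖ψ‖) := by gcongr
      _ = _ := by ring

/-- The span of the vectors with boundedly many bosons. -/
def finiteVectors (L : Type*) : Submodule ℂ (FockSpace L) := ⨆ m, upTo L m

theorem mem_finiteVectors {ψ : FockSpace L} : ψ ∈ finiteVectors L ↔ ∃ m, ψ ∈ upTo L m :=
  Submodule.mem_iSup_of_directed _
    (directed_of_isDirected_le fun _ _ h => upTo_mono h)

theorem tendsto_fluctProd {θ φ : L → ℝ} {V : (N : ℕ) → SpinSpace L N →ₗᵢ[ℂ] FockSpace L}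
    (hV : ∀ N : ℕ, 0 < N → IsDyson θ φ N (V N)) {k : ℕ} (v : Fin k → L1Three L)
    {N : ℕ → ℕ} (hN : Tendsto N atTop atTop) {ψ : FockSpace L} (hψ : ψ ∈ finiteVectors L) :
    ∃ h : ψ ∈ (fieldProd fun j => tangent θ φ (v j)).domain,
      Tendsto (fun m => fluctProd θ φ (V (N m)) v ψ) atTop
        (𝓝 ((fieldProd fun j => tangent θ φ (v j)) ⟨ψ, h⟩)) := by
  obtain ⟨n, hn⟩ := mem_finiteVectors.1 hψ
  obtain ⟨h, -⟩ := exists_fieldProd_bound (fun j => summable_norm_tangent θ φ (v j)) hn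
  refine ⟨h, ?_⟩
  rw [tendsto_iff_norm_sub_tendsto_zero]
  set C : ℝ := (∏ j, ‖v j‖) * Real.sqrt (((n + k).factorial : ℝ) / (n.factorial : ℝ))
            * (∑ i ∈ Finset.Icc 1 k,
                (2 : ℝ) ^ (k + i) * Real.sqrt ((n : ℝ) + (k : ℝ) - (i : ℝ))) * ‖ψ‖ with hC
  have hlim : Tendsto (fun m => 1 / Real.sqrt (N m : ℝ) * C) atTop (𝓝 0) := by
    have h1 : Tendsto (fun m => Real.sqrt (N m : ℝ)) atTop atTop :=
      Real.tendsto_sqrt_atTop.comp (tendsto_natCast_atTop_atTop.comp hN)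
    simpa [one_div] using h1.inv_tendsto_atTop.mul_const C
  refine squeeze_zero' (Eventually.of_forall fun _ => norm_nonneg _) ?_ hlim
  filter_upwards [hN.eventually_gt_atTop (n + k)] with m hm
  obtain ⟨h', hb⟩ := exists_fieldProd_sub_fluctProd_bound (hV (N m) (by lia)) v hm hn
  rw [norm_sub_rev]
  refine hb.trans (le_of_eq ?_)
  rw [hC]
  ring

theorem fockBasis_mem_upTo (n : L →₀ ℕ) : fockBasis n ∈ upTo L n.degree := fun k hk => by
  classical
  rw [fockBasis_apply, if_neg]
  rintro rfl
  exact lt_irrefl _ hk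

theorem finiteParticle_le_upTo (n : ℕ) : finiteParticle L n ≤ upTo L n := by
  refine Submodule.span_le.2 ?_
  rintro ψ ⟨w, -, h, rfl⟩
  have h0 : fockBasis (0 : L →₀ ℕ) ∈ upTo L 0 := by
    simpa using fockBasis_mem_upTo (0 : L →₀ ℕ)
  simpa using fieldProd_mem_upTo h0 h

theorem allFiniteParticle_le : allFiniteParticle L ≤ finiteVectors L :=
  iSup_mono finiteParticle_le_upTo

end FieldProducts

/-! ### Self-adjointness of the boson field -/

section FieldSelfAdjoint

variable {L : Type*}

theorem fockBasis_mem_fieldDomain {w : L → ℂ} (hw : Summable fun x => ‖w x‖) (n : L →₀ ℕ) :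
    fockBasis n ∈ (fieldOp w).domain :=
  upTo_le_fieldDomain hw _ (fockBasis_mem_upTo n)

open Classical in
theorem fieldTerm_fockBasis (w : L → ℂ) (n k : L →₀ ℕ) (x : L) :
    fieldTerm w (fockBasis n) k x
      = w x * (Real.sqrt (n x + 1) : ℝ) * (if k = n + Finsupp.single x 1 then 1 else 0)
        + conj (w x) * (Real.sqrt (n x) : ℝ)
          * (if k = n - Finsupp.single x 1 then 1 else 0) := by
  rw [fieldTerm, creation, annihilation, fockBasis_apply, fockBasis_apply]
  congr 1
  · by_cases h : k = n + Finsupp.single x 1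
    · subst h
      simp
    · rw [if_neg h]
      by_cases h0 : k x = 0
      · simp [h0]
      · rw [if_neg]
        · simp
        · rintro rfl
          exact h (sub_single_add h0).symm
  · by_cases h : k + Finsupp.single x 1 = n
    · subst h
      simp
    · rw [if_neg h]
      by_cases h0 : n x = 0
      · simp [h0]
      · rw [if_neg]
        · simp
        · rintro rfl
          exact h (sub_single_add h0)

/-- The field operator on its maximal domain acts by pairing with its values on the basis, so it is
the adjoint of its restriction to the span of the basis. -/
theorem hasSum_fieldTerm_inner {w : L → ℂ} (hw : Summable fun x => ‖w x‖) (χ : FockSpace L)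
    (n : L →₀ ℕ) :
    HasSum (fieldTerm w χ n)
      (inner ℂ (fieldOp w ⟨fockBasis n, fockBasis_mem_fieldDomain hw n⟩) χ) := by
  classical
  let b : L → FockSpace L := fun x =>
    (w x * (Real.sqrt (n x + 1) : ℝ)) • fockBasis (n + Finsupp.single x 1)
      + (conj (w x) * (Real.sqrt (n x) : ℝ)) • fockBasis (n - Finsupp.single x 1)
  have hnorm : ∀ k : L →₀ ℕ, ‖fockBasis k‖ = 1 := fun k => by
    rw [fockBasis, lp.norm_single (by simp)]
    simp
  have hb : Summable b := by
    refine Summable.of_norm_bounded (g := fun x => ‖w x‖ *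
      (Real.sqrt (n.degree + 1) + Real.sqrt n.degree)) (hw.mul_right _) fun x => ?_
    have hx := cast_apply_le_of_degree_le (le_refl n.degree) x
    refine (norm_add_le _ _).trans ?_
    rw [norm_smul, norm_smul, hnorm, hnorm, norm_mul, norm_mul, RCLike.norm_conj,
      Complex.norm_real, Complex.norm_real, Real.norm_of_nonneg (Real.sqrt_nonneg _),
      Real.norm_of_nonneg (Real.sqrt_nonneg _), mul_one, mul_one, ← mul_add]
    gcongr
  have hval : fieldOp w ⟨fockBasis n, fockBasis_mem_fieldDomain hw n⟩ = ∑' x, b x := by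
    refine fieldOp_eq_of_hasSum _ fun k => ?_
    have h1 := hb.hasSum.mapL (innerSL ℂ (fockBasis k))
    simp only [innerSL_apply_apply, inner_fockBasis] at h1
    suffices hfun : fieldTerm w (fockBasis n) k = fun x => (b x : (L →₀ ℕ) → ℂ) k by
      rw [hfun]
      exact h1
    ext1 x
    rw [fieldTerm_fockBasis]
    simp only [b, lp.coeFn_add, lp.coeFn_smul, Pi.add_apply, Pi.smul_apply, smul_eq_mul,
      fockBasis_apply]
  rw [hval]
  have h2 := (hb.hasSum.mapL (innerSL ℂ χ)).star
  simp only [innerSL_apply_apply] at h2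
  suffices hfun : fieldTerm w χ n = fun x => star (inner ℂ χ (b x)) by
    have h4 : inner ℂ (∑' x, b x) χ = star (inner ℂ χ (∑' x, b x)) := (inner_conj_symm _ _).symm
    rw [hfun, h4]
    exact h2
  ext1 x
  have h3 : star (inner ℂ χ (b x)) = inner ℂ (b x) χ := inner_conj_symm _ _
  rw [h3]
  simp only [b, inner_add_left, inner_smul_left, inner_fockBasis, fieldTerm, creation,
    annihilation, map_mul, Complex.conj_conj, Complex.conj_ofReal]
  ring

theorem mem_graph_fieldOp {w : L → ℂ} (hw : Summable fun x => ‖w x‖) {ψ η : FockSpace L} :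
    (ψ, η) ∈ (fieldOp w).graph ↔ ∀ n, (η : (L →₀ ℕ) → ℂ) n
      = inner ℂ (fieldOp w ⟨fockBasis n, fockBasis_mem_fieldDomain hw n⟩) ψ := by
  constructor
  · intro h n
    obtain ⟨⟨y, hy⟩, h1, h2⟩ := (LinearPMap.mem_graph_iff _).1 h
    dsimp only at h1 h2
    subst h1
    rw [← h2, fieldOp_apply]
    exact (hasSum_fieldTerm_inner hw y n).tsum_eq
  · intro h
    have hs : ∀ n, HasSum (fieldTerm w ψ n) ((η : (L →₀ ℕ) → ℂ) n) := fun n => by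
      rw [h n]
      exact hasSum_fieldTerm_inner hw ψ n
    have hd : ψ ∈ (fieldOp w).domain := by
      refine ⟨fun n => (hs n).summable, ?_⟩
      have : (fun n => ∑' x, fieldTerm w ψ n x) = (η : (L →₀ ℕ) → ℂ) := by
        ext n
        exact (hs n).tsum_eq
      rw [this]
      exact lp.memℓp η
    exact (LinearPMap.mem_graph_iff _).2 ⟨⟨ψ, hd⟩, rfl, fieldOp_eq_of_hasSum hd hs⟩

theorem isClosed_graph_fieldOp {w : L → ℂ} (hw : Summable fun x => ‖w x‖) :
    IsClosed ((fieldOp w).graph : Set (FockSpace L × FockSpace L)) := by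
  have : ((fieldOp w).graph : Set (FockSpace L × FockSpace L))
      = ⋂ n, {p | inner ℂ (fockBasis n) p.2
        = inner ℂ (fieldOp w ⟨fockBasis n, fockBasis_mem_fieldDomain hw n⟩) p.1} := by
    ext ⟨ψ, η⟩
    rw [SetLike.mem_coe, mem_graph_fieldOp hw, Set.mem_iInter]
    simp only [inner_fockBasis, Set.mem_ofPred_eq]
  rw [this]
  exact isClosed_iInter fun n => isClosed_eq (by fun_prop) (by fun_prop)

/-- The orthogonal projection onto the configurations in `s`. -/
def cut (s : Set (L →₀ ℕ)) : FockSpace L →L[ℂ] FockSpace L := relabel s id (Set.injOn_id s)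

theorem norm_cut_le (s : Set (L →₀ ℕ)) (ψ : FockSpace L) : ‖cut s ψ‖ ≤ ‖ψ‖ :=
  (ContinuousLinearMap.le_of_opNorm_le _ (norm_relabel_le _ _ _) ψ).trans (one_mul _).le

theorem inner_congr_right {I : Type*} {ψ f g : lp (fun _ : I => ℂ) 2}
    (h : ∀ i, (ψ : I → ℂ) i ≠ 0 → (f : I → ℂ) i = (g : I → ℂ) i) :
    inner ℂ ψ f = inner ℂ ψ g := by
  rw [lp.inner_eq_tsum, lp.inner_eq_tsum]
  congr 1
  ext1 i
  by_cases hi : (ψ : I → ℂ) i = 0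
  · rw [hi, inner_zero_left, inner_zero_left]
  · rw [h i hi]

theorem inner_congr_left {I : Type*} {ψ f g : lp (fun _ : I => ℂ) 2}
    (h : ∀ i, (ψ : I → ℂ) i ≠ 0 → (f : I → ℂ) i = (g : I → ℂ) i) :
    inner ℂ f ψ = inner ℂ g ψ := by
  rw [← inner_conj_symm, inner_congr_right h, inner_conj_symm]

/-- The component of `ψ` with exactly `m` bosons. -/
def level (m : ℕ) (ψ : FockSpace L) : FockSpace L := cut {n | n.degree = m} ψ

/-- The component of `ψ` with at most `m` bosons. -/
def truncate (m : ℕ) (ψ : FockSpace L) : FockSpace L := cut {n | n.degree ≤ m} ψ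

theorem level_apply_of_eq {m : ℕ} (ψ : FockSpace L) {n : L →₀ ℕ} (h : n.degree = m) :
    (level m ψ : (L →₀ ℕ) → ℂ) n = (ψ : (L →₀ ℕ) → ℂ) n :=
  Set.indicator_of_mem (s := {n : L →₀ ℕ | n.degree = m}) h _

theorem level_apply_of_ne {m : ℕ} (ψ : FockSpace L) {n : L →₀ ℕ} (h : n.degree ≠ m) :
    (level m ψ : (L →₀ ℕ) → ℂ) n = 0 :=
  Set.indicator_of_notMem (s := {n : L →₀ ℕ | n.degree = m}) h _

theorem truncate_apply_of_le {m : ℕ} (ψ : FockSpace L) {n : L →₀ ℕ} (h : n.degree ≤ m) :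
    (truncate m ψ : (L →₀ ℕ) → ℂ) n = (ψ : (L →₀ ℕ) → ℂ) n :=
  Set.indicator_of_mem (s := {n : L →₀ ℕ | n.degree ≤ m}) h _

theorem truncate_apply_of_lt {m : ℕ} (ψ : FockSpace L) {n : L →₀ ℕ} (h : m < n.degree) :
    (truncate m ψ : (L →₀ ℕ) → ℂ) n = 0 :=
  Set.indicator_of_notMem (s := {n : L →₀ ℕ | n.degree ≤ m}) (not_le.2 h) _

theorem level_mem_upTo (m : ℕ) (ψ : FockSpace L) : level m ψ ∈ upTo L m :=
  fun _ hn => level_apply_of_ne ψ hn.ne'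

theorem truncate_mem_upTo (m : ℕ) (ψ : FockSpace L) : truncate m ψ ∈ upTo L m :=
  fun _ hn => truncate_apply_of_lt ψ hn

theorem truncate_succ (m : ℕ) (ψ : FockSpace L) :
    truncate (m + 1) ψ = truncate m ψ + level (m + 1) ψ := by
  ext n
  rw [lp.coeFn_add, Pi.add_apply]
  rcases lt_trichotomy n.degree (m + 1) with h | h | h
  · rw [truncate_apply_of_le ψ h.le, truncate_apply_of_le ψ (Nat.lt_succ_iff.1 h),
      level_apply_of_ne ψ h.ne, add_zero]
  · rw [truncate_apply_of_le ψ h.le, truncate_apply_of_lt ψ (by lia), level_apply_of_eq ψ h,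
      zero_add]
  · rw [truncate_apply_of_lt ψ h, truncate_apply_of_lt ψ (by lia),
      level_apply_of_ne ψ h.ne', add_zero]

theorem inner_truncate_self (m : ℕ) (ψ : FockSpace L) :
    inner ℂ (truncate m ψ) ψ = ((‖truncate m ψ‖ ^ 2 : ℝ) : ℂ) := by
  rw [Complex.ofReal_pow]
  refine Eq.trans (inner_congr_right fun n hn => ?_) (inner_self_eq_norm_sq_to_K _)
  by_cases h : n.degree ≤ m
  · exact (truncate_apply_of_le ψ h).symm
  · exact absurd (truncate_apply_of_lt ψ (not_le.1 h)) hn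

theorem summable_norm_sq_level (ψ : FockSpace L) : Summable fun m => ‖level (m + 1) ψ‖ ^ 2 := by
  refine summable_of_sum_range_le (c := ‖ψ‖ ^ 2) (fun _ => sq_nonneg _) fun M => ?_
  have hM : ∑ m ∈ Finset.range M, ‖level (m + 1) ψ‖ ^ 2 ≤ ‖truncate M ψ‖ ^ 2 := by
    induction M with
    | zero => simp
    | succ M ih =>
      have ho : inner ℂ (truncate M ψ) (level (M + 1) ψ) = 0 := by
        rw [← inner_zero_right (𝕜 := ℂ) (truncate M ψ)]
        refine inner_congr_right fun n hn => ?_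
        by_cases h : n.degree ≤ M
        · rw [level_apply_of_ne ψ (by lia)]
          rfl
        · exact absurd (truncate_apply_of_lt ψ (not_le.1 h)) hn
      have := norm_add_sq_eq_norm_sq_add_norm_sq_of_inner_eq_zero (𝕜 := ℂ) _ _ ho
      rw [Finset.sum_range_succ, truncate_succ, sq ‖_ + _‖, this, ← sq, ← sq]
      gcongr
  exact hM.trans (pow_le_pow_left₀ (norm_nonneg _) (norm_cut_le _ ψ) 2)

/-- Truncating an eigenvector equation of the field at `m` bosons only leaves a boundary term
between the levels `m` and `m + 1`. -/
theorem abs_im_mul_norm_truncate_sq_le {w : L → ℂ} (hw : Summable fun x => ‖w x‖)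
    (hsym : ∀ ψ ∈ finiteVectors L, ∀ h : ψ ∈ (fieldOp w).domain,
      (inner ℂ ψ (fieldOp w ⟨ψ, h⟩)).im = 0)
    {z : ℂ} {χ : FockSpace L} (hχ : (χ, z • χ) ∈ (fieldOp w).graph) (m : ℕ) :
    |z.im| * ‖truncate m χ‖ ^ 2
      ≤ 2 * Real.sqrt ((m + 1 : ℕ) + 1) * (∑' x, ‖w x‖) * (‖level m χ‖ * ‖level (m + 1) χ‖) := by
  obtain ⟨⟨y, hy⟩, e1, e2⟩ := (LinearPMap.mem_graph_iff _).1 hχ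
  dsimp only at e1 e2
  subst e1
  set P := truncate m y with hP
  set Q := level (m + 1) y with hQ
  have hPd : P ∈ (fieldOp w).domain := upTo_le_fieldDomain hw _ (truncate_mem_upTo m y)
  have hQd : Q ∈ (fieldOp w).domain := upTo_le_fieldDomain hw _ (level_mem_upTo (m + 1) y)
  have hPy : ∀ n : L →₀ ℕ, (P : (L →₀ ℕ) → ℂ) n ≠ 0 → n.degree ≤ m := fun n hn => by
    by_contra h
    exact hn (truncate_apply_of_lt y (not_le.1 h))
  have h1 : inner ℂ P (z • y) = z * ((‖P‖ ^ 2 : ℝ) : ℂ) := by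
    rw [inner_smul_right, inner_truncate_self]
  have h2 : inner ℂ P (z • y)
      = inner ℂ P (fieldOp w ⟨P, hPd⟩) + inner ℂ (level m y) (fieldOp w ⟨Q, hQd⟩) := by
    have h3 : inner ℂ P (z • y) = inner ℂ P (fieldOp w ⟨P, hPd⟩ + fieldOp w ⟨Q, hQd⟩) := by
      refine inner_congr_right fun n hn => ?_
      have hdeg := hPy n hn
      rw [← e2, ← LinearPMap.map_add, fieldOp_apply, fieldOp_apply]
      congr 1
      ext1 x
      have ht : ∀ k : L →₀ ℕ, k.degree ≤ m + 1 →
          ((P + Q : FockSpace L) : (L →₀ ℕ) → ℂ) k = (y : (L →₀ ℕ) → ℂ) k := fun k hk => by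
        rw [hP, hQ, ← truncate_succ]
        exact truncate_apply_of_le y hk
      change fieldTerm w y n x = fieldTerm w (P + Q : FockSpace L) n x
      rw [fieldTerm, fieldTerm, creation, creation, annihilation, annihilation,
        ht (n + Finsupp.single x 1) (by rw [degree_add_single]; lia)]
      by_cases h0 : n x = 0
      · simp [h0]
      · have := degree_sub_single h0
        rw [ht (n - Finsupp.single x 1) (by lia)]
    rw [h3, inner_add_right]
    congr 1
    refine inner_congr_left fun n hn => ?_
    have hdeg : m ≤ n.degree := by
      by_contra hlt
      apply hn
      rw [fieldOp_apply]
      convert tsum_zero with x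
      change fieldTerm w Q n x = 0
      rw [fieldTerm, creation, annihilation, hQ,
        level_apply_of_ne y (n := n + Finsupp.single x 1) (by rw [degree_add_single]; lia)]
      by_cases h0 : n x = 0
      · simp [h0]
      · have := degree_sub_single h0
        rw [level_apply_of_ne y (n := n - Finsupp.single x 1) (by lia)]
        simp
    rcases hdeg.eq_or_lt with h | h
    · rw [level_apply_of_eq y h.symm, hP, truncate_apply_of_le y h.symm.le]
    · rw [level_apply_of_ne y h.ne', hP, truncate_apply_of_lt y h]
  have h4 := hsym P (mem_finiteVectors.2 ⟨m, truncate_mem_upTo m y⟩) hPd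
  have h5 : z.im * ‖P‖ ^ 2 = (inner ℂ (level m y) (fieldOp w ⟨Q, hQd⟩)).im := by
    rw [h1] at h2
    have := congrArg Complex.im h2
    rwa [Complex.im_mul_ofReal, Complex.add_im, h4, zero_add] at this
  calc |z.im| * ‖P‖ ^ 2 = |(inner ℂ (level m y) (fieldOp w ⟨Q, hQd⟩)).im| := by
        rw [← h5, abs_mul, abs_of_nonneg (sq_nonneg ‖P‖)]
    _ ≤ ‖level m y‖ * ‖fieldOp w ⟨Q, hQd⟩‖ :=
        (Complex.abs_im_le_norm _).trans (norm_inner_le_norm _ _)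
    _ ≤ ‖level m y‖ * (2 * Real.sqrt ((m + 1 : ℕ) + 1) * (∑' x, ‖w x‖) * ‖Q‖) := by
        gcongr
        exact norm_fieldOp_le hw (level_mem_upTo (m + 1) y) hQd
    _ = _ := by ring

/-- The field operator has no non-real eigenvalues on its maximal domain. By Carleman's argument: the
boundary terms grow at most like `√m`, and `∑ 1 / √m` diverges. -/
theorem eq_zero_of_fieldOp_eigenvector {w : L → ℂ} (hw : Summable fun x => ‖w x‖)
    (hsym : ∀ ψ ∈ finiteVectors L, ∀ h : ψ ∈ (fieldOp w).domain,
      (inner ℂ ψ (fieldOp w ⟨ψ, h⟩)).im = 0)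
    {z : ℂ} (hz : z.im ≠ 0) {χ : FockSpace L} (hχ : (χ, z • χ) ∈ (fieldOp w).graph) : χ = 0 := by
  by_contra hne
  have hex : ∃ n, (χ : (L →₀ ℕ) → ℂ) n ≠ 0 := by
    by_contra h
    push Not at h
    exact hne (by ext n; exact h n)
  obtain ⟨n₀, hn₀⟩ := hex
  set c : ℝ := ‖(χ : (L →₀ ℕ) → ℂ) n₀‖ with hc
  have hc0 : 0 < c := norm_pos_iff.2 hn₀
  set W : ℝ := ∑' x, ‖w x‖ with hW
  have hW0 : 0 ≤ W := tsum_nonneg fun _ => norm_nonneg _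
  have hz' : 0 < |z.im| := abs_pos.2 hz
  set d := n₀.degree with hd
  have hlow : ∀ m, d ≤ m → c ≤ ‖truncate m χ‖ := fun m hm => by
    rw [hc, ← truncate_apply_of_le χ hm]
    exact lp.norm_apply_le_norm (by simp) _ n₀
  have hS : Summable fun m => ‖level (m + 1) χ‖ * ‖level (m + 1 + 1) χ‖ := by
    have h1 := summable_norm_sq_level χ
    refine Summable.of_nonneg_of_le (fun _ => by positivity) (fun m => ?_)
      (h1.add ((summable_nat_add_iff 1).2 h1))
    nlinarith [sq_nonneg (‖level (m + 1) χ‖ - ‖level (m + 1 + 1) χ‖),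
      sq_nonneg ‖level (m + 1) χ‖, sq_nonneg ‖level (m + 1 + 1) χ‖]
  have hS' : Summable fun m : ℕ => (1 : ℝ) / ((m + (d + 3) : ℕ) : ℝ) := by
    have h2 := ((summable_nat_add_iff d).2 hS).mul_left ((|z.im| * c ^ 2)⁻¹ * (2 * W))
    refine Summable.of_nonneg_of_le (fun _ => by positivity) (fun m => ?_) h2
    have h3 := abs_im_mul_norm_truncate_sq_le hw hsym hχ (m + d + 1)
    have h4 : |z.im| * c ^ 2 ≤ |z.im| * ‖truncate (m + d + 1) χ‖ ^ 2 := by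
      gcongr
      exact hlow _ (by lia)
    set s : ℝ := Real.sqrt (((m + d + 1 + 1 : ℕ) : ℝ) + 1) with hs
    have hs1 : s ≤ ((m + (d + 3) : ℕ) : ℝ) := by
      have e : (((m + d + 1 + 1 : ℕ) : ℝ) + 1) = ((m + (d + 3) : ℕ) : ℝ) := by
        push_cast
        ring
      rw [hs, e]
      refine Real.sqrt_le_iff.2 ⟨Nat.cast_nonneg _, ?_⟩
      have : (1 : ℝ) ≤ ((m + (d + 3) : ℕ) : ℝ) := Nat.one_le_cast.2 (by lia)
      nlinarith
    have hs0 : 0 < s := Real.sqrt_pos.2 (by positivity)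
    have hl : 0 ≤ ‖level (m + d + 1) χ‖ * ‖level (m + d + 1 + 1) χ‖ := by positivity
    have h5 : |z.im| * c ^ 2
        ≤ 2 * s * W * (‖level (m + d + 1) χ‖ * ‖level (m + d + 1 + 1) χ‖) := h4.trans h3
    have hK : 0 < |z.im| * c ^ 2 := by positivity
    calc (1 : ℝ) / ((m + (d + 3) : ℕ) : ℝ) ≤ 1 / s := by gcongr
      _ ≤ (|z.im| * c ^ 2)⁻¹ * (2 * W)
          * (‖level (m + d + 1) χ‖ * ‖level (m + d + 1 + 1) χ‖) := by
        rw [div_le_iff₀ hs0, mul_assoc, mul_assoc, ← div_eq_inv_mul, le_div_iff₀ hK]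
        linarith
  exact Real.not_summable_one_div_natCast
    ((summable_nat_add_iff (f := fun n : ℕ => (1 : ℝ) / (n : ℝ)) (d + 3)).1 hS')

end FieldSelfAdjoint

/-! ### Resolvents of the boson field -/

section FieldResolvents

variable {L : Type*}

theorem isSelfAdjoint_transport_fluct (θ φ : L → ℝ) {N : ℕ}
    (V : SpinSpace L N →ₗᵢ[ℂ] FockSpace L) (v : L1Three L) :
    IsSelfAdjoint (transport V (fluct θ φ N v)) :=
  isSelfAdjoint_transport (isSelfAdjoint_fluct θ φ N v)

/-- A single fluctuation operator converges to the field on number-bounded vectors. -/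
theorem tendsto_transport_fluct {θ φ : L → ℝ}
    {V : (N : ℕ) → SpinSpace L N →ₗᵢ[ℂ] FockSpace L}
    (hV : ∀ N : ℕ, 0 < N → IsDyson θ φ N (V N)) (v : L1Three L)
    {N : ℕ → ℕ} (hN : Tendsto N atTop atTop) {ψ : FockSpace L} (hψ : ψ ∈ finiteVectors L)
    (h : ψ ∈ (fieldOp (tangent θ φ v)).domain) :
    Tendsto (fun m => transport (V (N m)) (fluct θ φ (N m) v) ψ) atTop
      (𝓝 (fieldOp (tangent θ φ v) ⟨ψ, h⟩)) := by
  obtain ⟨h', ht⟩ := tendsto_fluctProd hV (fun _ : Fin 1 => v) hN hψ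
  obtain ⟨h'', he⟩ := fieldProd_succ_apply (w := fun _ : Fin 1 => tangent θ φ v) (ψ := ψ) trivial h
  have e1 : (fieldProd fun _ : Fin 1 => tangent θ φ v) ⟨ψ, h'⟩
      = fieldOp (tangent θ φ v) ⟨ψ, h⟩ := he
  rw [e1] at ht
  simpa [fluctProd] using ht

/-- The field has real expectation values, being a limit of self-adjoint operators. -/
theorem im_inner_fieldOp {θ φ : L → ℝ}
    {V : (N : ℕ) → SpinSpace L N →ₗᵢ[ℂ] FockSpace L}
    (hV : ∀ N : ℕ, 0 < N → IsDyson θ φ N (V N)) (v : L1Three L) :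
    ∀ ψ ∈ finiteVectors L, ∀ h : ψ ∈ (fieldOp (tangent θ φ v)).domain,
      (inner ℂ ψ (fieldOp (tangent θ φ v) ⟨ψ, h⟩)).im = 0 := fun ψ hψ h => by
  have ht := tendsto_transport_fluct hV v tendsto_id hψ h
  have h1 := (Complex.continuous_im.tendsto _).comp ((tendsto_const_nhds (x := ψ)).inner ht (𝕜 := ℂ))
  refine tendsto_nhds_unique h1 ?_
  refine tendsto_const_nhds.congr fun m => ?_
  exact (im_inner_selfAdjoint (isSelfAdjoint_transport_fluct θ φ _ v) ψ).symm

/-- The boson field is the strong resolvent limit of the fluctuation operators. -/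
theorem strongResolventTendsto_fieldOp {θ φ : L → ℝ}
    {V : (N : ℕ) → SpinSpace L N →ₗᵢ[ℂ] FockSpace L}
    (hV : ∀ N : ℕ, 0 < N → IsDyson θ φ N (V N)) (v : L1Three L)
    {N : ℕ → ℕ} (hN : Tendsto N atTop atTop) :
    StrongResolventTendsto (fun m => transport (V (N m)) (fluct θ φ (N m) v))
      (fieldOp (tangent θ φ v)) := by
  have hw := summable_norm_tangent θ φ v
  have hsym := im_inner_fieldOp hV v
  have hA := fun m => isSelfAdjoint_transport_fluct θ φ (V (N m)) v
  refine strongResolventTendsto_of_tendsto hA fun z hz => ?_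
  set T₀ := (fieldOp (tangent θ φ v)).domRestrict (finiteVectors L) with hT₀
  have hle : T₀ ≤ fieldOp (tangent θ φ v) := LinearPMap.domRestrict_le
  have hval : ∀ ψ : T₀.domain, T₀ ψ = fieldOp (tangent θ φ v) ⟨ψ, ψ.2.2⟩ := fun ψ => rfl
  choose R hR hRn using fun m => exists_isResolvent_of_isSelfAdjoint (hA m) hz
  have hconv : ∀ ψ : T₀.domain,
      Tendsto (fun m => transport (V (N m)) (fluct θ φ (N m) v) ψ) atTop (𝓝 (T₀ ψ)) := fun ψ => by
    rw [hval]
    exact tendsto_transport_fluct hV v hN ψ.2.1 ψ.2.2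
  have hd : Dense (shiftRange T₀ z : Set (FockSpace L)) := by
    refine dense_shiftRange_iff.2 fun χ hχ => ?_
    refine eq_zero_of_fieldOp_eigenvector hw hsym (z := conj z) (by simpa using hz) ?_
    refine (mem_graph_fieldOp hw).2 fun n => ?_
    have hmem : fockBasis n ∈ T₀.domain :=
      ⟨mem_finiteVectors.2 ⟨_, fockBasis_mem_upTo n⟩, fockBasis_mem_fieldDomain hw n⟩
    have h1 := hχ ⟨fockBasis n, hmem⟩
    rw [hval, inner_sub_left, inner_smul_left, sub_eq_zero, inner_fockBasis] at h1
    exact h1.symm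
  obtain ⟨R', h1, h2, h3⟩ := exists_tendsto_resolvent hR hRn hconv hd
  have hgraph : ∀ ψ, (R' ψ, ψ + z • R' ψ) ∈ (fieldOp (tangent θ φ v)).graph := fun ψ =>
    closure_minimal (LinearPMap.le_graph_of_le hle) (isClosed_graph_fieldOp hw) (h3 ψ)
  refine ⟨R, R', hR, isResolvent_of_graph hgraph fun ψ => ?_, h1⟩
  -- `A - z` maps both sides to the same vector and is injective on the maximal domain
  set η := fieldOp (tangent θ φ v) ψ - z • (ψ : FockSpace L) with hη
  have hdiff := Submodule.sub_mem _ (hgraph η) ((fieldOp (tangent θ φ v)).mem_graph ψ)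
  rw [← sub_eq_zero]
  refine eq_zero_of_fieldOp_eigenvector hw hsym hz ?_
  convert hdiff using 1
  refine Prod.ext rfl ?_
  simp only [Prod.snd_sub, hη, smul_sub]
  abel

theorem fluctProd_const (θ φ : L → ℝ) {N : ℕ} (V : SpinSpace L N →ₗᵢ[ℂ] FockSpace L) (k : ℕ)
    (v : L1Three L) :
    fluctProd θ φ V (fun _ : Fin k => v) = transport V (fluct θ φ N v) ^ k := by
  rw [fluctProd, List.ofFn_const, List.prod_replicate]

theorem strongResolventTendsto_fluctProd_const {θ φ : L → ℝ}
    {V : (N : ℕ) → SpinSpace L N →ₗᵢ[ℂ] FockSpace L}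
    (hV : ∀ N : ℕ, 0 < N → IsDyson θ φ N (V N)) {k : ℕ} (v : Fin k → L1Three L)
    (hv : ∀ i j, v i = v j) {N : ℕ → ℕ} (hN : Tendsto N atTop atTop) :
    StrongResolventTendsto (fun m => fluctProd θ φ (V (N m)) v)
      (fieldProd fun j => tangent θ φ (v j)) := by
  obtain ⟨v₀, rfl⟩ : ∃ v₀, v = fun _ => v₀ := by
    cases k with
    | zero => exact ⟨0, Subsingleton.elim _ _⟩
    | succ k => exact ⟨v 0, funext fun j => hv j 0⟩
  simp only [fluctProd_const]
  exact (strongResolventTendsto_fieldOp hV v₀ hN).natProd_const k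

/-! ### The finite-particle domain -/

theorem fockBasis_zero_mem_allFiniteParticle : fockBasis (0 : L →₀ ℕ) ∈ allFiniteParticle L :=
  Submodule.mem_iSup_of_mem 0 (Submodule.subset_span ⟨Fin.elim0, fun j => j.elim0, trivial, rfl⟩)

theorem fieldOp_mem_allFiniteParticle {w : L → ℂ} (hw : Summable fun x => ‖w x‖)
    (hw2 : Memℓp (E := fun _ : L => ℂ) w 2) {ψ : FockSpace L} (hψ : ψ ∈ allFiniteParticle L) :
    ∃ η ∈ allFiniteParticle L, (ψ, η) ∈ (fieldOp w).graph := by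
  refine Submodule.iSup_induction (motive := fun ψ => ∃ η ∈ allFiniteParticle L,
    (ψ, η) ∈ (fieldOp w).graph) _ hψ (fun n χ hχ => ?_) ⟨0, zero_mem _, zero_mem _⟩ ?_
  · refine Submodule.span_induction (p := fun χ _ => ∃ η ∈ allFiniteParticle L,
      (χ, η) ∈ (fieldOp w).graph) ?_ ⟨0, zero_mem _, zero_mem _⟩ ?_ ?_ hχ
    · rintro χ ⟨u, hu, h, rfl⟩
      have hmem : fieldProd u ⟨fockBasis 0, h⟩ ∈ finiteParticle L n :=
        Submodule.subset_span ⟨u, hu, h, rfl⟩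
      have hd := upTo_le_fieldDomain hw _ (finiteParticle_le_upTo n hmem)
      refine ⟨fieldOp w ⟨_, hd⟩, ?_, (fieldOp w).mem_graph ⟨_, hd⟩⟩
      obtain ⟨h', he⟩ := fieldProd_succ_apply (w := Fin.cons w u) (ψ := fockBasis 0) h hd
      refine Submodule.mem_iSup_of_mem (n + 1) (Submodule.subset_span
        ⟨Fin.cons w u, fun j => ?_, h', he⟩)
      refine Fin.cases ?_ (fun i => ?_) j
      · simpa using hw2
      · simpa using hu i
    · rintro χ₁ χ₂ - - ⟨η₁, h1, g1⟩ ⟨η₂, h2, g2⟩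
      exact ⟨η₁ + η₂, add_mem h1 h2, add_mem g1 g2⟩
    · rintro c χ - ⟨η, h, g⟩
      exact ⟨c • η, Submodule.smul_mem _ c h, Submodule.smul_mem _ c g⟩
  · rintro χ₁ χ₂ ⟨η₁, h1, g1⟩ ⟨η₂, h2, g2⟩
    exact ⟨η₁ + η₂, add_mem h1 h2, add_mem g1 g2⟩

open Classical in
/-- `F(δₓ) φ̃_k = √(kₓ + 1) φ̃_{k + δₓ} + √kₓ φ̃_{k - δₓ}`. -/
theorem graph_fieldOp_single (x : L) (k : L →₀ ℕ) {η : FockSpace L}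
    (h : (fockBasis k, η) ∈ (fieldOp (Pi.single x (1 : ℂ))).graph) :
    η = ((Real.sqrt (k x + 1) : ℝ) : ℂ) • fockBasis (k + Finsupp.single x 1)
      + ((Real.sqrt (k x) : ℝ) : ℂ) • fockBasis (k - Finsupp.single x 1) := by
  obtain ⟨⟨y, hy⟩, h1, h2⟩ := (LinearPMap.mem_graph_iff _).1 h
  dsimp only at h1 h2
  subst h1
  rw [← h2]
  ext n
  rw [fieldOp_apply]
  change ∑' y, fieldTerm (Pi.single x 1) (fockBasis k) n y = _
  rw [tsum_eq_single x]
  · rw [fieldTerm_fockBasis, lp.coeFn_add, lp.coeFn_smul, lp.coeFn_smul]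
    simp only [Pi.add_apply, Pi.smul_apply, fockBasis_apply, Pi.single_eq_same, map_one, one_mul,
      smul_eq_mul]
  · intro y hy
    rw [fieldTerm, Pi.single_eq_of_ne hy]
    simp

/-- By induction on the number of bosons: `F(δₓ)` applied to the basis vector with one boson less at
`x` gives the wanted vector and one with two bosons less. -/
theorem fockBasis_mem_allFiniteParticle (n : L →₀ ℕ) : fockBasis n ∈ allFiniteParticle L := by
  classical
  induction hd : n.degree using Nat.strong_induction_on generalizing n with
  | _ d ih =>
    by_cases h0 : n = 0
    · subst h0
      exact fockBasis_zero_mem_allFiniteParticle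
    obtain ⟨x, hx⟩ := Finsupp.ne_iff.1 h0
    have hx' : n x ≠ 0 := hx
    set k := n - Finsupp.single x 1 with hk
    have hkn : k + Finsupp.single x 1 = n := sub_single_add hx'
    have hkd : k.degree + 1 = n.degree := degree_sub_single hx'
    have hfin : (Function.support (Pi.single x (1 : ℂ) : L → ℂ)).Finite :=
      (Set.finite_singleton x).subset fun y hy => by
        by_contra hne
        exact hy (Pi.single_eq_of_ne hne _)
    have hw : Summable fun y => ‖(Pi.single x (1 : ℂ) : L → ℂ) y‖ :=
      summable_of_hasFiniteSupport (hfin.subset fun y hy h => hy (by simp [h]))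
    have hw2 : Memℓp (E := fun _ : L => ℂ) (Pi.single x (1 : ℂ) : L → ℂ) 2 :=
      memℓp_two_iff.2 (summable_of_hasFiniteSupport (hfin.subset fun y hy h => hy (by simp [h])))
    obtain ⟨η, hη, hg⟩ := fieldOp_mem_allFiniteParticle hw hw2 (ih _ (by lia) k rfl)
    have e := graph_fieldOp_single x k hg
    rw [hkn] at e
    have hlow : ((Real.sqrt (k x) : ℝ) : ℂ) • fockBasis (k - Finsupp.single x 1)
        ∈ allFiniteParticle L := by
      by_cases hkx : k x = 0
      · rw [hkx]
        simp
      · have := degree_sub_single hkx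
        exact Submodule.smul_mem _ _ (ih _ (by lia) _ rfl)
    have hs : ((Real.sqrt (k x + 1) : ℝ) : ℂ) ≠ 0 :=
      Complex.ofReal_ne_zero.2 (Real.sqrt_pos.2 (by positivity)).ne'
    have e2 : ((Real.sqrt (k x + 1) : ℝ) : ℂ) • fockBasis n ∈ allFiniteParticle L := by
      rw [← sub_eq_iff_eq_add] at e
      rw [← e]
      exact sub_mem hη hlow
    exact ((allFiniteParticle L).smul_mem_iff hs).1 e2

theorem dense_allFiniteParticle : Dense (allFiniteParticle L : Set (FockSpace L)) := by
  rw [Submodule.dense_iff_topologicalClosure_eq_top, Submodule.topologicalClosure_eq_top_iff,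
    Submodule.eq_bot_iff]
  intro χ hχ
  ext n
  rw [← inner_fockBasis]
  exact (Submodule.mem_orthogonal _ _).1 hχ _ (fockBasis_mem_allFiniteParticle n)

theorem fieldProdCore_domain {θ φ : L → ℝ} {k : ℕ} (v : Fin k → L1Three L) :
    (fieldProdCore fun j => tangent θ φ (v j)).domain = allFiniteParticle L := by
  refine le_antisymm inf_le_left fun ψ hψ => ⟨hψ, ?_⟩
  obtain ⟨n, hn⟩ := mem_finiteVectors.1 (allFiniteParticle_le hψ)
  exact (exists_fieldProd_bound (fun j => summable_norm_tangent θ φ (v j)) hn).1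

theorem tendsto_fluctProd_core {θ φ : L → ℝ}
    {V : (N : ℕ) → SpinSpace L N →ₗᵢ[ℂ] FockSpace L}
    (hV : ∀ N : ℕ, 0 < N → IsDyson θ φ N (V N)) {k : ℕ} (v : Fin k → L1Three L)
    {N : ℕ → ℕ} (hN : Tendsto N atTop atTop)
    (ψ : (fieldProdCore fun j => tangent θ φ (v j)).domain) :
    Tendsto (fun m => fluctProd θ φ (V (N m)) v ψ) atTop
      (𝓝 ((fieldProdCore fun j => tangent θ φ (v j)) ψ)) := by
  obtain ⟨_, ht⟩ := tendsto_fluctProd hV v hN (allFiniteParticle_le ψ.2.1)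
  exact ht

theorem inner_list_prod_selfAdjoint {E : Type*} [NormedAddCommGroup E] [InnerProductSpace ℂ E]
    [CompleteSpace E] (l : List (E →L[ℂ] E)) (hl : ∀ A ∈ l, IsSelfAdjoint A) (ψ χ : E) :
    inner ℂ (l.reverse.prod ψ) χ = inner ℂ ψ (l.prod χ) := by
  induction l generalizing χ ψ with
  | nil => rfl
  | cons A l ih =>
    rw [List.reverse_cons, List.prod_append, List.prod_singleton, List.prod_cons,
      mul_apply_eq_comp, mul_apply_eq_comp, ih fun B hB => hl B (List.mem_cons_of_mem _ hB),
      inner_selfAdjoint (hl A List.mem_cons_self)]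

/-- The adjoint of a product of self-adjoint operators is the product in the reverse order. -/
theorem inner_fluctProd_rev (θ φ : L → ℝ) {N : ℕ} (V : SpinSpace L N →ₗᵢ[ℂ] FockSpace L) {k : ℕ}
    (v : Fin k → L1Three L) (ψ χ : FockSpace L) :
    inner ℂ (fluctProd θ φ V (fun j => v j.rev) ψ) χ = inner ℂ ψ (fluctProd θ φ V v χ) := by
  have h : (List.ofFn fun j => transport V (fluct θ φ N (v j.rev)))
      = (List.ofFn fun j => transport V (fluct θ φ N (v j))).reverse := by
    refine List.ext_getElem (by simp) fun i h1 h2 => ?_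
    simp only [List.getElem_ofFn, List.getElem_reverse, List.length_ofFn]
    congr 3
    ext
    simp [Fin.val_rev]
    lia
  rw [fluctProd, h]
  refine inner_list_prod_selfAdjoint _ (fun A hA => ?_) ψ χ
  obtain ⟨j, rfl⟩ := List.mem_ofFn.1 hA
  exact isSelfAdjoint_transport_fluct θ φ V (v j)

/-- The product of fields in the reverse order is a densely defined formal adjoint. -/
theorem isClosable_fieldProdCore {θ φ : L → ℝ}
    {V : (N : ℕ) → SpinSpace L N →ₗᵢ[ℂ] FockSpace L}
    (hV : ∀ N : ℕ, 0 < N → IsDyson θ φ N (V N)) {k : ℕ} (v : Fin k → L1Three L) :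
    (fieldProdCore fun j => tangent θ φ (v j)).IsClosable := by
  refine isClosable_of_formalAdjoint (S := fieldProdCore fun j => tangent θ φ (v j.rev)) ?_
    fun ψ χ => ?_
  · rw [fieldProdCore_domain fun j => v j.rev]
    exact dense_allFiniteParticle
  · have h1 := tendsto_fluctProd_core hV (fun j => v j.rev) tendsto_id ψ
    have h2 := tendsto_fluctProd_core hV v tendsto_id χ
    refine tendsto_nhds_unique (h1.inner (𝕜 := ℂ) tendsto_const_nhds) ?_
    refine (tendsto_const_nhds.inner h2).congr fun m => ?_
    exact (inner_fluctProd_rev θ φ _ v _ _).symm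

end FieldResolvents

end SpinCLT

end

theorem mainTheorem2 {L : Type*} (θ φ : L → ℝ) :
    (∀ N : ℕ, 0 < N →
      ∃! V : SpinCLT.SpinSpace L N →ₗᵢ[ℂ] SpinCLT.FockSpace L, SpinCLT.IsDyson θ φ N V) ∧
    ∀ V : (N : ℕ) → SpinCLT.SpinSpace L N →ₗᵢ[ℂ] SpinCLT.FockSpace L,
      (∀ N : ℕ, 0 < N → SpinCLT.IsDyson θ φ N (V N)) →
      ∀ (k : ℕ) (v : Fin k → SpinCLT.L1Three L),
        -- the quantitative bound on the spaces `𝒟_n`, for `2J = N > n + k`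
        (∀ (n N : ℕ), n + k < N → ∀ ψ ∈ SpinCLT.finiteParticle L n,
          ∃ h : ψ ∈ (SpinCLT.fieldProd fun j => SpinCLT.tangent θ φ (v j)).domain,
            ‖(SpinCLT.fieldProd fun j => SpinCLT.tangent θ φ (v j)) ⟨ψ, h⟩
                - SpinCLT.fluctProd θ φ (V N) v ψ‖
              ≤ 1 / Real.sqrt (N : ℝ) * (∏ j, ‖v j‖)
                  * Real.sqrt (((n + k).factorial : ℝ) / (n.factorial : ℝ))
                  * (∑ i ∈ Finset.Icc 1 k,
                      (2 : ℝ) ^ (k + i) * Real.sqrt ((n : ℝ) + (k : ℝ) - (i : ℝ)))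
                  * ‖ψ‖) ∧
        -- convergence along any sequence of spins `J = N m / 2` tending to infinity
        ∀ N : ℕ → ℕ, (∀ m, 0 < N m) → Tendsto N atTop atTop →
          -- strong convergence on the common domain `𝒟`
          (∀ ψ ∈ SpinCLT.allFiniteParticle L,
            ∃ h : ψ ∈ (SpinCLT.fieldProd fun j => SpinCLT.tangent θ φ (v j)).domain,
              Tendsto (fun m => SpinCLT.fluctProd θ φ (V (N m)) v ψ) atTop
                (𝓝 ((SpinCLT.fieldProd fun j => SpinCLT.tangent θ φ (v j)) ⟨ψ, h⟩))) ∧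
          -- equal factors (in particular `k = 1`): strong resolvent convergence
          ((∀ i j, v i = v j) →
            SpinCLT.StrongResolventTendsto (fun m => SpinCLT.fluctProd θ φ (V (N m)) v)
              (SpinCLT.fieldProd fun j => SpinCLT.tangent θ φ (v j))) ∧
          -- self-adjoint products: strong resolvent convergence
          ((∀ m, IsSelfAdjoint (SpinCLT.fluctProd θ φ (V (N m)) v)) →
            IsSelfAdjoint (SpinCLT.fieldProdCore fun j => SpinCLT.tangent θ φ (v j)).closure →
            SpinCLT.StrongResolventTendsto (fun m => SpinCLT.fluctProd θ φ (V (N m)) v)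
              (SpinCLT.fieldProdCore fun j => SpinCLT.tangent θ φ (v j)).closure) ∧
          -- arbitrary products: strong convergence of the resolvents wherever they are bounded
          (∀ (z : ℂ) (R : ℕ → SpinCLT.FockSpace L →L[ℂ] SpinCLT.FockSpace L) (C : ℝ),
            (∀ m, SpinCLT.IsResolvent
              (SpinCLT.everywhere (SpinCLT.fluctProd θ φ (V (N m)) v)) z (R m)) →
            (∀ m, ‖R m‖ ≤ C) →
            Dense {χ : SpinCLT.FockSpace L |
              ∃ ψ : (SpinCLT.fieldProdCore fun j => SpinCLT.tangent θ φ (v j)).domain,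
                (SpinCLT.fieldProdCore fun j => SpinCLT.tangent θ φ (v j)) ψ
                  - z • (ψ : SpinCLT.FockSpace L) = χ} →
            ∃ R' : SpinCLT.FockSpace L →L[ℂ] SpinCLT.FockSpace L,
              SpinCLT.IsResolvent
                (SpinCLT.fieldProdCore fun j => SpinCLT.tangent θ φ (v j)).closure z R' ∧
              ∀ ψ, Tendsto (fun m => R m ψ) atTop (𝓝 (R' ψ))) := by
  refine ⟨fun N _ => ?_, fun V hV k v => ⟨fun n N hN ψ hψ => ?_, fun N _ hN => ⟨?_, ?_, ?_, ?_⟩⟩⟩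
  · obtain ⟨V, hV⟩ := SpinCLT.exists_isDyson θ φ N
    exact ⟨V, hV, fun W hW => hW.unique hV⟩
  · exact SpinCLT.exists_fieldProd_sub_fluctProd_bound (hV N (by lia)) v hN
      (SpinCLT.finiteParticle_le_upTo n hψ)
  · exact fun ψ hψ => SpinCLT.tendsto_fluctProd hV v hN (SpinCLT.allFiniteParticle_le hψ)
  · exact fun hv => SpinCLT.strongResolventTendsto_fluctProd_const hV v hv hN
  · exact fun hA hT => SpinCLT.strongResolventTendsto_closure hA hT
      (SpinCLT.tendsto_fluctProd_core hV v hN)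
  · intro z R C hR hC hd
    obtain ⟨R', h1, h2, h3⟩ := SpinCLT.exists_tendsto_resolvent hR hC
      (SpinCLT.tendsto_fluctProd_core hV v hN) hd
    exact ⟨R', SpinCLT.isResolvent_closure (SpinCLT.isClosable_fieldProdCore hV v) h2 h3, h1⟩
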